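/- **Setting.** Let $\Omega=\mathbb R\times(0,1)$, $L>0$, and let $\gamma:\Omega\to\mathbb R$ be measurable, positive and bounded, with $\gamma=1$ for $|x|\ge L$. For $k>0$, a *solution* is a function $u$ that is $H^1$ on bounded parts of $\Omega$ and solves weakly $$\Delta u+k^2\gamma u=0\ \text{in }\Omega,\qquad \partial_yu=0\ \text{on }y=0\text{ and }y=1. \tag{1}$$ A *trapped mode* is a non zero solution in $L^2(\Omega)$; $\mathscr K_{\rm t}$ is the set of $k^2$ for which one exists. Let $N\in\mathbb N=\{0,1,\dots\}$, $k\in(N\pi,(N+1)\pi)$, $\beta_n=\sqrt{k^2-n^2\pi^2}$ with $\operatorname{Im}\beta_n\ge0$ (and $\beta_n>0$ for $n\le N$), $\varphi_0=1$, $\varphi_n(y)=\sqrt2\cos(n\pi y)$ for $n\ge1$, and $w_n^\pm(x,y)=(2|\beta_n|)^{-1/2}e^{\pm i\beta_nx}\varphi_n(y)$. An incident field $u_i=\sum_{n=0}^Na_nw_n^+$ *produces* the scattered field $u_s$ if $u_i+u_s$ is a solution of (1) and $u_s=\sum_{p\ge0}b_p^{\pm}w_p^\pm$ for $\pm x\ge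 L$, with convergence in $L^2(0,1)$ on almost every cross-section. The reflection operator $R(k)$ maps $(a_n)_{n\le N}$ to $(b_p^-)_{p\le N}$; $\mathscr K_{\rm r}$ is the set of $k^2$ (with $k\in(0,\infty)\setminus\pi\mathbb N$) such that $\ker R(k)\ne\{0\}$. A *reflectionless mode* is a solution $u$ of (1) with $$u=\sum_{n=0}^Na_nw_n^++\tilde u\ \ (x\le-L),\qquad u=\sum_{n=0}^Nt_nw_n^++\tilde u\ \ (x\ge L),\qquad (a_n)\ne0,$$ where $\tilde u$ decays exponentially for $\pm x\ge L$ (that is, $|\tilde u(x,y)|\le Ce^{-c|x|}$ with $c>0$). For $0<\theta<\pi/2$ let $\mathcal J_\theta(x)=-L+(x+L)e^{-i\theta}$ for $x\le-L$, $\mathcal J_\theta(x)=x$ for $|x|<L$, $\mathcal J_\theta(x)=L+(x-L)e^{i\theta}$ for $x\ge L$, and let $\beta_\theta(x)=e^{i\theta},\,1,\,e^{-i\theta}$ in these three regions respectively. Let $B_\theta$ be the unbounded operator of $L^2(\Omega)$ $$B_\theta w=-\frac1\gamma\Big(\beta_\theta\,\partial_x(\beta_\theta\,\partial_xw)+\partial_y^2w\Big)$$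 with homogeneous Neumann conditions on $\partial\Omega$, defined variationally in $H^1(\Omega)$. For $w_\theta\in L^2(\Omega)$, the *unscaled function* $w_\theta\circ\mathcal J_{-\theta}$ is $w_\theta$ for $|x|<L$ and, for $\pm x>L$, the restriction to real $x$ of the analytic continuation to $\{\pm\operatorname{Re}z>L\}$, in the variable $z=\mathcal J_\theta(x)$, of $w_\theta\circ\mathcal J_\theta^{-1}$. **Proposition.** Let $(k^2,w_\theta)$ be an eigenpair of $B_\theta$ with $k\in(N\pi,(N+1)\pi)$ real. Then $w_\theta$ has a trace $w_\theta(-L,\cdot)\in L^2(0,1)$ and $u=w_\theta\circ\mathcal J_{-\theta}$ is well defined. Set $$\rho(w_\theta)=\sum_{n=0}^N\Big|\int_0^1w_\theta(-L,y)\varphi_n(y)\,dy\Big|^2 .$$ 1. If $\rho(w_\theta)=0$, then $u$ is a trapped mode, and $k^2\in\mathscr K_{\rm t}$. 2. If $\rho(w_\theta)>0$, then $u$ is a reflectionless mode, and $k^2\in\mathscr K_{\rm r}$. In this case let $u_i=\sum_{n=0}^Na_nw_n^+$ with $$a_n=\sqrt{2\beta_n}\,e^{i\beta_nL}\int_0^1w_\theta(-L,y)\varphi_n(y)\,dy,\qquad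 n=0,\dots,N .$$ Then $u_i$ produces the scattered field $u-u_i$, and every scattered field produced by $u_i$ decays exponentially for $x\le-L$. Moreover $(a_n)\neq0$, and $\sum_{n=0}^Na_ns^-_{np}=0$ for all $p\le N$ whenever $(s^-_{np})_{0\le n,p\le N}$ is a reflection matrix, that is, its $n$-th row consists of the coefficients $b_p^-$, $p\le N$, of a scattered field produced by $w_n^+$. -/

import Mathlib

open MeasureTheory Set Filter Topology
open scoped ContDiff

noncomputable section

namespace Waveguide

/-- The waveguide `Ω = ℝ × (0,1)`. -/
def strip : Set (ℝ × ℝ) := {p | 0 < p.2 ∧ p.2 < 1}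

/-- Smooth compactly supported functions on the plane (not required to vanish on `∂Ω`). -/
def IsTest (φ : ℝ × ℝ → ℂ) : Prop := ContDiff ℝ ∞ φ ∧ HasCompactSupport φ

/-- Classical partial derivatives of a function on the plane. -/
def dx (φ : ℝ × ℝ → ℂ) (p : ℝ × ℝ) : ℂ := fderiv ℝ φ p (1, 0)

def dy (φ : ℝ × ℝ → ℂ) (p : ℝ × ℝ) : ℂ := fderiv ℝ φ p (0, 1)

/-- `(ux, uy)` is the weak (distributional) gradient of `u` in `Ω`. -/
def HasWeakGrad (u ux uy : ℝ × ℝ → ℂ) : Prop :=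
  ∀ φ : ℝ × ℝ → ℂ, IsTest φ → tsupport φ ⊆ strip →
    (∫ p in strip, u p * dx φ p) = -(∫ p in strip, ux p * φ p) ∧
    (∫ p in strip, u p * dy φ p) = -(∫ p in strip, uy p * φ p)

/-- `u ∈ H¹(Ω)`, with weak gradient `(ux, uy)`. -/
structure IsH1 (u ux uy : ℝ × ℝ → ℂ) : Prop where
  memLp : MemLp u 2 (volume.restrict strip)
  memLp_x : MemLp ux 2 (volume.restrict strip)
  memLp_y : MemLp uy 2 (volume.restrict strip)
  grad : HasWeakGrad u ux uy

/-- `u` is `H¹` on every bounded piece `(-r,r) × (0,1)` of the waveguide, with weak gradient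
`(ux, uy)`. -/
structure IsH1Loc (u ux uy : ℝ × ℝ → ℂ) : Prop where
  memLp : ∀ r : ℝ, MemLp u 2 (volume.restrict (strip ∩ {p | |p.1| < r}))
  memLp_x : ∀ r : ℝ, MemLp ux 2 (volume.restrict (strip ∩ {p | |p.1| < r}))
  memLp_y : ∀ r : ℝ, MemLp uy 2 (volume.restrict (strip ∩ {p | |p.1| < r}))
  grad : HasWeakGrad u ux uy

/-- `u` solves `Δu + k²γu = 0` in `Ω` with `∂_y u = 0` on `y = 0` and `y = 1` (weak formulation:
the Neumann condition is encoded by test functions that are free on the boundary). -/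
def IsSolution (γ : ℝ × ℝ → ℝ) (k : ℝ) (u : ℝ × ℝ → ℂ) : Prop :=
  ∃ ux uy : ℝ × ℝ → ℂ, IsH1Loc u ux uy ∧
    ∀ v : ℝ × ℝ → ℂ, IsTest v →
      ∫ p in strip, (ux p * dx v p + uy p * dy v p - (k : ℂ) ^ 2 * (γ p : ℂ) * u p * v p) = 0

/-! ### Modes -/

/-- `β_n = √(k² - n²π²)`, with the branch of the square root whose imaginary part is `≥ 0`. -/
def beta (k : ℝ) (n : ℕ) : ℂ :=
  if (n : ℝ) ^ 2 * Real.pi ^ 2 ≤ k ^ 2 then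
    (Real.sqrt (k ^ 2 - (n : ℝ) ^ 2 * Real.pi ^ 2) : ℂ)
  else Complex.I * (Real.sqrt ((n : ℝ) ^ 2 * Real.pi ^ 2 - k ^ 2) : ℂ)

/-- `φ_0 = 1`, `φ_n(y) = √2 cos(nπy)` for `n ≥ 1`. -/
def phi (n : ℕ) (y : ℝ) : ℝ :=
  if n = 0 then 1 else Real.sqrt 2 * Real.cos (n * Real.pi * y)

/-- `w_n^+(x,y) = (2|β_n|)^{-1/2} e^{iβ_n x} φ_n(y)`. -/
def modePlus (k : ℝ) (n : ℕ) (p : ℝ × ℝ) : ℂ :=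
  ((Real.sqrt (2 * ‖beta k n‖))⁻¹ : ℝ) * Complex.exp (Complex.I * beta k n * (p.1 : ℂ)) *
    (phi n p.2 : ℂ)

/-- `w_n^-(x,y) = (2|β_n|)^{-1/2} e^{-iβ_n x} φ_n(y)`. -/
def modeMinus (k : ℝ) (n : ℕ) (p : ℝ × ℝ) : ℂ :=
  ((Real.sqrt (2 * ‖beta k n‖))⁻¹ : ℝ) * Complex.exp (-(Complex.I * beta k n * (p.1 : ℂ))) *
    (phi n p.2 : ℂ)

/-- `f = ∑_p b_p w_p^-` for `x ≤ -L`, the series converging in `L²(0,1)` on almost every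
cross-section. -/
def ExpandsLeft (L k : ℝ) (f : ℝ × ℝ → ℂ) (b : ℕ → ℂ) : Prop :=
  ∀ᵐ x : ℝ, x ≤ -L →
    Tendsto (fun M : ℕ => eLpNorm
      (fun y : ℝ => f (x, y) - ∑ p ∈ Finset.range M, b p * modeMinus k p (x, y)) 2
      (volume.restrict (Ioo (0 : ℝ) 1))) atTop (𝓝 0)

/-- `f = ∑_p b_p w_p^+` for `x ≥ L`, the series converging in `L²(0,1)` on almost every
cross-section. -/
def ExpandsRight (L k : ℝ) (f : ℝ × ℝ → ℂ) (b : ℕ → ℂ) : Prop :=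
  ∀ᵐ x : ℝ, L ≤ x →
    Tendsto (fun M : ℕ => eLpNorm
      (fun y : ℝ => f (x, y) - ∑ p ∈ Finset.range M, b p * modePlus k p (x, y)) 2
      (volume.restrict (Ioo (0 : ℝ) 1))) atTop (𝓝 0)

/-- `f` decays exponentially for `x ≤ -L`. -/
def ExpDecayLeft (L : ℝ) (f : ℝ × ℝ → ℂ) : Prop :=
  ∃ C c : ℝ, 0 < c ∧ ∀ᵐ p ∂(volume.restrict strip), p.1 ≤ -L →
    ‖f p‖ ≤ C * Real.exp (-(c * |p.1|))

/-- `f` decays exponentially for `x ≥ L`. -/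
def ExpDecayRight (L : ℝ) (f : ℝ × ℝ → ℂ) : Prop :=
  ∃ C c : ℝ, 0 < c ∧ ∀ᵐ p ∂(volume.restrict strip), L ≤ p.1 →
    ‖f p‖ ≤ C * Real.exp (-(c * |p.1|))

/-! ### Trapped modes, scattering, reflectionless modes -/

/-- Trapped modes: non zero `L²(Ω)` solutions of the homogeneous problem. -/
structure IsTrappedMode (γ : ℝ × ℝ → ℝ) (k : ℝ) (u : ℝ × ℝ → ℂ) : Prop where
  solution : IsSolution γ k u
  memLp : MemLp u 2 (volume.restrict strip)
  ne_zero : ¬ u =ᵐ[volume.restrict strip] 0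

/-- The set `K_t` of the `k²` for which trapped modes exist. -/
def trappedSet (γ : ℝ × ℝ → ℝ) : Set ℝ :=
  {l | ∃ k : ℝ, 0 < k ∧ l = k ^ 2 ∧ ∃ u, IsTrappedMode γ k u}

/-- Incident field `∑_{n ≤ N} a_n w_n^+`. -/
def incident (k : ℝ) {N : ℕ} (a : Fin (N + 1) → ℂ) (p : ℝ × ℝ) : ℂ :=
  ∑ n : Fin (N + 1), a n * modePlus k n p

/-- `us` is an outgoing scattered field produced by the incident field with coefficients `a`:
`u_i + us` solves the problem, and `us = ∑ b_p^± w_p^±` for `±x ≥ L`. -/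
structure IsScatteredField (γ : ℝ × ℝ → ℝ) (L k : ℝ) {N : ℕ} (a : Fin (N + 1) → ℂ)
    (us : ℝ × ℝ → ℂ) (bm bp : ℕ → ℂ) : Prop where
  solution : IsSolution γ k (fun p => incident k a p + us p)
  left : ExpandsLeft L k us bm
  right : ExpandsRight L k us bp

/-- The reflection operator `R(k)`, as a graph: the pairs `(a, (b_p^-)_{p ≤ N})` of incident and
reflected propagating amplitudes. -/
def reflectionGraph (γ : ℝ × ℝ → ℝ) (L k : ℝ) (N : ℕ) :
    Set ((Fin (N + 1) → ℂ) × (Fin (N + 1) → ℂ)) :=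
  {ab | ∃ us bm bp, IsScatteredField γ L k ab.1 us bm bp ∧ ∀ p : Fin (N + 1), ab.2 p = bm p}

/-- `R` is the reflection matrix `(s_{np}^-)_{0 ≤ n,p ≤ N}`: its `n`-th row consists of the
reflected propagating amplitudes for the incident wave `w_n^+`. With this convention `R(k)` maps
the amplitudes `a` to the row vector `a R`. -/
def IsReflectionMatrix (γ : ℝ × ℝ → ℝ) (L k : ℝ) (N : ℕ)
    (R : Matrix (Fin (N + 1)) (Fin (N + 1)) ℂ) : Prop :=
  ∀ n, (Pi.single n 1, R n) ∈ reflectionGraph γ L k N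

/-- The set `K_r` of the `k²` for which `k` is reflectionless, that is `ker R(k) ≠ {0}`. -/
def reflectionlessSet (γ : ℝ × ℝ → ℝ) (L : ℝ) : Set ℝ :=
  {l | ∃ (N : ℕ) (k : ℝ), N * Real.pi < k ∧ k < (N + 1) * Real.pi ∧ l = k ^ 2 ∧
    ∃ a, a ≠ 0 ∧ (a, 0) ∈ reflectionGraph γ L k N}

/-- Reflectionless modes: solutions that are, up to exponentially decaying terms,
`∑_{n ≤ N} a_n w_n^+` for `x ≤ -L` with `a ≠ 0` and `∑_{n ≤ N} t_n w_n^+` for `x ≥ L`. -/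
def IsReflectionlessMode (γ : ℝ × ℝ → ℝ) (L k : ℝ) (N : ℕ) (u : ℝ × ℝ → ℂ) : Prop :=
  IsSolution γ k u ∧ ∃ a t : Fin (N + 1) → ℂ, a ≠ 0 ∧
    ExpDecayLeft L (fun p => u p - incident k a p) ∧
    ExpDecayRight L (fun p => u p - incident k t p)

/-! ### Conjugated complex scaling -/

/-- The complex change of variable `J_θ`. -/
def scalingMap (L θ x : ℝ) : ℂ :=
  if x ≤ -L then -(L : ℂ) + ((x : ℂ) + L) * Complex.exp (-(Complex.I * θ))
  else if L ≤ x then (L : ℂ) + ((x : ℂ) - L) * Complex.exp (Complex.I * θ)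
  else (x : ℂ)

/-- The coefficient `β_θ`: `e^{iθ}` for `x ≤ -L`, `1` for `|x| < L`, `e^{-iθ}` for `x ≥ L`. -/
def scalingCoeff (L θ x : ℝ) : ℂ :=
  if x ≤ -L then Complex.exp (Complex.I * θ)
  else if L ≤ x then Complex.exp (-(Complex.I * θ))
  else 1

/-- `w` belongs to the domain of the unbounded operator
`B_θ w = -γ⁻¹ (β_θ ∂_x (β_θ ∂_x w) + ∂_y² w)` of `L²(Ω)`, with homogeneous Neumann boundary
conditions, and `B_θ w = f`. After multiplication by `γ β_θ⁻¹` the equation is in divergence form;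
it is understood variationally in `H¹(Ω)`. -/
def OpB (γ : ℝ × ℝ → ℝ) (L θ : ℝ) (w f : ℝ × ℝ → ℂ) : Prop :=
  MemLp f 2 (volume.restrict strip) ∧
  ∃ wx wy, IsH1 w wx wy ∧ ∀ v vx vy, IsH1 v vx vy →
    (∫ p in strip, (scalingCoeff L θ p.1 * wx p * vx p + (scalingCoeff L θ p.1)⁻¹ * wy p * vy p))
      = ∫ p in strip, (γ p : ℂ) * (scalingCoeff L θ p.1)⁻¹ * f p * v p

/-- `(l, w)` is an eigenpair of `B_θ`. -/
def IsEigenpairB (γ : ℝ × ℝ → ℝ) (L θ : ℝ) (l : ℂ) (w : ℝ × ℝ → ℂ) : Prop :=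
  OpB γ L θ w (fun p => l * w p) ∧ ¬ w =ᵐ[volume.restrict strip] 0

/-- `u` is the unscaled function `w ∘ J_θ⁻¹ = w ∘ J_{-θ}`: `w(x,y) = U(J_θ(x),y)` and
`u(x,y) = U(x,y)`, where `U(·,y)` is the analytic continuation of `w ∘ J_θ⁻¹` from the two complex
half-lines of `J_θ(ℝ)` to the half-planes `Re z < -L` and `Re z > L`, which contain the real
half-lines. For `|x| < L` one has `u = w`. Functions are understood up to null sets. -/
def IsUnscaled (L θ : ℝ) (w u : ℝ × ℝ → ℂ) : Prop :=
  ∃ U : ℂ → ℝ → ℂ,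
    (∀ y ∈ Ioo (0 : ℝ) 1, DifferentiableOn ℂ (fun z => U z y) {z | L < |z.re|}) ∧
    (∀ᵐ p ∂(volume.restrict strip), w p = U (scalingMap L θ p.1) p.2) ∧
    (∀ᵐ p ∂(volume.restrict strip), u p = U (p.1 : ℂ) p.2)

/-- `τ ∈ L²(0,1)` is the trace `w(c,·)` of `w ∈ H¹(Ω)` on the cross-section `x = c`, defined by
Green's formula in `{x < c}`. -/
def IsTraceAt (c : ℝ) (w : ℝ × ℝ → ℂ) (τ : ℝ → ℂ) : Prop :=
  MemLp τ 2 (volume.restrict (Ioo (0 : ℝ) 1)) ∧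
  ∃ wx wy, IsH1 w wx wy ∧ ∀ φ, IsTest φ →
    (∫ p in strip ∩ {p | p.1 < c}, (w p * dx φ p + wx p * φ p))
      = ∫ y in Ioo (0 : ℝ) 1, τ y * φ (c, y)

/-- `∫₀¹ τ(y) φ_n(y) dy`. -/
def modalCoeff (τ : ℝ → ℂ) (n : ℕ) : ℂ := ∫ y in Ioo (0 : ℝ) 1, τ y * (phi n y : ℂ)

/-- The indicator `ρ = ∑_{n ≤ N} |∫₀¹ w(-L,y) φ_n(y) dy|²`, for `τ = w(-L,·)`. -/
def rho (N : ℕ) (τ : ℝ → ℂ) : ℝ := ∑ n : Fin (N + 1), ‖modalCoeff τ n‖ ^ 2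

/-- Amplitudes `a_n = √(2|β_n|) e^{iβ_n L} ∫₀¹ w(-L,y) φ_n(y) dy` (for `τ = w(-L,·)`), so that
`∫₀¹ a_n w_n^+(-L,y) φ_n(y) dy = ∫₀¹ w(-L,y) φ_n(y) dy`. -/
def incidentCoeff (L k : ℝ) (N : ℕ) (τ : ℝ → ℂ) (n : Fin (N + 1)) : ℂ :=
  (Real.sqrt (2 * ‖beta k n‖) : ℂ) * Complex.exp (Complex.I * beta k n * (L : ℂ)) *
    modalCoeff τ n

end Waveguide

end

open Waveguide

noncomputable section

namespace Waveguide

/-! Everything is read on the coefficients along the cosines φ_n, a Hilbert basis of L²(0,1) made of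
Neumann eigenfunctions. For |x| > L one has γ = 1 and β_θ is constant, so in the outward distance s
= |x| - L each coefficient of the eigenfunction solves w_n'' = (μ_n e)² w_n, with μ_n² = n²π² - k²
and e = e^{iθ} on the right, e^{-iθ} on the left. Being square integrable, it is a multiple of one
decaying exponential e^{μ_n e s}. For n > N the exponent is -√(n²π² - k²) on both sides. For n ≤ N
decay selects μ_n = iβ_n on the right but μ_n = -iβ_n on the left: outgoing waves on the right,
incoming waves on the left. This is the effect of rotating the two ends in opposite directions.

Thus on each side w_θ is a series Σ c_n e^{μ_n ζ} φ_n(y), holomorphic in Re ζ > 0, read on the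
rotated half-line ζ = e s; the unscaled function u is the same series read at ζ = s. That u solves
the problem across |x| = L means that traces and fluxes match there. These are Σ c_n φ_n and Σ μ_n
c_n φ_n, and neither depends on e. For H¹ functions the argument needs the series to converge up to
the interface: `ScaledSol.summable_amplitudes` proves that Σ rate^{3/4}|c_n| is finite, by testing
the modal equations with e^{rate·x} times a cut-off. The series then converges normally on bounded
pieces, and its gradient is dominated by s^{-1/4}, which is locally square integrable. Green's
formula holds termwise (`ExtData.hasSum_flux`) and the gluing follows (`ScaledSol.unscale`). The
left side is obtained by reflection. The identity theorem shows that u does not depend on the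
continuation chosen (`IsUnscaled.ae_eq`).

The modal coefficients of the trace at x = -L are the left amplitudes d_n
(`ExtForm.modalCoeff_trace`), so ρ measures the incoming waves. Energy balance (`BiExt.flux`): the
imaginary parts of the modal fluxes sum to zero because ∫ γ|u|² is real, and evanescent modes carry
no flux. If ρ = 0, the outgoing waves on the right have zero total flux, hence vanish, and u is a
trapped mode; it is not zero, since w_θ would then vanish too. If ρ > 0, then on the left u is u_i
plus evanescent modes, so that nothing propagating is reflected. When both sides are outgoing, the
same balance shows that two outgoing fields differing by a solution have the same reflected
propagating amplitudes (`reflected_unique`), even if trapped modes make the scattered field non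
unique. The claims on all scattered fields and all reflection matrices follow by comparison and
superposition. -/

/-- Lebesgue measure on the cross-section `(0,1)`. -/
abbrev nu : Measure ℝ := volume.restrict (Ioo (0 : ℝ) 1)

/-! ### Cosine modes: orthonormality, completeness, Parseval -/

/-- The normalisation constant of `φ_n`. -/
def amp (n : ℕ) : ℝ := if n = 0 then 1 else Real.sqrt 2

/-- The derivative of `φ_n`. -/
def dphi (n : ℕ) (y : ℝ) : ℝ := -(amp n * (n * Real.pi) * Real.sin (n * Real.pi * y))

lemma amp_pos (n : ℕ) : 0 < amp n := by
  unfold amp; split_ifs <;> positivity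

lemma amp_le (n : ℕ) : amp n ≤ 2 := by
  unfold amp
  split_ifs
  · norm_num
  · rw [Real.sqrt_le_left (by norm_num)]; norm_num

lemma phi_eq (n : ℕ) (y : ℝ) : phi n y = amp n * Real.cos (n * Real.pi * y) := by
  unfold phi amp
  split_ifs with h
  · simp [h]
  · rfl

lemma abs_phi_le (n : ℕ) (y : ℝ) : |phi n y| ≤ 2 := by
  rw [phi_eq, abs_mul, abs_of_pos (amp_pos n)]
  calc amp n * |Real.cos (n * Real.pi * y)| ≤ 2 * 1 :=
        mul_le_mul (amp_le n) (Real.abs_cos_le_one _) (abs_nonneg _) (by norm_num)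
    _ = 2 := by norm_num

lemma abs_dphi_le (n : ℕ) (y : ℝ) : |dphi n y| ≤ 2 * (n * Real.pi) := by
  have h0 : (0:ℝ) ≤ n * Real.pi := by positivity
  rw [dphi, abs_neg, abs_mul, abs_mul, abs_of_pos (amp_pos n), abs_of_nonneg h0]
  calc amp n * (n * Real.pi) * |Real.sin (n * Real.pi * y)|
      ≤ 2 * (n * Real.pi) * 1 := by
        gcongr
        · exact amp_le n
        · exact Real.abs_sin_le_one _
    _ = _ := by ring

lemma contDiff_phi (n : ℕ) : ContDiff ℝ ∞ (phi n) := by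
  have : phi n = fun y => amp n * Real.cos (n * Real.pi * y) := funext (phi_eq n)
  rw [this]
  exact contDiff_const.mul (Real.contDiff_cos.comp (contDiff_const.mul contDiff_id))

lemma contDiff_dphi (n : ℕ) : ContDiff ℝ ∞ (dphi n) := by
  unfold dphi
  exact (contDiff_const.mul (Real.contDiff_sin.comp (contDiff_const.mul contDiff_id))).neg

@[fun_prop] lemma continuous_phi (n : ℕ) : Continuous (phi n) := (contDiff_phi n).continuous

@[fun_prop] lemma continuous_dphi (n : ℕ) : Continuous (dphi n) := (contDiff_dphi n).continuous

lemma hasDerivAt_phi (n : ℕ) (y : ℝ) : HasDerivAt (phi n) (dphi n y) y := by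
  have : phi n = fun y => amp n * Real.cos (n * Real.pi * y) := funext (phi_eq n)
  rw [this]
  have h := ((hasDerivAt_id y).const_mul (n * Real.pi)).cos.const_mul (amp n)
  refine h.congr_deriv ?_
  simp only [dphi, id]; ring

lemma hasDerivAt_dphi (n : ℕ) (y : ℝ) :
    HasDerivAt (dphi n) (-((n : ℝ) ^ 2 * Real.pi ^ 2 * phi n y)) y := by
  have h := (((hasDerivAt_id y).const_mul (n * Real.pi)).sin.const_mul
    (amp n * (n * Real.pi))).neg
  refine HasDerivAt.congr_deriv (f := dphi n) h ?_
  simp only [phi_eq, id]; ring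

lemma dphi_zero (n : ℕ) : dphi n 0 = 0 := by simp [dphi]

lemma dphi_one (n : ℕ) : dphi n 1 = 0 := by
  simp [dphi, Real.sin_nat_mul_pi]

lemma integral_cos_int_mul_pi {m : ℤ} (hm : m ≠ 0) :
    ∫ y in (0:ℝ)..1, Real.cos (m * Real.pi * y) = 0 := by
  have hc : (m : ℝ) * Real.pi ≠ 0 := mul_ne_zero (by exact_mod_cast hm) Real.pi_ne_zero
  rw [intervalIntegral.integral_comp_mul_left (fun y => Real.cos y) hc]
  simp [Real.sin_int_mul_pi]

lemma integral_phi_mul_phi (n m : ℕ) :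
    ∫ y, phi n y * phi m y ∂nu = if n = m then 1 else 0 := by
  have e : ∀ y, phi n y * phi m y = (amp n * amp m / 2) *
      (Real.cos (((n + m : ℤ) : ℝ) * Real.pi * y) + Real.cos (((n - m : ℤ) : ℝ) * Real.pi * y)) := by
    intro y
    rw [phi_eq, phi_eq]
    have h1 : ((n + m : ℤ) : ℝ) * Real.pi * y = n * Real.pi * y + m * Real.pi * y := by
      push_cast; ring
    have h2 : ((n - m : ℤ) : ℝ) * Real.pi * y = n * Real.pi * y - m * Real.pi * y := by
      push_cast; ring
    rw [h1, h2, Real.cos_add, Real.cos_sub]; ring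
  simp only [nu]
  rw [← integral_Ioc_eq_integral_Ioo, ← intervalIntegral.integral_of_le zero_le_one]
  simp_rw [e]
  rw [intervalIntegral.integral_const_mul, intervalIntegral.integral_add
    (by apply Continuous.intervalIntegrable; fun_prop)
    (by apply Continuous.intervalIntegrable; fun_prop)]
  by_cases hnm : n = m
  · subst hnm
    by_cases hn : n = 0
    · subst hn; norm_num [amp]
    · rw [integral_cos_int_mul_pi (by positivity)]
      have : amp n * amp n = 2 := by simp [amp, hn]
      simp [this]
  · rw [integral_cos_int_mul_pi (by omega), integral_cos_int_mul_pi (by omega)]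
    simp [hnm]

/-- A bounded continuous factor preserves integrability. -/
lemma integrable_mul_continuous {f : ℝ → ℂ} {g : ℝ → ℝ} (hf : Integrable f nu)
    (hg : Continuous g) : Integrable (fun y => f y * (g y : ℂ)) nu := by
  obtain ⟨C, hC⟩ := (isCompact_Icc (a := (0:ℝ)) (b := 1)).exists_bound_of_continuousOn
    hg.continuousOn
  refine hf.mul_bdd (c := C) ?_ ?_
  · exact (Complex.continuous_ofReal.comp hg).aestronglyMeasurable
  · refine (ae_restrict_mem measurableSet_Ioo).mono fun y hy => ?_
    simpa using hC y (Ioo_subset_Icc_self hy)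

/-- The identity 2 cos a cos b = cos(a+b) + cos(a-b) lowers the power of cos(πy) by one and shifts
the frequency, so the induction on `j` needs all frequencies at once. Frequency 0 is absorbed as
frequency 1 at the lower power, which avoids a negative one. -/
lemma integral_mul_cos_pow_eq_zero {f : ℝ → ℂ} (hf : Integrable f nu)
    (h : ∀ n, modalCoeff f n = 0) (j : ℕ) : ∀ n : ℕ,
    ∫ y, f y * ((Real.cos (Real.pi * y) ^ j * Real.cos (n * Real.pi * y) : ℝ) : ℂ) ∂nu = 0 := by
  induction j with
  | zero =>
    intro n
    have h1 : ∀ y, f y * ((Real.cos (Real.pi * y) ^ 0 * Real.cos (n * Real.pi * y) : ℝ) : ℂ)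
        = (f y * (phi n y : ℂ)) * ((amp n)⁻¹ : ℝ) := by
      intro y
      have := (amp_pos n).ne'
      rw [phi_eq, mul_assoc (f y), ← Complex.ofReal_mul]
      refine congrArg (fun t : ℝ => f y * (t : ℂ)) ?_
      rw [pow_zero, one_mul]
      field_simp
    simp_rw [h1]
    rw [integral_mul_const]
    have := h n
    simp only [modalCoeff] at this
    rw [this, zero_mul]
  | succ j ih =>
    intro n
    have key : ∀ a : ℕ, Integrable (fun y => f y *
        ((Real.cos (Real.pi * y) ^ j * Real.cos (a * Real.pi * y) : ℝ) : ℂ)) nu :=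
      fun a => integrable_mul_continuous hf (by fun_prop)
    rcases n with _ | n
    · have := ih 1
      convert this using 4 with y
      simp [pow_succ]
    · have e : ∀ y, f y * ((Real.cos (Real.pi * y) ^ (j + 1) *
            Real.cos ((n + 1 : ℕ) * Real.pi * y) : ℝ) : ℂ) =
          (f y * ((Real.cos (Real.pi * y) ^ j * Real.cos ((n + 2 : ℕ) * Real.pi * y) : ℝ) : ℂ) +
          f y * ((Real.cos (Real.pi * y) ^ j * Real.cos (n * Real.pi * y) : ℝ) : ℂ)) * (1 / 2) := by
        intro y
        have h1 : ((n + 2 : ℕ) : ℝ) * Real.pi * y = (n + 1 : ℕ) * Real.pi * y + Real.pi * y := by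
          push_cast; ring
        have h2 : (n : ℝ) * Real.pi * y = (n + 1 : ℕ) * Real.pi * y - Real.pi * y := by
          push_cast; ring
        rw [h1, h2, Real.cos_add, Real.cos_sub]
        push_cast
        ring
      simp_rw [e]
      rw [integral_mul_const, integral_add (key _) (key _), ih, ih]
      simp

lemma integral_mul_polynomial_cos_eq_zero {f : ℝ → ℂ} (hf : Integrable f nu)
    (h : ∀ n, modalCoeff f n = 0) (P : Polynomial ℝ) :
    ∫ y, f y * ((P.eval (Real.cos (Real.pi * y)) : ℝ) : ℂ) ∂nu = 0 := by
  have e : ∀ y, f y * ((P.eval (Real.cos (Real.pi * y)) : ℝ) : ℂ) =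
      ∑ i ∈ Finset.range (P.natDegree + 1), (P.coeff i : ℂ) *
        (f y * ((Real.cos (Real.pi * y) ^ i * Real.cos ((0 : ℕ) * Real.pi * y) : ℝ) : ℂ)) := by
    intro y
    rw [Polynomial.eval_eq_sum_range]
    push_cast
    rw [Finset.mul_sum]
    refine Finset.sum_congr rfl fun i _ => ?_
    simp; ring
  simp_rw [e]
  rw [integral_finsetSum]
  · refine Finset.sum_eq_zero fun i _ => ?_
    rw [integral_const_mul, integral_mul_cos_pow_eq_zero hf h, mul_zero]
  · intro i _
    exact (integrable_mul_continuous hf (by fun_prop)).const_mul _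

/-- Completeness of the cosines: a function whose modal coefficients all vanish is zero. -/
theorem ae_eq_zero_of_modalCoeff_eq_zero {f : ℝ → ℂ} (hf : Integrable f nu)
    (h : ∀ n, modalCoeff f n = 0) : f =ᵐ[nu] 0 := by
  have main : ∀ g : ℝ → ℝ, Continuous g → ∫ y, f y * (g y : ℂ) ∂nu = 0 := by
    intro g hg
    rw [← norm_le_zero_iff]
    refine le_of_forall_pos_le_add fun ε hε => ?_
    set I := ∫ y, ‖f y‖ ∂nu with hI
    have hI0 : 0 ≤ I := integral_nonneg fun _ => norm_nonneg _
    -- Weierstrass in the variable t = cos(πy), since y = arccos(t)/π on [0,1]. The `+ 1` in the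
    -- tolerance covers the case where the norm of f is zero.
    obtain ⟨P, hP⟩ := exists_polynomial_near_of_continuousOn (-1) 1
      (fun t => g (Real.arccos t / Real.pi))
      (by apply Continuous.continuousOn; fun_prop) (ε / (I + 1)) (by positivity)
    have hsub : ∫ y, f y * (g y : ℂ) ∂nu =
        ∫ y, f y * ((g y - P.eval (Real.cos (Real.pi * y)) : ℝ) : ℂ) ∂nu := by
      have h2 : ∀ y, f y * ((g y - P.eval (Real.cos (Real.pi * y)) : ℝ) : ℂ) =
          f y * (g y : ℂ) - f y * ((P.eval (Real.cos (Real.pi * y)) : ℝ) : ℂ) := by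
        intro y; push_cast; ring
      simp_rw [h2]
      rw [integral_sub (integrable_mul_continuous hf hg)
        (integrable_mul_continuous hf (by fun_prop)),
        integral_mul_polynomial_cos_eq_zero hf h, sub_zero]
    rw [hsub, zero_add]
    calc ‖∫ y, f y * ((g y - P.eval (Real.cos (Real.pi * y)) : ℝ) : ℂ) ∂nu‖
        ≤ ∫ y, ‖f y‖ * (ε / (I + 1)) ∂nu := by
          refine norm_integral_le_of_norm_le (hf.norm.mul_const _) ?_
          refine (ae_restrict_mem measurableSet_Ioo).mono fun y hy => ?_
          rw [norm_mul, Complex.norm_real]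
          gcongr
          have h3 := hP (Real.cos (Real.pi * y)) ⟨Real.neg_one_le_cos _, Real.cos_le_one _⟩
          have h4 : Real.arccos (Real.cos (Real.pi * y)) / Real.pi = y := by
            rw [Real.arccos_cos (by have := hy.1; positivity)
              (by nlinarith [hy.2, Real.pi_pos])]
            field_simp
          simp only [h4] at h3
          rw [Real.norm_eq_abs, abs_sub_comm]
          exact h3.le
      _ = I * (ε / (I + 1)) := by rw [integral_mul_const]
      _ ≤ ε := by
          rw [mul_div_assoc', div_le_iff₀ (by positivity)]; nlinarith
  have hae : ∀ᵐ y : ℝ, y ∈ Ioo (0:ℝ) 1 → f y = 0 := by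
    refine isOpen_Ioo.ae_eq_zero_of_integral_contDiff_smul_eq_zero
      (IntegrableOn.locallyIntegrableOn hf) fun g hg _ hsupp => ?_
    have h1 := main g hg.continuous
    have h2 : ∫ y in Ioo (0:ℝ) 1, g y • f y = ∫ y, g y • f y := by
      refine setIntegral_eq_integral_of_forall_compl_eq_zero fun y hy => ?_
      have : g y = 0 := by
        by_contra hne
        exact hy (hsupp (subset_tsupport _ hne))
      simp [this]
    rw [← h2, ← h1]
    refine integral_congr_ae (Eventually.of_forall fun y => ?_)
    simp [mul_comm]
  exact (ae_restrict_iff' measurableSet_Ioo).2 hae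

lemma memLp_phi (n : ℕ) : MemLp (fun y => (phi n y : ℂ)) 2 nu := by
  refine MemLp.of_bound (Complex.continuous_ofReal.comp
    (continuous_phi n)).aestronglyMeasurable 2 (Eventually.of_forall fun y => ?_)
  simpa using abs_phi_le n y

lemma modalCoeff_congr {f g : ℝ → ℂ} (h : f =ᵐ[nu] g) (n : ℕ) :
    modalCoeff f n = modalCoeff g n :=
  integral_congr_ae (h.mono fun y hy => by simp only [hy])

lemma inner_toLp_phi {f : ℝ → ℂ} (hf : MemLp f 2 nu) (n : ℕ) :
    inner ℂ ((memLp_phi n).toLp _) (hf.toLp f) = modalCoeff f n := by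
  rw [L2.inner_def]
  refine integral_congr_ae ?_
  filter_upwards [(memLp_phi n).coeFn_toLp, hf.coeFn_toLp] with y h1 h2
  rw [h1, h2]
  simp

/-- The Hilbert basis of `L²(0,1)` made of the functions `φ_n`. -/
def phiBasis : HilbertBasis ℕ ℂ (Lp ℂ 2 nu) :=
  HilbertBasis.mkOfOrthogonalEqBot (v := fun n => (memLp_phi n).toLp _)
    (by
      rw [orthonormal_iff_ite]
      intro i j
      rw [inner_toLp_phi, modalCoeff]
      have := integral_phi_mul_phi j i
      simp_rw [← Complex.ofReal_mul]
      rw [integral_complex_ofReal, this]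
      simp [eq_comm, apply_ite])
    (by
      rw [Submodule.eq_bot_iff]
      intro f hf
      have hmem := Lp.memLp f
      have h0 : ∀ n, modalCoeff f n = 0 := by
        intro n
        rw [← inner_toLp_phi hmem n, Lp.toLp_coeFn]
        exact (Submodule.mem_orthogonal _ f).1 hf _ (Submodule.subset_span ⟨n, rfl⟩)
      have := ae_eq_zero_of_modalCoeff_eq_zero (hmem.integrable (by norm_num)) h0
      exact (Lp.eq_zero_iff_ae_eq_zero).2 this)

lemma phiBasis_apply (n : ℕ) : phiBasis n = (memLp_phi n).toLp _ := by
  simp [phiBasis]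

/-- Parseval's identity. -/
theorem hasSum_modalCoeff {f g : ℝ → ℂ} (hf : MemLp f 2 nu) (hg : MemLp g 2 nu) :
    HasSum (fun n => starRingEnd ℂ (modalCoeff f n) * modalCoeff g n)
      (∫ y, starRingEnd ℂ (f y) * g y ∂nu) := by
  have h := phiBasis.hasSum_inner_mul_inner (hf.toLp f) (hg.toLp g)
  have h1 : ∀ n, inner ℂ (hf.toLp f) (phiBasis n) * inner ℂ (phiBasis n) (hg.toLp g) =
      starRingEnd ℂ (modalCoeff f n) * modalCoeff g n := by
    intro n
    rw [phiBasis_apply, inner_toLp_phi, ← inner_conj_symm, inner_toLp_phi]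
  have h2 : inner ℂ (hf.toLp f) (hg.toLp g) = ∫ y, starRingEnd ℂ (f y) * g y ∂nu := by
    rw [L2.inner_def]
    refine integral_congr_ae ?_
    filter_upwards [hf.coeFn_toLp, hg.coeFn_toLp] with y h1 h2
    rw [h1, h2]
    simp [mul_comm]
  simpa only [h1, h2] using h

lemma hasSum_normSq_modalCoeff {f : ℝ → ℂ} (hf : MemLp f 2 nu) :
    HasSum (fun n => ‖modalCoeff f n‖ ^ 2) (∫ y, ‖f y‖ ^ 2 ∂nu) := by
  have h := hasSum_modalCoeff hf hf
  simp_rw [Complex.conj_mul', ← Complex.ofReal_pow] at h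
  rw [integral_complex_ofReal] at h
  exact_mod_cast h

/-- Bessel's inequality. -/
lemma sum_normSq_modalCoeff_le {f : ℝ → ℂ} (hf : MemLp f 2 nu) (s : Finset ℕ) :
    ∑ n ∈ s, ‖modalCoeff f n‖ ^ 2 ≤ ∫ y, ‖f y‖ ^ 2 ∂nu :=
  sum_le_hasSum s (fun _ _ => by positivity) (hasSum_normSq_modalCoeff hf)

/-! ### Fubini on the strip and coefficients on cross-sections -/

lemma restrict_strip_inter (A : Set ℝ) :
    (volume : Measure (ℝ × ℝ)).restrict (strip ∩ {p | p.1 ∈ A}) = (volume.restrict A).prod nu := by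
  rw [nu, Measure.prod_restrict, Measure.volume_eq_prod]
  congr 1
  ext p
  simp [strip, and_comm]

lemma restrict_strip :
    (volume : Measure (ℝ × ℝ)).restrict strip = (volume : Measure ℝ).prod nu := by
  have := restrict_strip_inter univ
  simpa using this

lemma measurableSet_strip : MeasurableSet strip :=
  (measurableSet_lt measurable_const measurable_snd).inter
    (measurableSet_lt measurable_snd measurable_const)

lemma isOpen_strip : IsOpen strip :=
  (isOpen_lt continuous_const continuous_snd).inter (isOpen_lt continuous_snd continuous_const)

/-- The `n`-th modal coefficient of `f` on the cross-section of abscissa `x`. -/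
def coef (f : ℝ × ℝ → ℂ) (n : ℕ) (x : ℝ) : ℂ := modalCoeff (fun y => f (x, y)) n

/-- Functions that are square integrable on bounded pieces of the waveguide. -/
def L2Loc (f : ℝ × ℝ → ℂ) : Prop :=
  ∀ r : ℝ, MemLp f 2 (volume.restrict (strip ∩ {p | |p.1| < r}))

/-- Two functions that agree on almost every point of almost every cross-section agree a.e. -/
lemma ae_eq_prod_of_ae_ae {μ : Measure ℝ} [SFinite μ] {f g : ℝ × ℝ → ℂ}
    (hf : AEStronglyMeasurable f (μ.prod nu)) (hg : AEStronglyMeasurable g (μ.prod nu))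
    (h : ∀ᵐ x ∂μ, ∀ᵐ y ∂nu, f (x, y) = g (x, y)) : f =ᵐ[μ.prod nu] g := by
  have hm : AEMeasurable (fun p => ‖f p - g p‖ₑ) (μ.prod nu) := (hf.sub hg).enorm
  have h0 : ∫⁻ p, ‖f p - g p‖ₑ ∂(μ.prod nu) = 0 := by
    rw [lintegral_prod _ hm]
    refine lintegral_eq_zero_of_ae_eq_zero ?_
    filter_upwards [h] with x hx
    refine lintegral_eq_zero_of_ae_eq_zero ?_
    filter_upwards [hx] with y hy
    simp [hy]
  filter_upwards [(lintegral_eq_zero_iff' hm).1 h0] with p hp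
  simpa [sub_eq_zero] using hp

section Slices

variable {μ : Measure ℝ} {f : ℝ × ℝ → ℂ}

lemma memLp_slice [SFinite μ] (hf : MemLp f 2 (μ.prod nu)) :
    ∀ᵐ x ∂μ, MemLp (fun y => f (x, y)) 2 nu := by
  have h1 := ((memLp_two_iff_integrable_sq_norm hf.1).1 hf).prod_right_ae
  filter_upwards [h1, hf.1.prodMk_left] with x h2 h3
  exact (memLp_two_iff_integrable_sq_norm h3).2 h2

lemma aestronglyMeasurable_coef (hf : AEStronglyMeasurable f (μ.prod nu)) (n : ℕ) :
    AEStronglyMeasurable (coef f n) μ := by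
  have : AEStronglyMeasurable (fun p : ℝ × ℝ => f p * (phi n p.2 : ℂ)) (μ.prod nu) :=
    hf.mul (Continuous.aestronglyMeasurable (by fun_prop))
  exact this.integral_prod_right'

lemma integrable_sq_slice (hf : MemLp f 2 (μ.prod nu)) :
    Integrable (fun x => ∫ y, ‖f (x, y)‖ ^ 2 ∂nu) μ :=
  ((memLp_two_iff_integrable_sq_norm hf.1).1 hf).integral_prod_left

lemma memLp_coef [SFinite μ] (hf : MemLp f 2 (μ.prod nu)) (n : ℕ) : MemLp (coef f n) 2 μ := by
  have hm := aestronglyMeasurable_coef hf.1 n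
  rw [memLp_two_iff_integrable_sq_norm hm]
  refine (integrable_sq_slice hf).mono' (hm.norm.pow 2) ?_
  filter_upwards [memLp_slice hf] with x hx
  have := sum_normSq_modalCoeff_le hx {n}
  simpa [coef] using this

/-- Bessel's inequality on each cross-section, integrated in x. Since the finite set is arbitrary,
the energies of the modal coefficients are summable in n. -/
lemma sum_integral_normSq_coef_le [SFinite μ] (hf : MemLp f 2 (μ.prod nu)) (s : Finset ℕ) :
    ∑ n ∈ s, ∫ x, ‖coef f n x‖ ^ 2 ∂μ ≤ ∫ p, ‖f p‖ ^ 2 ∂(μ.prod nu) := by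
  rw [integral_prod _ ((memLp_two_iff_integrable_sq_norm hf.1).1 hf), ← integral_finsetSum]
  · refine integral_mono_ae ?_ (integrable_sq_slice hf) ?_
    · refine integrable_finsetSum _ fun n _ => ?_
      have := memLp_coef hf n
      exact (memLp_two_iff_integrable_sq_norm this.1).1 this
    · filter_upwards [memLp_slice hf] with x hx
      exact sum_normSq_modalCoeff_le hx s
  · intro n _
    have := memLp_coef hf n
    exact (memLp_two_iff_integrable_sq_norm this.1).1 this

/-- A function whose modal coefficients are those of another one coincides with it. -/
lemma ae_eq_of_coef_eq [SFinite μ] {g : ℝ × ℝ → ℂ} (hf : AEStronglyMeasurable f (μ.prod nu))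
    (hg : AEStronglyMeasurable g (μ.prod nu))
    (hfi : ∀ᵐ x ∂μ, Integrable (fun y => f (x, y)) nu)
    (hgi : ∀ᵐ x ∂μ, Integrable (fun y => g (x, y)) nu)
    (h : ∀ n, ∀ᵐ x ∂μ, coef f n x = coef g n x) : f =ᵐ[μ.prod nu] g := by
  refine ae_eq_prod_of_ae_ae hf hg ?_
  filter_upwards [hfi, hgi, ae_all_iff.2 h] with x h1 h2 h3
  have h4 : (fun y => f (x, y) - g (x, y)) =ᵐ[nu] 0 := by
    refine ae_eq_zero_of_modalCoeff_eq_zero (h1.sub h2) fun n => ?_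
    have h5 := h3 n
    simp only [coef, modalCoeff] at h5 ⊢
    simp_rw [sub_mul]
    rw [integral_sub (integrable_mul_continuous h1 (continuous_phi n))
      (integrable_mul_continuous h2 (continuous_phi n)), h5, sub_self]
  filter_upwards [h4] with y hy
  simpa [sub_eq_zero] using hy

end Slices

/-! ### Local square integrability -/

lemma L2Loc.memLp {f : ℝ × ℝ → ℂ} (hf : L2Loc f) (r : ℝ) :
    MemLp f 2 ((volume.restrict {x : ℝ | |x| < r}).prod nu) := by
  have := hf r
  rwa [show (strip ∩ {p : ℝ × ℝ | |p.1| < r}) = strip ∩ {p | p.1 ∈ {x : ℝ | |x| < r}} from rfl,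
    restrict_strip_inter] at this

lemma strip_eq_iUnion : strip = ⋃ n : ℕ, (strip ∩ {p | |p.1| < (n : ℝ)}) := by
  ext p
  simp only [mem_iUnion, mem_inter_iff, mem_ofPred_eq, exists_and_left]
  exact ⟨fun h => ⟨h, exists_nat_gt _⟩, fun h => h.1⟩

lemma univ_eq_iUnion_abs_lt : (univ : Set ℝ) = ⋃ n : ℕ, {x : ℝ | |x| < (n : ℝ)} := by
  ext p
  simpa using exists_nat_gt _

lemma L2Loc.aestronglyMeasurable {f : ℝ × ℝ → ℂ} (hf : L2Loc f) :
    AEStronglyMeasurable f (volume.restrict strip) := by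
  rw [strip_eq_iUnion, aestronglyMeasurable_iUnion_iff]
  exact fun n => (hf n).1

lemma L2Loc.memLp_slice {f : ℝ × ℝ → ℂ} (hf : L2Loc f) :
    ∀ᵐ x : ℝ, MemLp (fun y => f (x, y)) 2 nu := by
  rw [← Measure.restrict_univ (μ := (volume : Measure ℝ)), univ_eq_iUnion_abs_lt,
    ae_restrict_iUnion_iff]
  exact fun n => Waveguide.memLp_slice (hf.memLp n)

lemma memLp_l2Loc {f : ℝ × ℝ → ℂ} (hf : MemLp f 2 (volume.restrict strip)) : L2Loc f :=
  fun _ => hf.mono_measure (Measure.restrict_mono inter_subset_left le_rfl)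

lemma L2Loc.coef_memLp {f : ℝ × ℝ → ℂ} (hf : L2Loc f) (n : ℕ) (r : ℝ) :
    MemLp (coef f n) 2 (volume.restrict {x : ℝ | |x| < r}) :=
  memLp_coef (hf.memLp r) n

lemma locallyIntegrable_of_memLp_abs_lt {f : ℝ → ℂ}
    (hf : ∀ r : ℝ, MemLp f 2 (volume.restrict {x : ℝ | |x| < r})) : LocallyIntegrable f := by
  intro x
  refine ⟨{y : ℝ | |y| < |x| + 1}, (isOpen_lt continuous_abs continuous_const).mem_nhds
    (by simp), ?_⟩
  have : IsFiniteMeasure ((volume : Measure ℝ).restrict {y : ℝ | |y| < |x| + 1}) := by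
    refine ⟨?_⟩
    rw [Measure.restrict_apply_univ]
    refine (Metric.isBounded_ball (x := (0:ℝ)) (r := |x| + 1)).measure_lt_top (μ := volume)
      |>.trans_le' (measure_mono fun y hy => ?_)
    simpa using hy
  exact (hf _).integrable (by norm_num)

lemma L2Loc.locallyIntegrable_coef {f : ℝ × ℝ → ℂ} (hf : L2Loc f) (n : ℕ) :
    LocallyIntegrable (coef f n) :=
  locallyIntegrable_of_memLp_abs_lt (hf.coef_memLp n)

lemma L2Loc.bdd_mul {f g : ℝ × ℝ → ℂ} (hf : L2Loc f) {C : ℝ}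
    (hg : AEStronglyMeasurable g (volume.restrict strip)) (hC : ∀ p ∈ strip, ‖g p‖ ≤ C) :
    L2Loc (fun p => g p * f p) := by
  intro r
  have hgr : AEStronglyMeasurable g (volume.restrict (strip ∩ {p | |p.1| < r})) :=
    hg.mono_measure (Measure.restrict_mono inter_subset_left le_rfl)
  refine (hf r).of_le_mul (c := C) (hgr.mul (hf r).1) ?_
  have hs : MeasurableSet (strip ∩ {p : ℝ × ℝ | |p.1| < r}) :=
    measurableSet_strip.inter (measurableSet_lt (by fun_prop) measurable_const)
  refine (ae_restrict_mem hs).mono fun p hp => ?_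
  rw [norm_mul]
  exact mul_le_mul_of_nonneg_right (hC p hp.1) (norm_nonneg _)

lemma L2Loc.add {f g : ℝ × ℝ → ℂ} (hf : L2Loc f) (hg : L2Loc g) :
    L2Loc (fun p => f p + g p) := fun r => (hf r).add (hg r)

lemma L2Loc.const_mul {f : ℝ × ℝ → ℂ} (hf : L2Loc f) (c : ℂ) :
    L2Loc (fun p => c * f p) := fun r => (hf r).const_mul c

/-- The function `g` vanishes for large `|x|`. -/
def XSupp (g : ℝ × ℝ → ℂ) : Prop := ∃ R : ℝ, ∀ p, R ≤ |p.1| → g p = 0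

lemma L2Loc.integrable_mul {f g : ℝ × ℝ → ℂ} (hf : L2Loc f) (hg : Continuous g)
    (hs : XSupp g) : Integrable (fun p => f p * g p) (volume.restrict strip) := by
  obtain ⟨R, hR⟩ := hs
  obtain ⟨C, hC⟩ := ((isCompact_Icc (a := -R) (b := R)).prod
    (isCompact_Icc (a := (0:ℝ)) (b := 1))).exists_bound_of_continuousOn hg.continuousOn
  have hA : MeasurableSet (strip ∩ {p : ℝ × ℝ | |p.1| < R}) :=
    measurableSet_strip.inter (measurableSet_lt (by fun_prop) measurable_const)
  have hfin : IsFiniteMeasure ((volume : Measure (ℝ × ℝ)).restrict (strip ∩ {p | |p.1| < R})) := by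
    refine ⟨?_⟩
    rw [Measure.restrict_apply_univ]
    refine (((isCompact_Icc (a := -R) (b := R)).prod
      (isCompact_Icc (a := (0:ℝ)) (b := 1))).measure_lt_top (μ := volume)).trans_le' (measure_mono ?_)
    intro p hp
    exact ⟨abs_le.1 hp.2.le, hp.1.1.le, hp.1.2.le⟩
  have h1 : IntegrableOn (fun p => f p * g p) (strip ∩ {p | |p.1| < R}) := by
    refine Integrable.mul_bdd (c := C) ((hf R).integrable (by norm_num)) hg.aestronglyMeasurable ?_
    refine (ae_restrict_mem hA).mono fun p hp => ?_
    exact hC p ⟨abs_le.1 hp.2.le, hp.1.1.le, hp.1.2.le⟩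
  refine h1.of_forall_sdiff_eq_zero measurableSet_strip ?_
  intro p hp
  have : R ≤ |p.1| := by
    by_contra hlt
    exact hp.2 ⟨hp.1, not_le.1 hlt⟩
  simp [hR p this]

lemma exists_forall_abs_ge_eq_zero {ψ : ℝ → ℂ} (hψ : HasCompactSupport ψ) :
    ∃ R, ∀ x, R ≤ |x| → ψ x = 0 := by
  obtain ⟨R, hR⟩ := hψ.isCompact.isBounded.subset_ball (0 : ℝ)
  refine ⟨R, fun x hx => ?_⟩
  by_contra hne
  have := hR (subset_tsupport _ hne)
  simp at this
  linarith

lemma xSupp_tensor {ψ q : ℝ → ℂ} (hψ : HasCompactSupport ψ) :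
    XSupp (fun p => ψ p.1 * q p.2) := by
  obtain ⟨R, hR⟩ := exists_forall_abs_ge_eq_zero hψ
  exact ⟨R, fun p hp => by simp [hR _ hp]⟩

lemma xSupp_of_hasCompactSupport {g : ℝ × ℝ → ℂ} (hg : HasCompactSupport g) : XSupp g := by
  obtain ⟨R, hR⟩ := hg.isCompact.isBounded.subset_ball (0 : ℝ × ℝ)
  refine ⟨R, fun p hp => ?_⟩
  by_contra hne
  have := hR (subset_tsupport _ hne)
  rw [mem_ball_zero_iff, Prod.norm_def] at this
  have h1 : ‖p.1‖ < R := (le_max_left _ _).trans_lt this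
  rw [Real.norm_eq_abs] at h1
  linarith

/-- Fubini's theorem on the waveguide, against a tensor product. -/
lemma L2Loc.integral_mul_tensor {f : ℝ × ℝ → ℂ} (hf : L2Loc f) {ψ : ℝ → ℂ} (hc : Continuous ψ)
    (hψ : HasCompactSupport ψ) {q : ℝ → ℝ} (hq : Continuous q) :
    ∫ p in strip, f p * (ψ p.1 * (q p.2 : ℂ)) = ∫ x, (∫ y, f (x, y) * (q y : ℂ) ∂nu) * ψ x := by
  have hi : Integrable (fun p => f p * (ψ p.1 * (q p.2 : ℂ))) (volume.restrict strip) :=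
    hf.integrable_mul (by fun_prop) (xSupp_tensor (q := fun y => (q y : ℂ)) hψ)
  rw [restrict_strip] at hi ⊢
  rw [integral_prod _ hi]
  refine integral_congr_ae (Eventually.of_forall fun x => ?_)
  simp only
  rw [← integral_mul_const]
  refine integral_congr_ae (Eventually.of_forall fun y => ?_)
  simp only
  ring

lemma L2Loc.locallyIntegrable_integral_mul {f : ℝ × ℝ → ℂ} (hf : L2Loc f) {q : ℝ → ℝ}
    (hq : Continuous q) : LocallyIntegrable (fun x => ∫ y, f (x, y) * (q y : ℂ) ∂nu) := by
  intro x
  refine ⟨{y : ℝ | |y| < |x| + 1}, (isOpen_lt continuous_abs continuous_const).mem_nhds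
    (by simp), ?_⟩
  obtain ⟨C, hC⟩ := (isCompact_Icc (a := (0:ℝ)) (b := 1)).exists_bound_of_continuousOn
    hq.continuousOn
  have hfin : IsFiniteMeasure ((volume : Measure ℝ).restrict {y : ℝ | |y| < |x| + 1}) := by
    refine ⟨?_⟩
    rw [Measure.restrict_apply_univ]
    refine (Metric.isBounded_ball (x := (0:ℝ)) (r := |x| + 1)).measure_lt_top (μ := volume)
      |>.trans_le' (measure_mono fun y hy => ?_)
    simpa using hy
  have h1 : Integrable f ((volume.restrict {y : ℝ | |y| < |x| + 1}).prod nu) :=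
    (hf.memLp _).integrable (by norm_num)
  refine Integrable.integral_prod_left (f := fun p : ℝ × ℝ => f p * (q p.2 : ℂ))
    (h1.mul_bdd (c := C) (Continuous.aestronglyMeasurable (by fun_prop)) ?_)
  have h2 : ∀ᵐ y ∂nu, ‖(q y : ℂ)‖ ≤ C := (ae_restrict_mem measurableSet_Ioo).mono fun y hy => by
    simpa using hC y (Ioo_subset_Icc_self hy)
  exact Measure.quasiMeasurePreserving_snd.ae h2

lemma integrable_mul_test {f ψ : ℝ → ℂ} (hf : LocallyIntegrable f)
    (hc : Continuous ψ) (hψ : HasCompactSupport ψ) : Integrable (fun x => f x * ψ x) := by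
  have := hf.integrable_smul_left_of_hasCompactSupport hc hψ
  simpa [mul_comm] using this

/-! ### Test functions of one variable and the fundamental lemma -/

/-- Smooth compactly supported functions of one variable. -/
def IsTest1 (ψ : ℝ → ℂ) : Prop := ContDiff ℝ ∞ ψ ∧ HasCompactSupport ψ

lemma IsTest1.continuous {ψ : ℝ → ℂ} (h : IsTest1 ψ) : Continuous ψ := h.1.continuous

lemma IsTest1.differentiable {ψ : ℝ → ℂ} (h : IsTest1 ψ) : Differentiable ℝ ψ :=
  h.1.differentiable (by simp)

lemma IsTest1.derivative {ψ : ℝ → ℂ} (h : IsTest1 ψ) : IsTest1 (deriv ψ) :=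
  ⟨(contDiff_infty_iff_deriv.1 h.1).2, h.2.deriv⟩

lemma IsTest1.mul_left {ψ g : ℝ → ℂ} (h : IsTest1 ψ) (hg : ContDiff ℝ ∞ g) :
    IsTest1 (fun x => g x * ψ x) := ⟨hg.mul h.1, h.2.mul_left⟩

/-- The fundamental lemma of the calculus of variations on an open set. -/
lemma ae_eq_zero_of_forall_test {U : Set ℝ} (hU : IsOpen U) {f : ℝ → ℂ}
    (hf : LocallyIntegrableOn f U)
    (h : ∀ ψ, IsTest1 ψ → tsupport ψ ⊆ U → ∫ x, f x * ψ x = 0) :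
    ∀ᵐ x, x ∈ U → f x = 0 := by
  refine hU.ae_eq_zero_of_integral_contDiff_smul_eq_zero hf fun g hg hc hs => ?_
  have hts : tsupport (fun x => (g x : ℂ)) ⊆ tsupport g :=
    closure_mono fun x hx => by
      simp only [Function.mem_support, ne_eq, Complex.ofReal_eq_zero] at hx ⊢
      exact hx
  rw [← h (fun x => (g x : ℂ)) ⟨Complex.ofRealCLM.contDiff.comp hg,
    HasCompactSupport.of_support_subset_isCompact hc fun x hx => hts (subset_tsupport _ hx)⟩
    (hts.trans hs)]
  refine integral_congr_ae (Eventually.of_forall fun y => ?_)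
  simp [mul_comm]

lemma ae_eq_of_forall_test {f g : ℝ → ℂ} (hf : LocallyIntegrable f) (hg : LocallyIntegrable g)
    (h : ∀ ψ, IsTest1 ψ → ∫ x, f x * ψ x = ∫ x, g x * ψ x) : f =ᵐ[volume] g := by
  have := ae_eq_zero_of_forall_test isOpen_univ
    (f := fun x => f x - g x) ((hf.sub hg).locallyIntegrableOn _) (fun ψ hψ _ => by
      simp_rw [sub_mul]
      rw [integral_sub (integrable_mul_test hf hψ.continuous hψ.2)
        (integrable_mul_test hg hψ.continuous hψ.2), h ψ hψ, sub_self])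
  filter_upwards [this] with x hx
  simpa [sub_eq_zero] using hx

/-! ### Tensor test functions -/

/-- The function `(x,y) ↦ ψ(x) q(y)`. -/
def tensor (ψ q : ℝ → ℂ) (p : ℝ × ℝ) : ℂ := ψ p.1 * q p.2

lemma hasFDerivAt_tensor {ψ q : ℝ → ℂ} {p : ℝ × ℝ} (hψ : DifferentiableAt ℝ ψ p.1)
    (hq : DifferentiableAt ℝ q p.2) :
    dx (tensor ψ q) p = deriv ψ p.1 * q p.2 ∧ dy (tensor ψ q) p = ψ p.1 * deriv q p.2 := by
  have h1 := hψ.hasDerivAt.hasFDerivAt.comp p (hasFDerivAt_fst (𝕜 := ℝ) (E := ℝ) (F := ℝ))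
  have h2 := hq.hasDerivAt.hasFDerivAt.comp p (hasFDerivAt_snd (𝕜 := ℝ) (E := ℝ) (F := ℝ))
  have h : HasFDerivAt (tensor ψ q) _ p := h1.mul h2
  simp only [dx, dy, h.fderiv]
  constructor
  · simp [mul_comm]
  · simp

lemma contDiff_tensor {ψ q : ℝ → ℂ} (hψ : ContDiff ℝ ∞ ψ) (hq : ContDiff ℝ ∞ q) :
    ContDiff ℝ ∞ (tensor ψ q) := (hψ.comp contDiff_fst).mul (hq.comp contDiff_snd)

lemma tsupport_tensor_subset (ψ q : ℝ → ℂ) :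
    tsupport (tensor ψ q) ⊆ tsupport ψ ×ˢ tsupport q := by
  refine closure_minimal (fun p hp => ?_) ((isClosed_tsupport _).prod (isClosed_tsupport _))
  rw [Function.mem_support, tensor] at hp
  exact ⟨subset_tsupport _ (left_ne_zero_of_mul hp), subset_tsupport _ (right_ne_zero_of_mul hp)⟩

lemma isTest_tensor {ψ q : ℝ → ℂ} (hψ : IsTest1 ψ) (hq : IsTest1 q) : IsTest (tensor ψ q) :=
  ⟨contDiff_tensor hψ.1 hq.1, (hψ.2.isCompact.prod hq.2.isCompact).of_isClosed_subset
    (isClosed_tsupport _) (tsupport_tensor_subset ψ q)⟩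

/-! ### Cut-off functions of the cross-section -/

/-- A fixed smooth compactly supported function equal to `1` near `[0,1]`. -/
def plateau (y : ℝ) : ℝ := Real.smoothTransition (y + 2) * Real.smoothTransition (3 - y)

lemma contDiff_plateau : ContDiff ℝ ∞ plateau :=
  (Real.smoothTransition.contDiff.comp (contDiff_id.add contDiff_const)).mul
    (Real.smoothTransition.contDiff.comp (contDiff_const.sub contDiff_id))

lemma plateau_eq_one {y : ℝ} (h1 : -1 ≤ y) (h2 : y ≤ 2) : plateau y = 1 := by
  simp [plateau, Real.smoothTransition.one_of_one_le (show (1:ℝ) ≤ y + 2 by linarith),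
    Real.smoothTransition.one_of_one_le (show (1:ℝ) ≤ 3 - y by linarith)]

lemma plateau_eq_zero {y : ℝ} (h : y ∉ Icc (-2 : ℝ) 3) : plateau y = 0 := by
  rw [mem_Icc, not_and_or, not_le, not_le] at h
  rcases h with h | h
  · simp [plateau, Real.smoothTransition.zero_of_nonpos (show y + 2 ≤ 0 by linarith)]
  · simp [plateau, Real.smoothTransition.zero_of_nonpos (show 3 - y ≤ 0 by linarith)]

/-- A smooth function is made a test function without changing it near `[0,1]`. -/
lemma isTest1_mul_plateau {q : ℝ → ℝ} (hq : ContDiff ℝ ∞ q) :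
    IsTest1 (fun y => ((q y * plateau y : ℝ) : ℂ)) := by
  refine ⟨Complex.ofRealCLM.contDiff.comp (hq.mul contDiff_plateau),
    HasCompactSupport.intro (isCompact_Icc (a := (-2:ℝ)) (b := 3)) fun y hy => ?_⟩
  simp [plateau_eq_zero hy]

lemma mul_plateau_eventuallyEq {q : ℝ → ℝ} {y : ℝ} (hy : y ∈ Ioo (0:ℝ) 1) :
    (fun y => ((q y * plateau y : ℝ) : ℂ)) =ᶠ[𝓝 y] fun y => (q y : ℂ) := by
  filter_upwards [Ioo_mem_nhds hy.1 hy.2] with z hz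
  rw [plateau_eq_one (by linarith [hz.1]) (by linarith [hz.2]), mul_one]

/-- Smooth functions with compact support in `(0,1)` that increase to `1`. -/
def eta (j : ℕ) (y : ℝ) : ℝ :=
  Real.smoothTransition (j * y - 1) * Real.smoothTransition (j * (1 - y) - 1)

lemma contDiff_eta (j : ℕ) : ContDiff ℝ ∞ (eta j) :=
  (Real.smoothTransition.contDiff.comp ((contDiff_const.mul contDiff_id).sub contDiff_const)).mul
    (Real.smoothTransition.contDiff.comp
      ((contDiff_const.mul (contDiff_const.sub contDiff_id)).sub contDiff_const))

lemma eta_nonneg (j : ℕ) (y : ℝ) : 0 ≤ eta j y :=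
  mul_nonneg (Real.smoothTransition.nonneg _) (Real.smoothTransition.nonneg _)

lemma eta_le_one (j : ℕ) (y : ℝ) : eta j y ≤ 1 :=
  mul_le_one₀ (Real.smoothTransition.le_one _) (Real.smoothTransition.nonneg _)
    (Real.smoothTransition.le_one _)

lemma tsupport_eta_subset (j : ℕ) : tsupport (eta j) ⊆ {y | 1 ≤ j * y ∧ 1 ≤ j * (1 - y)} := by
  have hc1 : IsClosed {y : ℝ | 1 ≤ j * y} := isClosed_le (by fun_prop) (by fun_prop)
  have hc2 : IsClosed {y : ℝ | 1 ≤ j * (1 - y)} := isClosed_le (by fun_prop) (by fun_prop)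
  refine closure_minimal (fun y hy => ?_) (hc1.inter hc2)
  rw [Function.mem_support, eta] at hy
  have h1 := left_ne_zero_of_mul hy
  have h2 := right_ne_zero_of_mul hy
  rw [ne_eq, Real.smoothTransition.zero_iff_nonpos, not_le] at h1 h2
  exact ⟨by linarith, by linarith⟩

lemma tsupport_eta_subset_Ioo (j : ℕ) : tsupport (eta j) ⊆ Ioo 0 1 := by
  intro y hy
  obtain ⟨h1, h2⟩ := tsupport_eta_subset j hy
  have hj : (0:ℝ) ≤ j := j.cast_nonneg
  constructor
  · by_contra h
    nlinarith
  · by_contra h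
    nlinarith

lemma eta_eventuallyEq_one {y : ℝ} (hy : y ∈ Ioo (0:ℝ) 1) :
    ∀ᶠ j : ℕ in atTop, eta j =ᶠ[𝓝 y] fun _ => 1 := by
  obtain ⟨j0, hj0⟩ := exists_nat_gt (max (2 / y) (2 / (1 - y)))
  filter_upwards [eventually_ge_atTop j0] with j hj
  have hjj : (j0 : ℝ) ≤ j := by exact_mod_cast hj
  have h1 : 2 < j * y := by
    have := (le_max_left _ _).trans_lt (hj0.trans_le hjj)
    rwa [div_lt_iff₀ hy.1] at this
  have h2 : 2 < j * (1 - y) := by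
    have := (le_max_right _ _).trans_lt (hj0.trans_le hjj)
    rwa [div_lt_iff₀ (by linarith [hy.2])] at this
  have o1 : IsOpen {z : ℝ | 2 < j * z} := isOpen_lt (by fun_prop) (by fun_prop)
  have o2 : IsOpen {z : ℝ | 2 < j * (1 - z)} := isOpen_lt (by fun_prop) (by fun_prop)
  filter_upwards [o1.mem_nhds h1, o2.mem_nhds h2] with z hz1 hz2
  have hz3 : 2 < j * z := hz1
  have hz4 : 2 < j * (1 - z) := hz2
  simp [eta, Real.smoothTransition.one_of_one_le (show (1:ℝ) ≤ j * z - 1 by linarith),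
    Real.smoothTransition.one_of_one_le (show (1:ℝ) ≤ j * (1 - z) - 1 by linarith)]

/-- The derivative is supported in [0,1]. The second clause is phrased with `t + 1` because the
arguments used later are j·y - 1 and its mirror image. -/
lemma exists_deriv_smoothTransition_bound :
    ∃ C, 0 ≤ C ∧ ∀ t, |deriv Real.smoothTransition t| ≤ C ∧
      (2 < t + 1 → deriv Real.smoothTransition t = 0) := by
  have hcont : Continuous (deriv Real.smoothTransition) :=
    (Real.smoothTransition.contDiff (n := ⊤)).continuous_deriv (by simp)
  obtain ⟨C, hC⟩ := (isCompact_Icc (a := (0:ℝ)) (b := 1)).exists_bound_of_continuousOn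
    hcont.continuousOn
  have hr : ∀ t : ℝ, 1 < t → deriv Real.smoothTransition t = 0 := by
    intro t ht
    have : Real.smoothTransition =ᶠ[𝓝 t] fun _ => 1 := by
      filter_upwards [Ioi_mem_nhds ht] with s hs
      exact Real.smoothTransition.one_of_one_le (le_of_lt hs)
    rw [this.deriv_eq]; simp
  have hl : ∀ t : ℝ, t < 0 → deriv Real.smoothTransition t = 0 := by
    intro t ht
    have : Real.smoothTransition =ᶠ[𝓝 t] fun _ => 0 := by
      filter_upwards [Iio_mem_nhds ht] with s hs
      exact Real.smoothTransition.zero_of_nonpos (le_of_lt hs)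
    rw [this.deriv_eq]; simp
  have hC0 : 0 ≤ C := (norm_nonneg _).trans (hC 0 (by simp))
  refine ⟨C, hC0, fun t => ⟨?_, fun h => hr t (by linarith)⟩⟩
  by_cases h0 : t < 0
  · simpa [hl t h0] using hC0
  by_cases h1 : 1 < t
  · simpa [hr t h1] using hC0
  · exact hC t ⟨not_lt.1 h0, not_lt.1 h1⟩

/-- The sine also vanishes at y = 1: this is the counterpart, at the upper wall, of |sin t| ≤ |t| at
the lower one. -/
lemma abs_sin_nat_mul_pi_le (n : ℕ) (y : ℝ) :
    |Real.sin (n * Real.pi * y)| ≤ n * Real.pi * |1 - y| := by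
  have h : Real.sin (n * Real.pi * y) = -((-1) ^ n * Real.sin (n * Real.pi * (1 - y))) := by
    rw [mul_sub, mul_one, Real.sin_sub, Real.sin_nat_mul_pi, Real.cos_nat_mul_pi]
    rw [zero_mul, zero_sub, mul_neg, neg_neg, ← mul_assoc, ← pow_add, ← two_mul,
      pow_mul]
    simp
  rw [h, abs_neg, abs_mul, abs_pow, abs_neg, abs_one, one_pow, one_mul]
  refine Real.abs_sin_le_abs.trans ?_
  rw [abs_mul, abs_of_nonneg (show (0:ℝ) ≤ n * Real.pi by positivity)]

/-- The derivative of η_j is of size j but lives within distance 2/j of the walls, where φ_n' is of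
the order of that distance because it vanishes at y = 0 and y = 1. The product is therefore bounded
uniformly in j, which is the domination needed to remove the cut-off. -/
lemma exists_deriv_dphi_mul_eta_bound (n : ℕ) :
    ∃ C, ∀ (j : ℕ), ∀ y ∈ Ioo (0:ℝ) 1, |deriv (fun y => dphi n y * eta j y) y| ≤ C := by
  obtain ⟨C, hC0, hC⟩ := exists_deriv_smoothTransition_bound
  set M : ℝ := (n:ℝ) ^ 2 * Real.pi ^ 2 with hM
  have hM0 : 0 ≤ M := by positivity
  have e1 : ∀ y ∈ Ioo (0:ℝ) 1, |dphi n y| ≤ 2 * M * y := by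
    intro y hy
    rw [dphi, abs_neg, abs_mul, abs_mul, abs_of_pos (amp_pos n),
      abs_of_nonneg (show (0:ℝ) ≤ n * Real.pi by positivity)]
    have h1 : |Real.sin (n * Real.pi * y)| ≤ n * Real.pi * y := by
      refine Real.abs_sin_le_abs.trans (le_of_eq (abs_of_nonneg ?_))
      have := hy.1.le; positivity
    calc _ ≤ 2 * (n * Real.pi) * (n * Real.pi * y) := by
          gcongr; exact amp_le n
      _ = _ := by rw [hM]; ring
  have e2 : ∀ y ∈ Ioo (0:ℝ) 1, |dphi n y| ≤ 2 * M * (1 - y) := by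
    intro y hy
    rw [dphi, abs_neg, abs_mul, abs_mul, abs_of_pos (amp_pos n),
      abs_of_nonneg (show (0:ℝ) ≤ n * Real.pi by positivity)]
    have h1 := abs_sin_nat_mul_pi_le n y
    rw [abs_of_nonneg (show 0 ≤ 1 - y by linarith [hy.2])] at h1
    calc _ ≤ 2 * (n * Real.pi) * (n * Real.pi * (1 - y)) := by
          gcongr; exact amp_le n
      _ = _ := by rw [hM]; ring
  -- The first term bounds φ_n'' η_j. The other two are 2M·dist·jC with j·dist ≤ 2, one for each
  -- wall.
  refine ⟨M * 2 + 4 * M * C + 4 * M * C, fun j y hy => ?_⟩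
  have hT : ∀ t, HasDerivAt Real.smoothTransition (deriv Real.smoothTransition t) t := fun t =>
    ((Real.smoothTransition.contDiff (n := ⊤)).differentiable (by simp) t).hasDerivAt
  have hd1 : HasDerivAt (fun y : ℝ => (j:ℝ) * y - 1) (j:ℝ) y := by
    simpa using ((hasDerivAt_id y).const_mul (j:ℝ)).sub_const 1
  have hd2 : HasDerivAt (fun y : ℝ => (j:ℝ) * (1 - y) - 1) (-(j:ℝ)) y := by
    simpa using (((hasDerivAt_id y).const_sub 1).const_mul (j:ℝ)).sub_const 1
  have h1 := (hT (j * y - 1)).comp y hd1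
  have h2 := (hT (j * (1 - y) - 1)).comp y hd2
  have h3 := (hasDerivAt_dphi n y).mul (h1.mul h2)
  have h4 : HasDerivAt (fun y => dphi n y * eta j y) _ y := h3
  rw [h4.deriv]
  simp only [Function.comp, Pi.mul_apply]
  set a := Real.smoothTransition (j * y - 1)
  set b := Real.smoothTransition (j * (1 - y) - 1)
  set a' := deriv Real.smoothTransition (j * y - 1) with ha'
  set b' := deriv Real.smoothTransition (j * (1 - y) - 1) with hb'
  have ha0 : |a| ≤ 1 := abs_le.2 ⟨by linarith [Real.smoothTransition.nonneg (j * y - 1)],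
    Real.smoothTransition.le_one _⟩
  have hb0 : |b| ≤ 1 := abs_le.2 ⟨by linarith [Real.smoothTransition.nonneg (j * (1 - y) - 1)],
    Real.smoothTransition.le_one _⟩
  have t1 : |-((n:ℝ) ^ 2 * Real.pi ^ 2 * phi n y) * (a * b)| ≤ M * 2 := by
    rw [abs_mul, abs_neg, ← hM, abs_mul M, abs_mul a, abs_of_nonneg hM0]
    calc M * |phi n y| * (|a| * |b|) ≤ M * 2 * (1 * 1) := by
          gcongr; exact abs_phi_le n y
      _ = _ := by ring
  have t2 : |dphi n y| * (j * |a'|) ≤ 4 * M * C := by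
    by_cases hjy : 2 < j * y
    · rw [ha', (hC _).2 (by linarith)]; simp; positivity
    · calc |dphi n y| * (j * |a'|) ≤ (2 * M * y) * (j * C) := by
            gcongr
            · have := hy.1.le; positivity
            · exact e1 y hy
            · exact (hC _).1
        _ = 2 * M * C * (j * y) := by ring
        _ ≤ 2 * M * C * 2 := by gcongr; exact not_lt.1 hjy
        _ = _ := by ring
  have t3 : |dphi n y| * (j * |b'|) ≤ 4 * M * C := by
    by_cases hjy : 2 < j * (1 - y)
    · rw [hb', (hC _).2 (by linarith)]; simp; positivity
    · calc |dphi n y| * (j * |b'|) ≤ (2 * M * (1 - y)) * (j * C) := by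
            gcongr
            · have := hy.2.le; have : 0 ≤ 1 - y := by linarith
              positivity
            · exact e2 y hy
            · exact (hC _).1
        _ = 2 * M * C * (j * (1 - y)) := by ring
        _ ≤ 2 * M * C * 2 := by gcongr; exact not_lt.1 hjy
        _ = _ := by ring
  have hj : (0:ℝ) ≤ j := j.cast_nonneg
  calc _ ≤ |-((n:ℝ) ^ 2 * Real.pi ^ 2 * phi n y) * (a * b)| +
        |dphi n y * (a' * j * b + a * (b' * -j))| := abs_add_le _ _
    _ ≤ M * 2 + (|dphi n y| * (j * |a'|) * 1 + |dphi n y| * (j * |b'|) * 1) := by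
        refine add_le_add t1 ?_
        rw [mul_add]
        refine (abs_add_le _ _).trans (add_le_add ?_ ?_)
        · rw [abs_mul, abs_mul, abs_mul, abs_of_nonneg hj]
          calc |dphi n y| * (|a'| * j * |b|) = |dphi n y| * (j * |a'|) * |b| := by ring
            _ ≤ _ := by gcongr
        · rw [abs_mul, abs_mul, abs_mul, abs_neg, abs_of_nonneg hj]
          calc |dphi n y| * (|a| * (|b'| * j)) = |dphi n y| * (j * |b'|) * |a| := by ring
            _ ≤ _ := by gcongr
    _ ≤ _ := by rw [mul_one, mul_one]; linarith

/-! ### Modal coefficients of H¹ functions -/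

lemma IsH1Loc.l2Loc {f fx fy : ℝ × ℝ → ℂ} (h : IsH1Loc f fx fy) : L2Loc f := h.memLp
lemma IsH1Loc.l2Loc_x {f fx fy : ℝ × ℝ → ℂ} (h : IsH1Loc f fx fy) : L2Loc fx := h.memLp_x
lemma IsH1Loc.l2Loc_y {f fx fy : ℝ × ℝ → ℂ} (h : IsH1Loc f fx fy) : L2Loc fy := h.memLp_y

/-- Dominated convergence that removes a cut-off in y: weak gradients can be tested only inside the
strip, while φ_n and φ_n' are not compactly supported in (0,1). -/
lemma tendsto_integral_tensor {f : ℝ × ℝ → ℂ} (hf : L2Loc f) {ψ : ℝ → ℂ} (hc : Continuous ψ)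
    (hψ : HasCompactSupport ψ) {q : ℕ → ℝ → ℝ} {q0 : ℝ → ℝ} {C : ℝ} (hq : ∀ j, Continuous (q j))
    (hC : ∀ j, ∀ y ∈ Ioo (0:ℝ) 1, |q j y| ≤ C)
    (hlim : ∀ y ∈ Ioo (0:ℝ) 1, Tendsto (fun j => q j y) atTop (𝓝 (q0 y))) :
    Tendsto (fun j => ∫ p in strip, f p * (ψ p.1 * (q j p.2 : ℂ))) atTop
      (𝓝 (∫ p in strip, f p * (ψ p.1 * (q0 p.2 : ℂ)))) := by
  have hi : Integrable (fun p => f p * (ψ p.1 * ((1 : ℝ) : ℂ))) (volume.restrict strip) :=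
    hf.integrable_mul (by fun_prop) (xSupp_tensor (q := fun _ => ((1:ℝ):ℂ)) hψ)
  refine tendsto_integral_of_dominated_convergence
    (fun p => ‖f p * (ψ p.1 * ((1 : ℝ) : ℂ))‖ * C) (fun j => ?_) (hi.norm.mul_const C)
    (fun j => ?_) ?_
  · have := hq j
    exact (hf.aestronglyMeasurable).mul (Continuous.aestronglyMeasurable (by fun_prop))
  · refine (ae_restrict_mem measurableSet_strip).mono fun p hp => ?_
    simp only [norm_mul, Complex.norm_real, norm_one, mul_one, Real.norm_eq_abs]
    rw [← mul_assoc]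
    gcongr
    exact hC j p.2 hp
  · refine (ae_restrict_mem measurableSet_strip).mono fun p hp => ?_
    exact ((Complex.continuous_ofReal.tendsto _).comp (hlim p.2 hp)).const_mul _ |>.const_mul _

lemma eta_tendsto {y : ℝ} (hy : y ∈ Ioo (0:ℝ) 1) :
    Tendsto (fun j => eta j y) atTop (𝓝 1) := by
  refine tendsto_const_nhds.congr' ?_
  filter_upwards [eta_eventuallyEq_one hy] with j hj
  exact hj.eq_of_nhds.symm

lemma isTest1_mul_eta {q : ℝ → ℝ} (hq : ContDiff ℝ ∞ q) (j : ℕ) :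
    IsTest1 (fun y => ((q y * eta j y : ℝ) : ℂ)) ∧
      tsupport (fun y => ((q y * eta j y : ℝ) : ℂ)) ⊆ Ioo 0 1 := by
  have h0 : tsupport (fun y => ((q y * eta j y : ℝ) : ℂ)) ⊆ tsupport (eta j) :=
    closure_mono fun y hy => by
      simp only [Function.mem_support, ne_eq, Complex.ofReal_eq_zero, mul_eq_zero, not_or] at hy
      exact hy.2
  refine ⟨⟨Complex.ofRealCLM.contDiff.comp (hq.mul (contDiff_eta j)), ?_⟩,
    h0.trans (tsupport_eta_subset_Ioo j)⟩
  refine (isCompact_Icc (a := (0:ℝ)) (b := 1)).of_isClosed_subset (isClosed_tsupport _)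
    ((h0.trans (tsupport_eta_subset_Ioo j)).trans Ioo_subset_Icc_self)

lemma deriv_ofReal_comp {q : ℝ → ℝ} {y : ℝ} (hq : DifferentiableAt ℝ q y) :
    deriv (fun y => ((q y : ℝ) : ℂ)) y = ((deriv q y : ℝ) : ℂ) :=
  hq.hasDerivAt.ofReal_comp.deriv

lemma tsupport_tensor_subset_strip {ψ q : ℝ → ℂ} (hq : tsupport q ⊆ Ioo 0 1) :
    tsupport (tensor ψ q) ⊆ strip :=
  (tsupport_tensor_subset ψ q).trans fun _ hp => hq hp.2

/-- The modal coefficients of the `x`-derivative are the derivatives of the coefficients. -/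
lemma IsH1Loc.integral_coef_mul_deriv {f fx fy : ℝ × ℝ → ℂ} (h : IsH1Loc f fx fy) (n : ℕ)
    {ψ : ℝ → ℂ} (hψ : IsTest1 ψ) :
    ∫ x, coef f n x * deriv ψ x = -∫ x, coef fx n x * ψ x := by
  have hq : ∀ j, ContDiff ℝ ∞ (fun y => phi n y * eta j y) := fun j =>
    (contDiff_phi n).mul (contDiff_eta j)
  have hb : ∀ j, ∀ y ∈ Ioo (0:ℝ) 1, |phi n y * eta j y| ≤ 2 := by
    intro j y _
    rw [abs_mul, abs_of_nonneg (eta_nonneg j y)]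
    calc _ ≤ (2:ℝ) * 1 := mul_le_mul (abs_phi_le n y) (eta_le_one j y) (eta_nonneg j y) (by norm_num)
      _ = 2 := by norm_num
  have hl : ∀ y ∈ Ioo (0:ℝ) 1, Tendsto (fun j => phi n y * eta j y) atTop (𝓝 (phi n y)) := by
    intro y hy
    simpa using (eta_tendsto hy).const_mul (phi n y)
  have h1 := tendsto_integral_tensor h.l2Loc hψ.derivative.continuous hψ.derivative.2
    (fun j => (hq j).continuous) hb hl
  have h2 := tendsto_integral_tensor h.l2Loc_x hψ.continuous hψ.2
    (fun j => (hq j).continuous) hb hl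
  rw [h.l2Loc.integral_mul_tensor hψ.derivative.continuous hψ.derivative.2 (continuous_phi n)] at h1
  rw [h.l2Loc_x.integral_mul_tensor hψ.continuous hψ.2 (continuous_phi n)] at h2
  -- The identity holds for each φ_n η_j, which is admissible for the weak gradient, and both sides
  -- pass to the limit.
  refine tendsto_nhds_unique h1 (h2.neg.congr fun j => ?_)
  obtain ⟨hT, hs⟩ := isTest1_mul_eta (contDiff_phi n) j
  have h3 := (h.grad _ (isTest_tensor hψ hT) (tsupport_tensor_subset_strip hs)).1
  simp_rw [(hasFDerivAt_tensor (hψ.differentiable _) (hT.differentiable _)).1] at h3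
  rw [h3]
  rfl

/-- The modal form of the Neumann condition, in integrated form. -/
lemma IsH1Loc.integral_dphi_mul {f fx fy : ℝ × ℝ → ℂ} (h : IsH1Loc f fx fy) (n : ℕ) :
    ∀ᵐ x : ℝ, ∫ y, fy (x, y) * (dphi n y : ℂ) ∂nu =
      ((n : ℂ) ^ 2 * (Real.pi : ℂ) ^ 2) * coef f n x := by
  obtain ⟨C, hC⟩ := exists_deriv_dphi_mul_eta_bound n
  refine ae_eq_of_forall_test (h.l2Loc_y.locallyIntegrable_integral_mul (continuous_dphi n))
    ((h.l2Loc.locallyIntegrable_coef n).smul ((n : ℂ) ^ 2 * (Real.pi : ℂ) ^ 2)) fun ψ hψ => ?_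
  have hq : ∀ j, ContDiff ℝ ∞ (fun y => dphi n y * eta j y) := fun j =>
    (contDiff_dphi n).mul (contDiff_eta j)
  have hl : ∀ y ∈ Ioo (0:ℝ) 1, Tendsto (fun j => dphi n y * eta j y) atTop (𝓝 (dphi n y)) := by
    intro y hy
    simpa using (eta_tendsto hy).const_mul (dphi n y)
  have hb : ∀ j, ∀ y ∈ Ioo (0:ℝ) 1, |dphi n y * eta j y| ≤ 2 * (n * Real.pi) := by
    intro j y _
    rw [abs_mul, abs_of_nonneg (eta_nonneg j y)]
    calc _ ≤ (2 * (n * Real.pi)) * 1 := mul_le_mul (abs_dphi_le n y) (eta_le_one j y)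
          (eta_nonneg j y) (by positivity)
      _ = _ := by ring
  -- Near a given y the cut-off is eventually 1, so the limit is φ_n'' = -n²π²φ_n. No boundary term
  -- survives since φ_n' vanishes on the walls; f itself need not satisfy any boundary condition.
  have hl' : ∀ y ∈ Ioo (0:ℝ) 1, Tendsto (fun j => deriv (fun y => dphi n y * eta j y) y) atTop
      (𝓝 (-((n : ℝ) ^ 2 * Real.pi ^ 2 * phi n y))) := by
    intro y hy
    refine tendsto_const_nhds.congr' ?_
    filter_upwards [eta_eventuallyEq_one hy] with j hj
    have : (fun y => dphi n y * eta j y) =ᶠ[𝓝 y] dphi n := by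
      filter_upwards [hj] with z hz
      rw [hz, mul_one]
    rw [this.deriv_eq, (hasDerivAt_dphi n y).deriv]
  have h1 := tendsto_integral_tensor h.l2Loc hψ.continuous hψ.2
    (fun j => (hq j).continuous_deriv (by simp)) hC hl'
  have h2 := tendsto_integral_tensor h.l2Loc_y hψ.continuous hψ.2
    (fun j => (hq j).continuous) hb hl
  rw [h.l2Loc_y.integral_mul_tensor hψ.continuous hψ.2 (continuous_dphi n)] at h2
  have h4 : ∫ p in strip, f p * (ψ p.1 * ((-((n : ℝ) ^ 2 * Real.pi ^ 2 * phi n p.2) : ℝ) : ℂ)) =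
      -(∫ x, ((n : ℂ) ^ 2 * (Real.pi : ℂ) ^ 2) • coef f n x * ψ x) := by
    have e : ∀ p : ℝ × ℝ, f p * (ψ p.1 * ((-((n : ℝ) ^ 2 * Real.pi ^ 2 * phi n p.2) : ℝ) : ℂ)) =
        (-((n : ℂ) ^ 2 * (Real.pi : ℂ) ^ 2)) * (f p * (ψ p.1 * (phi n p.2 : ℂ))) := by
      intro p; push_cast; ring
    simp_rw [e]
    rw [integral_const_mul, h.l2Loc.integral_mul_tensor hψ.continuous hψ.2 (continuous_phi n),
      neg_mul, ← integral_const_mul]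
    congr 2
    funext x
    simp only [coef, modalCoeff, smul_eq_mul]
    ring
  rw [h4] at h1
  refine neg_injective (tendsto_nhds_unique h2.neg (h1.congr fun j => ?_))
  obtain ⟨hT, hs⟩ := isTest1_mul_eta (contDiff_dphi n) j
  have h3 := (h.grad _ (isTest_tensor hψ hT) (tsupport_tensor_subset_strip hs)).2
  simp_rw [(hasFDerivAt_tensor (hψ.differentiable _) (hT.differentiable _)).2] at h3
  have e2 : ∀ y, deriv (fun y => ((dphi n y * eta j y : ℝ) : ℂ)) y =
      ((deriv (fun y => dphi n y * eta j y) y : ℝ) : ℂ) := fun y =>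
    deriv_ofReal_comp ((hq j).differentiable (by simp) y)
  simp_rw [e2] at h3
  rw [h3]
  rfl

/-! ### Scaled solutions -/

/-- A bounded measurable coefficient equal to `1` for `|x| ≥ L`. -/
structure IsMedium (γ : ℝ × ℝ → ℝ) (L : ℝ) : Prop where
  meas : AEMeasurable γ (volume.restrict strip)
  bdd : ∃ M : ℝ, ∀ p ∈ strip, |γ p| ≤ M
  one : ∀ p ∈ strip, L ≤ |p.1| → γ p = 1

/-- A measurable unimodular function of `x`. -/
structure IsPhase (B : ℝ → ℂ) : Prop where
  meas : Measurable B
  norm : ∀ x, ‖B x‖ = 1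

/-- `w` is a locally `H¹` weak solution of
`B ∂_x(B ∂_x w) + ∂_y² w + k² γ w = 0` with Neumann boundary conditions. -/
structure ScaledSol (γ : ℝ × ℝ → ℝ) (B : ℝ → ℂ) (k : ℝ) (w wx wy : ℝ × ℝ → ℂ) : Prop where
  h1 : IsH1Loc w wx wy
  weak : ∀ v : ℝ × ℝ → ℂ, IsTest v →
    ∫ p in strip, (B p.1 * wx p * dx v p + (B p.1)⁻¹ * wy p * dy v p
      - (k : ℂ) ^ 2 * (γ p : ℂ) * (B p.1)⁻¹ * w p * v p) = 0

lemma IsPhase.inv {B : ℝ → ℂ} (hB : IsPhase B) : IsPhase (fun x => (B x)⁻¹) :=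
  ⟨hB.meas.inv, fun x => by rw [norm_inv, hB.norm, inv_one]⟩

lemma IsPhase.l2Loc_mul {B : ℝ → ℂ} (hB : IsPhase B) {f : ℝ × ℝ → ℂ} (hf : L2Loc f) :
    L2Loc (fun p => B p.1 * f p) :=
  hf.bdd_mul (hB.meas.comp measurable_fst).aestronglyMeasurable (C := 1)
    fun p _ => (hB.norm p.1).le

lemma IsMedium.l2Loc_mul {γ : ℝ × ℝ → ℝ} {L : ℝ} (hγ : IsMedium γ L) {f : ℝ × ℝ → ℂ}
    (hf : L2Loc f) : L2Loc (fun p => (γ p : ℂ) * f p) := by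
  obtain ⟨M, hM⟩ := hγ.bdd
  refine hf.bdd_mul (Complex.measurable_ofReal.comp_aemeasurable hγ.meas).aestronglyMeasurable
    (C := M) fun p hp => ?_
  simpa using hM p hp

lemma coef_phase_mul (B : ℝ → ℂ) (f : ℝ × ℝ → ℂ) (n : ℕ) (x : ℝ) :
    coef (fun p => B p.1 * f p) n x = B x * coef f n x := by
  simp only [coef, modalCoeff, mul_assoc]
  rw [integral_const_mul]

lemma continuous_dx {v : ℝ × ℝ → ℂ} (hv : IsTest v) : Continuous (dx v) :=
  (hv.1.continuous_fderiv (by simp)).clm_apply continuous_const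

lemma continuous_dy {v : ℝ × ℝ → ℂ} (hv : IsTest v) : Continuous (dy v) :=
  (hv.1.continuous_fderiv (by simp)).clm_apply continuous_const

lemma hasCompactSupport_dx {v : ℝ × ℝ → ℂ} (hv : IsTest v) : HasCompactSupport (dx v) :=
  (hv.2.fderiv (𝕜 := ℝ)).comp_left (g := fun A : ℝ × ℝ →L[ℝ] ℂ => A (1, 0)) (by simp)

lemma hasCompactSupport_dy {v : ℝ × ℝ → ℂ} (hv : IsTest v) : HasCompactSupport (dy v) :=
  (hv.2.fderiv (𝕜 := ℝ)).comp_left (g := fun A : ℝ × ℝ →L[ℝ] ℂ => A (0, 1)) (by simp)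

/-- The modal equations satisfied by a scaled solution. -/
lemma ScaledSol.modal {γ : ℝ × ℝ → ℝ} {L : ℝ} (hγ : IsMedium γ L) {B : ℝ → ℂ} (hB : IsPhase B)
    {k : ℝ} {w wx wy : ℝ × ℝ → ℂ} (h : ScaledSol γ B k w wx wy) (n : ℕ) {ψ : ℝ → ℂ}
    (hψ : IsTest1 ψ) :
    ∫ x, B x * coef wx n x * deriv ψ x =
      -∫ x, (B x)⁻¹ * (((n : ℂ) ^ 2 * (Real.pi : ℂ) ^ 2) * coef w n x -
        (k : ℂ) ^ 2 * coef (fun p => (γ p : ℂ) * w p) n x) * ψ x := by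
  -- φ_n is truncated only away from [0,1]: the test functions of the weak form are free on the
  -- walls, which encodes the Neumann condition on w.
  have hT := isTest1_mul_plateau (contDiff_phi n)
  have h0 := h.weak _ (isTest_tensor hψ hT)
  have l1 : L2Loc (fun p => B p.1 * wx p) := hB.l2Loc_mul h.h1.l2Loc_x
  have l2 : L2Loc (fun p => (B p.1)⁻¹ * wy p) := hB.inv.l2Loc_mul h.h1.l2Loc_y
  have l3 : L2Loc (fun p => (B p.1)⁻¹ * ((γ p : ℂ) * w p)) :=
    hB.inv.l2Loc_mul (hγ.l2Loc_mul h.h1.l2Loc)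
  have hd := hψ.derivative
  have i1 : Integrable (fun p => B p.1 * wx p * (deriv ψ p.1 * (phi n p.2 : ℂ)))
      (volume.restrict strip) :=
    l1.integrable_mul (by have := hd.continuous; fun_prop)
      (xSupp_tensor (q := fun y => (phi n y : ℂ)) hd.2)
  have i2 : Integrable (fun p => (B p.1)⁻¹ * wy p * (ψ p.1 * (dphi n p.2 : ℂ)))
      (volume.restrict strip) :=
    l2.integrable_mul (by have := hψ.continuous; fun_prop)
      (xSupp_tensor (q := fun y => (dphi n y : ℂ)) hψ.2)
  have i3 : Integrable (fun p => (B p.1)⁻¹ * ((γ p : ℂ) * w p) * (ψ p.1 * (phi n p.2 : ℂ)))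
      (volume.restrict strip) :=
    l3.integrable_mul (by have := hψ.continuous; fun_prop)
      (xSupp_tensor (q := fun y => (phi n y : ℂ)) hψ.2)
  have e : ∫ p in strip, (B p.1 * wx p * dx (tensor ψ fun y => ((phi n y * plateau y : ℝ) : ℂ)) p
      + (B p.1)⁻¹ * wy p * dy (tensor ψ fun y => ((phi n y * plateau y : ℝ) : ℂ)) p
      - (k : ℂ) ^ 2 * (γ p : ℂ) * (B p.1)⁻¹ * w p *
        tensor ψ (fun y => ((phi n y * plateau y : ℝ) : ℂ)) p) =
      ∫ p in strip, (B p.1 * wx p * (deriv ψ p.1 * (phi n p.2 : ℂ))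
      + (B p.1)⁻¹ * wy p * (ψ p.1 * (dphi n p.2 : ℂ))
      - (k : ℂ) ^ 2 * ((B p.1)⁻¹ * ((γ p : ℂ) * w p) * (ψ p.1 * (phi n p.2 : ℂ)))) := by
    refine setIntegral_congr_fun measurableSet_strip fun p hp => ?_
    have e1 := mul_plateau_eventuallyEq (q := phi n) (y := p.2) hp
    obtain ⟨e2, e3⟩ := hasFDerivAt_tensor (p := p) (hψ.differentiable _) (hT.differentiable _)
    rw [e2, e3, e1.eq_of_nhds, e1.deriv_eq,
      deriv_ofReal_comp (hasDerivAt_phi n _).differentiableAt, (hasDerivAt_phi n _).deriv, tensor,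
      e1.eq_of_nhds]
    ring
  have i12 : Integrable (fun p => B p.1 * wx p * (deriv ψ p.1 * (phi n p.2 : ℂ)) +
      (B p.1)⁻¹ * wy p * (ψ p.1 * (dphi n p.2 : ℂ))) (volume.restrict strip) := i1.add i2
  rw [e, integral_sub i12 (i3.const_mul _), integral_add i1 i2, integral_const_mul,
    l1.integral_mul_tensor hd.continuous hd.2 (continuous_phi n),
    l2.integral_mul_tensor hψ.continuous hψ.2 (continuous_dphi n),
    l3.integral_mul_tensor hψ.continuous hψ.2 (continuous_phi n)] at h0
  have c1 : ∀ x, ∫ y, B x * wx (x, y) * (phi n y : ℂ) ∂nu = B x * coef wx n x :=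
    fun x => coef_phase_mul B wx n x
  have c3 : ∀ x, ∫ y, (B x)⁻¹ * ((γ (x, y) : ℂ) * w (x, y)) * (phi n y : ℂ) ∂nu =
      (B x)⁻¹ * coef (fun p => (γ p : ℂ) * w p) n x :=
    fun x => coef_phase_mul (fun x => (B x)⁻¹) (fun p => (γ p : ℂ) * w p) n x
  have c2 : ∫ x, (∫ y, (B x)⁻¹ * wy (x, y) * (dphi n y : ℂ) ∂nu) * ψ x =
      ∫ x, ((B x)⁻¹ * (((n : ℂ) ^ 2 * (Real.pi : ℂ) ^ 2) * coef w n x)) * ψ x := by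
    refine integral_congr_ae ?_
    filter_upwards [h.h1.integral_dphi_mul n] with x hx
    simp only [mul_assoc]
    rw [integral_const_mul]
    simp only [mul_assoc] at hx
    rw [hx]
    ring
  simp_rw [c1, c3] at h0
  rw [c2] at h0
  have j2 : Integrable fun x => ((B x)⁻¹ * (((n : ℂ) ^ 2 * (Real.pi : ℂ) ^ 2) * coef w n x)) * ψ x := by
    have := (integrable_mul_test ((hB.inv.l2Loc_mul h.h1.l2Loc).locallyIntegrable_coef n)
      hψ.continuous hψ.2).const_mul ((n : ℂ) ^ 2 * (Real.pi : ℂ) ^ 2)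
    refine this.congr (Eventually.of_forall fun x => ?_)
    simp only [coef_phase_mul (fun x => (B x)⁻¹) w]
    ring
  have j3 : Integrable fun x => (B x)⁻¹ * coef (fun p => (γ p : ℂ) * w p) n x * ψ x := by
    have := integrable_mul_test (l3.locallyIntegrable_coef n) hψ.continuous hψ.2
    refine this.congr (Eventually.of_forall fun x => ?_)
    simp only [coef_phase_mul (fun x => (B x)⁻¹) (fun p => (γ p : ℂ) * w p)]
  have j4 : ∫ x, (B x)⁻¹ * (((n : ℂ) ^ 2 * (Real.pi : ℂ) ^ 2) * coef w n x -
        (k : ℂ) ^ 2 * coef (fun p => (γ p : ℂ) * w p) n x) * ψ x =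
      (∫ x, ((B x)⁻¹ * (((n : ℂ) ^ 2 * (Real.pi : ℂ) ^ 2) * coef w n x)) * ψ x) -
        (k : ℂ) ^ 2 * ∫ x, (B x)⁻¹ * coef (fun p => (γ p : ℂ) * w p) n x * ψ x := by
    rw [← integral_const_mul, ← integral_sub j2 (j3.const_mul _)]
    refine integral_congr_ae (Eventually.of_forall fun x => ?_)
    simp only
    ring
  rw [j4]
  linear_combination h0

/-! ### Weak ordinary differential equations on an interval -/

lemma integrable_mul_test_on {U : Set ℝ} {f ψ : ℝ → ℂ} (hf : LocallyIntegrableOn f U)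
    (hc : Continuous ψ) (hψ : HasCompactSupport ψ) (hs : tsupport ψ ⊆ U) :
    Integrable (fun x => f x * ψ x) := by
  have h1 : IntegrableOn (fun x => f x * ψ x) (tsupport ψ) := by
    obtain ⟨C, hC⟩ := hψ.isCompact.exists_bound_of_continuousOn hc.continuousOn
    refine Integrable.mul_bdd (c := C)
      (hf.integrableOn_compact_subset hs hψ.isCompact) hc.aestronglyMeasurable ?_
    exact (ae_restrict_mem (isClosed_tsupport ψ).measurableSet).mono hC
  refine (integrableOn_iff_integrable_of_support_subset fun x hx => ?_).1 h1
  exact subset_tsupport _ (right_ne_zero_of_mul hx)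

/-- A test function of zero mean is the derivative of a test function. -/
lemma exists_primitive {ψ : ℝ → ℂ} (hψ : IsTest1 ψ) {m M : ℝ} (hs : tsupport ψ ⊆ Icc m M)
    (h0 : ∫ x, ψ x = 0) : ∃ Ψ, IsTest1 Ψ ∧ tsupport Ψ ⊆ Icc m M ∧ deriv Ψ = ψ := by
  have hz : ∀ x, x ∉ Icc m M → ψ x = 0 := fun x hx => by
    by_contra hne
    exact hx (hs (subset_tsupport _ hne))
  have hd : ∀ x, HasDerivAt (fun x => ∫ t in m..x, ψ t) (ψ x) x := fun x =>
    hψ.continuous.integral_hasStrictDerivAt m x |>.hasDerivAt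
  have hderiv : deriv (fun x => ∫ t in m..x, ψ t) = ψ := funext fun x => (hd x).deriv
  have hout : ∀ x, x ∉ Icc m M → ∫ t in m..x, ψ t = 0 := by
    intro x hx
    by_cases hxm : x < m
    · rw [intervalIntegral.integral_symm, intervalIntegral.integral_of_le hxm.le,
        integral_Ioc_eq_integral_Ioo, neg_eq_zero]
      exact setIntegral_eq_zero_of_forall_eq_zero fun t ht => hz t fun h => by
        linarith [h.1, ht.2]
    · have hxM : M < x := by
        by_contra h
        exact hx ⟨not_lt.1 hxm, not_lt.1 h⟩
      rw [intervalIntegral.integral_of_le (not_lt.1 hxm), ← integral_Icc_eq_integral_Ioc, ← h0]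
      refine setIntegral_eq_integral_of_forall_compl_eq_zero fun t ht => hz t fun h => ht ?_
      exact ⟨h.1, h.2.trans hxM.le⟩
  have hsupp : tsupport (fun x => ∫ t in m..x, ψ t) ⊆ Icc m M := by
    refine closure_minimal (fun x hx => ?_) isClosed_Icc
    by_contra h
    exact hx (hout x h)
  refine ⟨fun x => ∫ t in m..x, ψ t, ⟨?_, ?_⟩, hsupp, hderiv⟩
  · rw [contDiff_infty_iff_deriv, hderiv]
    exact ⟨fun x => (hd x).differentiableAt, hψ.1⟩
  · exact isCompact_Icc.of_isClosed_subset (isClosed_tsupport _) hsupp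

lemma exists_test_integral_eq_one {U : Set ℝ} (hU : IsOpen U) {c : ℝ} (hc : c ∈ U) :
    ∃ η, IsTest1 η ∧ tsupport η ⊆ U ∧ ∫ x, η x = 1 := by
  obtain ⟨ε, hε, hεU⟩ := Metric.isOpen_iff.1 hU c hc
  let b : ContDiffBump c := ⟨ε / 4, ε / 2, by positivity, by linarith⟩
  have hts : tsupport (fun x => ((b.normed volume x : ℝ) : ℂ)) ⊆ Metric.closedBall c (ε / 2) := by
    refine closure_minimal (fun x hx => ?_) Metric.isClosed_closedBall
    have : x ∈ Function.support (b.normed volume) := fun h => hx (by simp [h])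
    rw [b.support_normed_eq] at this
    exact Metric.ball_subset_closedBall this
  refine ⟨fun x => ((b.normed volume x : ℝ) : ℂ), ⟨Complex.ofRealCLM.contDiff.comp
    b.contDiff_normed, ?_⟩, ?_, ?_⟩
  · exact (isCompact_closedBall c (ε / 2)).of_isClosed_subset (isClosed_tsupport _) hts
  · exact hts.trans ((Metric.closedBall_subset_ball (by linarith)).trans hεU)
  · rw [integral_complex_ofReal, b.integral_normed]; simp

lemma exists_Icc_of_isCompact {U K : Set ℝ} (hU : U.OrdConnected) (hK : IsCompact K)
    (hne : K.Nonempty) (hKU : K ⊆ U) : ∃ m M, K ⊆ Icc m M ∧ Icc m M ⊆ U :=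
  ⟨sInf K, sSup K, fun _ hx => ⟨csInf_le hK.bddBelow hx, le_csSup hK.bddAbove hx⟩,
    hU.out (hKU (hK.sInf_mem hne)) (hKU (hK.sSup_mem hne))⟩

/-- The du Bois-Reymond lemma: a function with zero weak derivative is constant. -/
theorem ae_const_of_integral_mul_deriv_eq_zero {U : Set ℝ} (hU : IsOpen U)
    (hUc : U.OrdConnected) (hUne : U.Nonempty) {f : ℝ → ℂ} (hf : LocallyIntegrableOn f U)
    (h : ∀ ψ, IsTest1 ψ → tsupport ψ ⊆ U → ∫ x, f x * deriv ψ x = 0) :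
    ∃ C : ℂ, ∀ᵐ x, x ∈ U → f x = C := by
  obtain ⟨c, hc⟩ := hUne
  obtain ⟨η, hη, hηU, hη1⟩ := exists_test_integral_eq_one hU hc
  set C : ℂ := ∫ x, f x * η x with hC
  refine ⟨C, ?_⟩
  have hloc : LocallyIntegrableOn (fun x => f x - C) U :=
    hf.sub ((locallyIntegrable_const C).locallyIntegrableOn U)
  have := ae_eq_zero_of_forall_test hU hloc fun ψ hψ hψU => by
    set I : ℂ := ∫ x, ψ x with hI
    -- η carries the mean: ψ - (∫ψ)η has zero mean, hence is the derivative of a test function. Its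
    -- support stays in `U` because `U` is order connected.
    have hφ : IsTest1 (fun x => ψ x - I * η x) :=
      ⟨hψ.1.sub (contDiff_const.mul hη.1), hψ.2.sub hη.2.mul_left⟩
    have hK : tsupport (fun x => ψ x - I * η x) ⊆ tsupport ψ ∪ tsupport η := by
      refine closure_minimal (fun x hx => ?_)
        ((isClosed_tsupport ψ).union (isClosed_tsupport η))
      by_contra hn
      rw [mem_union, not_or] at hn
      exact hx (by simp [image_eq_zero_of_notMem_tsupport hn.1,
        image_eq_zero_of_notMem_tsupport hn.2])
    have hne : (tsupport ψ ∪ tsupport η).Nonempty := by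
      by_contra hemp
      rw [not_nonempty_iff_eq_empty, union_empty_iff] at hemp
      have : η = 0 := tsupport_eq_empty_iff.1 hemp.2
      simp [this] at hη1
    obtain ⟨m, M, h1, h2⟩ := exists_Icc_of_isCompact hUc (hψ.2.isCompact.union hη.2.isCompact) hne
      (union_subset hψU hηU)
    have i1 : Integrable ψ := hψ.continuous.integrable_of_hasCompactSupport hψ.2
    have i2 : Integrable η := hη.continuous.integrable_of_hasCompactSupport hη.2
    obtain ⟨Ψ, hΨ, hΨs, hΨd⟩ := exists_primitive hφ (hK.trans h1) (by
      rw [integral_sub i1 (i2.const_mul I), integral_const_mul, hη1, mul_one, ← hI, sub_self])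
    have h3 := h Ψ hΨ (hΨs.trans h2)
    rw [hΨd] at h3
    have j1 := integrable_mul_test_on hf hψ.continuous hψ.2 hψU
    have j2 := integrable_mul_test_on hf hη.continuous hη.2 hηU
    have e : ∀ x, f x * (ψ x - I * η x) = f x * ψ x - I * (f x * η x) := fun x => by ring
    simp_rw [e] at h3
    rw [integral_sub j1 (j2.const_mul I), integral_const_mul, ← hC] at h3
    simp_rw [sub_mul]
    rw [integral_sub j1 (i1.const_mul C), integral_const_mul, ← hI]
    linear_combination h3
  filter_upwards [this] with x hx hxU
  exact sub_eq_zero.1 (hx hxU)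

lemma IsTest1.exp_mul {ψ : ℝ → ℂ} (hψ : IsTest1 ψ) (m : ℂ) :
    IsTest1 (fun x => Complex.exp (m * x) * ψ x) ∧
    (∀ x, deriv (fun x : ℝ => Complex.exp (m * x) * ψ x) x =
      Complex.exp (m * x) * deriv ψ x + m * (Complex.exp (m * x) * ψ x)) ∧
    tsupport (fun x : ℝ => Complex.exp (m * x) * ψ x) ⊆ tsupport ψ := by
  refine ⟨hψ.mul_left ?_, fun x => ?_, tsupport_mul_subset_right⟩
  · exact (contDiff_const.mul Complex.ofRealCLM.contDiff).cexp
  · have h1 : HasDerivAt (fun x : ℝ => Complex.exp (m * x)) (Complex.exp (m * x) * (m * 1)) x :=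
      ((Complex.ofRealCLM.hasDerivAt (x := x)).const_mul m).cexp
    rw [(h1.fun_mul (hψ.differentiable x).hasDerivAt).deriv]
    ring

/-- Weak solutions of `h' = -m h` are exponentials. -/
lemma ae_eq_exp_of_weak {U : Set ℝ} (hU : IsOpen U) (hUc : U.OrdConnected) (hUne : U.Nonempty)
    {h : ℝ → ℂ} (hh : LocallyIntegrableOn h U) (m : ℂ)
    (hw : ∀ ψ, IsTest1 ψ → tsupport ψ ⊆ U → ∫ x, h x * deriv ψ x = m * ∫ x, h x * ψ x) :
    ∃ C : ℂ, ∀ᵐ x : ℝ, x ∈ U → h x = C * Complex.exp (-(m * x)) := by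
  have hexp : Continuous (fun x : ℝ => Complex.exp (m * x)) := by fun_prop
  -- Integrating factor: e^{mx}h has zero weak derivative.
  obtain ⟨C, hC⟩ := ae_const_of_integral_mul_deriv_eq_zero hU hUc hUne
    (f := fun x : ℝ => Complex.exp (m * x) * h x) (hh.continuousOn_mul hexp.continuousOn hU.isLocallyClosed)
    fun ψ hψ hψU => by
      obtain ⟨h1, h2, h3⟩ := hψ.exp_mul m
      have h4 := hw _ h1 (h3.trans hψU)
      simp_rw [h2] at h4
      have e : ∀ x : ℝ, h x * (Complex.exp (m * x) * deriv ψ x + m * (Complex.exp (m * x) * ψ x)) =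
          Complex.exp (m * x) * h x * deriv ψ x + m * (h x * (Complex.exp (m * x) * ψ x)) :=
        fun x => by ring
      simp_rw [e] at h4
      have hdsupp : tsupport (deriv ψ) ⊆ U :=
        (tsupport_deriv_subset (𝕜 := ℝ) (f := ψ)).trans hψU
      have j1 : Integrable fun x : ℝ => Complex.exp (m * x) * h x * deriv ψ x := by
        have := integrable_mul_test_on hh (hexp.mul hψ.derivative.continuous)
          hψ.derivative.2.mul_left (tsupport_mul_subset_right.trans hdsupp)
        refine this.congr (Eventually.of_forall fun x => ?_)
        simp only [Pi.mul_apply]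
        ring
      have j2 := integrable_mul_test_on hh h1.continuous h1.2 (h3.trans hψU)
      rw [integral_add j1 (j2.const_mul m), integral_const_mul] at h4
      simpa using h4
  refine ⟨C, ?_⟩
  filter_upwards [hC] with x hx hxU
  rw [← hx hxU, mul_right_comm, ← Complex.exp_add]
  simp

lemma locallyIntegrableOn_of_memLp {U : Set ℝ} {f : ℝ → ℂ} (hf : MemLp f 2 (volume.restrict U)) :
    LocallyIntegrableOn f U := by
  intro x _
  refine ⟨U ∩ Metric.ball x 1, inter_mem_nhdsWithin U (Metric.ball_mem_nhds x one_pos), ?_⟩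
  have : IsFiniteMeasure ((volume : Measure ℝ).restrict (U ∩ Metric.ball x 1)) := ⟨by
    rw [Measure.restrict_apply_univ]
    exact (measure_mono inter_subset_right).trans_lt (measure_ball_lt_top (x := x) (r := 1))⟩
  exact (hf.mono_measure (Measure.restrict_mono inter_subset_left le_rfl)).integrable (by norm_num)

/-- For Re m ≥ 0 the modulus is bounded below on x > a by its value at a, and the half-line has
infinite measure. Oscillating exponentials are excluded as well as growing ones. -/
lemma not_memLp_exp {a : ℝ} {C m : ℂ} (hm : 0 ≤ m.re) (hC : C ≠ 0) :
    ¬ MemLp (fun x : ℝ => C * Complex.exp (m * x)) 2 (volume.restrict (Ioi a)) := by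
  intro h
  have h1 := (memLp_two_iff_integrable_sq_norm h.1).1 h
  have hpos : 0 < ‖C‖ * Real.exp (m.re * a) := by
    have := norm_pos_iff.2 hC; positivity
  have h2 : Integrable (fun _ : ℝ => (‖C‖ * Real.exp (m.re * a)) ^ 2) (volume.restrict (Ioi a)) := by
    refine h1.mono' (by fun_prop) ?_
    refine (ae_restrict_mem measurableSet_Ioi).mono fun x hx => ?_
    rw [Real.norm_of_nonneg (by positivity), norm_mul, Complex.norm_exp]
    gcongr
    simp only [Complex.mul_re, Complex.ofReal_re, Complex.ofReal_im, mul_zero, sub_zero]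
    exact mul_le_mul_of_nonneg_left (le_of_lt hx) hm
  rw [integrable_const_iff] at h2
  rcases h2 with h2 | h2
  · exact absurd h2 (by positivity)
  · exact absurd h2.measure_univ_lt_top (by simp)

/-- Square integrable weak solutions of `f'' = m² f` on a half-line decay exponentially. -/
theorem ae_eq_exp_of_weak_second_order {a : ℝ} {f g : ℝ → ℂ} {m : ℂ} (hm : m.re < 0)
    (hf : MemLp f 2 (volume.restrict (Ioi a))) (hg : MemLp g 2 (volume.restrict (Ioi a)))
    (h1 : ∀ ψ, IsTest1 ψ → tsupport ψ ⊆ Ioi a → ∫ x, f x * deriv ψ x = -∫ x, g x * ψ x)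
    (h2 : ∀ ψ, IsTest1 ψ → tsupport ψ ⊆ Ioi a →
      ∫ x, g x * deriv ψ x = -(m ^ 2 * ∫ x, f x * ψ x)) :
    ∃ c : ℂ, ∀ᵐ x : ℝ, x ∈ Ioi a →
      f x = c * Complex.exp (m * (x - a)) ∧ g x = m * (c * Complex.exp (m * (x - a))) := by
  have hfl := locallyIntegrableOn_of_memLp hf
  have hgl := locallyIntegrableOn_of_memLp hg
  -- Factorisation f'' - m²f = (d/dx + m)(d/dx - m)f: the function g - m f is a multiple of e^{-mx},
  -- which is not square integrable as Re m < 0. What remains is f' = m f.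
  have hL : MemLp (fun x => g x - m * f x) 2 (volume.restrict (Ioi a)) := hg.sub (hf.const_mul m)
  obtain ⟨C, hC⟩ := ae_eq_exp_of_weak isOpen_Ioi ordConnected_Ioi nonempty_Ioi
    (locallyIntegrableOn_of_memLp hL) m fun ψ hψ hψU => by
      have hdU : tsupport (deriv ψ) ⊆ Ioi a :=
        (tsupport_deriv_subset (𝕜 := ℝ) (f := ψ)).trans hψU
      have i1 := integrable_mul_test_on hfl hψ.continuous hψ.2 hψU
      have i2 := integrable_mul_test_on hgl hψ.continuous hψ.2 hψU
      have i3 := integrable_mul_test_on hfl hψ.derivative.continuous hψ.derivative.2 hdU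
      have i4 := integrable_mul_test_on hgl hψ.derivative.continuous hψ.derivative.2 hdU
      simp_rw [sub_mul, mul_assoc]
      rw [integral_sub i4 (i3.const_mul m), integral_sub i2 (i1.const_mul m), integral_const_mul,
        integral_const_mul, h1 ψ hψ hψU, h2 ψ hψ hψU]
      ring
  have hC' : ∀ᵐ x : ℝ, x ∈ Ioi a → g x - m * f x = C * Complex.exp (-m * x) := by
    filter_upwards [hC] with x hx hxa
    rw [hx hxa, neg_mul]
  have hC0 : C = 0 := by
    by_contra hne
    refine not_memLp_exp (a := a) (m := -m) (by simpa using hm.le) hne ?_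
    exact (memLp_congr_ae ((ae_restrict_iff' measurableSet_Ioi).2 hC')).1 hL
  have hgf : ∀ᵐ x : ℝ, x ∈ Ioi a → g x = m * f x := by
    filter_upwards [hC'] with x hx hxa
    have := hx hxa
    rw [hC0, zero_mul] at this
    exact sub_eq_zero.1 this
  obtain ⟨c, hc⟩ := ae_eq_exp_of_weak isOpen_Ioi ordConnected_Ioi nonempty_Ioi hfl (-m)
    fun ψ hψ hψU => by
      rw [h1 ψ hψ hψU, ← integral_const_mul, ← integral_neg]
      refine integral_congr_ae ?_
      filter_upwards [hgf] with x hx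
      by_cases hxa : x ∈ Ioi a
      · rw [hx hxa]; ring
      · have : ψ x = 0 := image_eq_zero_of_notMem_tsupport fun h => hxa (hψU h)
        simp [this]
  refine ⟨c * Complex.exp (m * a), ?_⟩
  filter_upwards [hgf, hc] with x h3 h4 hxa
  have e : f x = c * Complex.exp (m * a) * Complex.exp (m * (x - a)) := by
    rw [h4 hxa, mul_assoc, ← Complex.exp_add]
    congr 2
    ring
  exact ⟨e, by rw [h3 hxa, e]⟩

/-- The weak derivative of an exponential is its derivative. -/
lemma ae_eq_of_weak_deriv_exp {a : ℝ} {f g : ℝ → ℂ} {m c : ℂ}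
    (hg : LocallyIntegrableOn g (Ioi a))
    (h1 : ∀ ψ, IsTest1 ψ → tsupport ψ ⊆ Ioi a → ∫ x, f x * deriv ψ x = -∫ x, g x * ψ x)
    (hf : ∀ᵐ x : ℝ, x ∈ Ioi a → f x = c * Complex.exp (m * (x - a))) :
    ∀ᵐ x : ℝ, x ∈ Ioi a → g x = m * (c * Complex.exp (m * (x - a))) := by
  have hcont : Continuous fun x : ℝ => m * (c * Complex.exp (m * (x - a))) := by fun_prop
  have hl : LocallyIntegrableOn (fun x : ℝ => m * (c * Complex.exp (m * (x - a)))) (Ioi a) :=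
    hcont.locallyIntegrable.locallyIntegrableOn _
  have := ae_eq_zero_of_forall_test isOpen_Ioi (hg.sub hl) fun ψ hψ hψU => by
    have i1 := integrable_mul_test_on hg hψ.continuous hψ.2 hψU
    have i2 := integrable_mul_test_on hl hψ.continuous hψ.2 hψU
    simp only [Pi.sub_apply, sub_mul]
    rw [integral_sub i1 i2, sub_eq_zero]
    have h2 := h1 ψ hψ hψU
    have h3 : ∫ x, f x * deriv ψ x = ∫ x : ℝ, c * Complex.exp (m * (x - a)) * deriv ψ x := by
      refine integral_congr_ae ?_
      filter_upwards [hf] with x hx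
      by_cases hxa : x ∈ Ioi a
      · rw [hx hxa]
      · have : deriv ψ x = 0 := image_eq_zero_of_notMem_tsupport fun h => hxa
          (hψU (tsupport_deriv_subset (𝕜 := ℝ) (f := ψ) h))
        simp [this]
    have hd : ∀ x : ℝ, HasDerivAt (fun x : ℝ => c * Complex.exp (m * (x - a)))
        (m * (c * Complex.exp (m * (x - a)))) x := by
      intro x
      have := ((((Complex.ofRealCLM.hasDerivAt (x := x)).sub_const (a : ℂ)).const_mul m).cexp).const_mul c
      refine this.congr_deriv ?_
      simp only [Complex.ofRealCLM_apply, Complex.ofReal_one]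
      ring
    have hcont0 : Continuous fun x : ℝ => c * Complex.exp (m * (x - a)) := by fun_prop
    rw [integral_mul_deriv_eq_deriv_mul_of_integrable (fun x _ => hd x)
      (fun x _ => (hψ.differentiable x).hasDerivAt)
      ((hcont0.mul hψ.derivative.continuous).integrable_of_hasCompactSupport hψ.derivative.2.mul_left)
      ((hcont.mul hψ.continuous).integrable_of_hasCompactSupport hψ.2.mul_left)
      ((hcont0.mul hψ.continuous).integrable_of_hasCompactSupport hψ.2.mul_left)] at h3
    rw [h3] at h2
    exact (neg_injective h2).symm
  filter_upwards [this] with x hx hxa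
  exact sub_eq_zero.1 (hx hxa)

/-! ### Primitives, continuous representatives and the flux identity -/

lemma intervalIntegrable_of_locallyIntegrable {f : ℝ → ℂ} (hf : LocallyIntegrable f) (a b : ℝ) :
    IntervalIntegrable f volume a b :=
  (hf.integrableOn_isCompact isCompact_uIcc).mono_set uIoc_subset_uIcc |>
    intervalIntegrable_iff.mpr

/-- Real and imaginary parts are treated separately, the absolute continuity of primitives being
applied to real integrands. -/
lemma absolutelyContinuousOnInterval_primitive {f : ℝ → ℂ} (hf : LocallyIntegrable f) (a b c : ℝ)
    (hc : c ∈ uIcc a b) :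
    AbsolutelyContinuousOnInterval (fun x => ∫ t in c..x, f t) a b := by
  have hi := intervalIntegrable_of_locallyIntegrable hf
  have hre : IntervalIntegrable (fun t => (f t).re) volume a b :=
    ⟨(hi a b).1.re, (hi a b).2.re⟩
  have him : IntervalIntegrable (fun t => (f t).im) volume a b :=
    ⟨(hi a b).1.im, (hi a b).2.im⟩
  have h1 : AbsolutelyContinuousOnInterval (fun _ : ℝ => (1 : ℂ)) a b :=
    contDiffOn_const.absolutelyContinuousOnInterval
  have h2 : AbsolutelyContinuousOnInterval (fun _ : ℝ => Complex.I) a b :=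
    contDiffOn_const.absolutelyContinuousOnInterval
  have h3 := ((hre.absolutelyContinuousOnInterval_intervalIntegral hc).smul h1).add
    ((him.absolutelyContinuousOnInterval_intervalIntegral hc).smul h2)
  have hE : (fun x => ∫ t in c..x, f t) = ((fun x => ∫ t in c..x, (f t).re) • fun _ => (1 : ℂ)) +
      (fun x => ∫ t in c..x, (f t).im) • fun _ => Complex.I := by
    funext x
    simp only [Pi.add_apply, Pi.smul_apply', Complex.real_smul, mul_one]
    have e : ∀ t, f t = ((f t).re : ℂ) + ((f t).im : ℂ) * Complex.I := fun t =>
      (Complex.re_add_im (f t)).symm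
    have hre' : IntervalIntegrable (fun t => ((f t).re : ℂ)) volume c x :=
      ⟨(hi c x).1.re.ofReal, (hi c x).2.re.ofReal⟩
    have him' : IntervalIntegrable (fun t => ((f t).im : ℂ)) volume c x :=
      ⟨(hi c x).1.im.ofReal, (hi c x).2.im.ofReal⟩
    rw [intervalIntegral.integral_congr (fun t _ => e t), intervalIntegral.integral_add hre'
      (him'.mul_const _), intervalIntegral.integral_mul_const, intervalIntegral.integral_ofReal,
      intervalIntegral.integral_ofReal]
  rw [hE]
  exact h3

/-- The product rule for primitives of locally integrable functions. -/
theorem primitive_mul_primitive {f g F G : ℝ → ℂ} (hf : LocallyIntegrable f)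
    (hg : LocallyIntegrable g) {A A' : ℂ} (hF : ∀ x, F x = A + ∫ t in (0:ℝ)..x, f t)
    (hG : ∀ x, G x = A' + ∫ t in (0:ℝ)..x, g t) {R : ℝ} (hR : 0 < R) :
    ∫ x in (-R)..R, (f x * G x + F x * g x) = F R * G R - F (-R) * G (-R) := by
  have h0 : (0:ℝ) ∈ uIcc (-R) R := by rw [uIcc_of_le (by linarith)]; constructor <;> linarith
  have hFac : AbsolutelyContinuousOnInterval F (-R) R := by
    rw [show F = (fun _ => A) + (fun x => ∫ t in (0:ℝ)..x, f t) from funext hF]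
    exact contDiffOn_const.absolutelyContinuousOnInterval.add
      (absolutelyContinuousOnInterval_primitive hf _ _ _ h0)
  have hGac : AbsolutelyContinuousOnInterval G (-R) R := by
    rw [show G = (fun _ => A') + (fun x => ∫ t in (0:ℝ)..x, g t) from funext hG]
    exact contDiffOn_const.absolutelyContinuousOnInterval.add
      (absolutelyContinuousOnInterval_primitive hg _ _ _ h0)
  have hFc : Continuous F := by
    rw [show F = fun x => A + ∫ t in (0:ℝ)..x, f t from funext hF]
    exact continuous_const.add (intervalIntegral.continuous_primitive
      (intervalIntegrable_of_locallyIntegrable hf) 0)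
  have hGc : Continuous G := by
    rw [show G = fun x => A' + ∫ t in (0:ℝ)..x, g t from funext hG]
    exact continuous_const.add (intervalIntegral.continuous_primitive
      (intervalIntegrable_of_locallyIntegrable hg) 0)
  have hloc : LocallyIntegrable (fun x => f x * G x + F x * g x) := by
    have h1 : LocallyIntegrable (fun x => f x * G x) := by
      rw [← locallyIntegrableOn_univ] at hf ⊢
      exact hf.mul_continuousOn hGc.continuousOn isOpen_univ.isLocallyClosed
    have h2 : LocallyIntegrable (fun x => F x * g x) := by
      rw [← locallyIntegrableOn_univ] at hg ⊢
      exact hg.continuousOn_mul hFc.continuousOn isOpen_univ.isLocallyClosed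
    exact h1.add h2
  -- FG minus the primitive of its formal derivative is absolutely continuous with derivative zero
  -- almost everywhere, hence constant.
  have hH : AbsolutelyContinuousOnInterval
      (F • G - fun x => ∫ t in (-R)..x, (f t * G t + F t * g t)) (-R) R :=
    (hFac.smul hGac).sub (absolutelyContinuousOnInterval_primitive hloc _ _ _ left_mem_uIcc)
  obtain ⟨C, hC⟩ := hH.const_of_ae_hasDerivAt_zero (by
    filter_upwards [LocallyIntegrable.ae_hasDerivAt_integral hf,
      LocallyIntegrable.ae_hasDerivAt_integral hg,
      LocallyIntegrable.ae_hasDerivAt_integral hloc] with x h1 h2 h3 _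
    have k1 : HasDerivAt F (f x) x := by
      rw [show F = fun x => A + ∫ t in (0:ℝ)..x, f t from funext hF]
      exact (h1 0).const_add A
    have k2 : HasDerivAt G (g x) x := by
      rw [show G = fun x => A' + ∫ t in (0:ℝ)..x, g t from funext hG]
      exact (h2 0).const_add A'
    have k3 := (k1.mul k2).sub (h3 (-R))
    simpa using k3)
  have e1 := hC R right_mem_uIcc
  have e2 := hC (-R) left_mem_uIcc
  simp only [Pi.sub_apply, smul_eq_mul, Pi.mul_apply, intervalIntegral.integral_same,
    sub_zero] at e1 e2
  rw [← e2] at e1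
  linear_combination -e1

/-- A function with locally integrable weak derivative is a primitive of it. -/
theorem ae_eq_primitive_of_weak_deriv {f g : ℝ → ℂ} (hf : LocallyIntegrable f)
    (hg : LocallyIntegrable g)
    (h : ∀ ψ, IsTest1 ψ → ∫ x, f x * deriv ψ x = -∫ x, g x * ψ x) :
    ∃ A : ℂ, ∀ᵐ x, f x = A + ∫ t in (0:ℝ)..x, g t := by
  set G : ℝ → ℂ := fun x => ∫ t in (0:ℝ)..x, g t with hGdef
  have hGc : Continuous G :=
    intervalIntegral.continuous_primitive (intervalIntegrable_of_locallyIntegrable hg) 0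
  obtain ⟨A, hA⟩ := ae_const_of_integral_mul_deriv_eq_zero isOpen_univ ordConnected_univ
    univ_nonempty (f := fun x => f x - G x)
    ((hf.sub hGc.locallyIntegrable).locallyIntegrableOn univ) fun ψ hψ _ => by
      obtain ⟨R, hR⟩ := exists_forall_abs_ge_eq_zero hψ.2
      obtain ⟨R', hR'⟩ := exists_forall_abs_ge_eq_zero hψ.derivative.2
      set S := max 1 (max R R') with hS
      have hS0 : 0 < S := lt_of_lt_of_le one_pos (le_max_left _ _)
      have hSR : R ≤ S := (le_max_left _ _).trans (le_max_right _ _)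
      have hSR' : R' ≤ S := (le_max_right _ _).trans (le_max_right _ _)
      -- The product rule for G and ψ, on an interval containing the support of ψ, shows that g is
      -- the weak derivative of G; thus f - G has zero weak derivative.
      have hprod := primitive_mul_primitive hg hψ.derivative.continuous.locallyIntegrable
        (F := G) (G := ψ) (A := 0) (A' := ψ 0) (fun x => by simp [hGdef]) (fun x => by
          rw [intervalIntegral.integral_deriv_eq_sub (fun y _ => hψ.differentiable y)
            (hψ.derivative.continuous.intervalIntegrable _ _)]
          ring) hS0
      have z1 : ψ S = 0 := hR S (hSR.trans (le_abs_self S))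
      have z2 : ψ (-S) = 0 := hR (-S) (by rw [abs_neg]; exact hSR.trans (le_abs_self S))
      rw [z1, z2, mul_zero, mul_zero, sub_zero, intervalIntegral.integral_of_le (by linarith),
        ← integral_Icc_eq_integral_Ioc, setIntegral_eq_integral_of_forall_compl_eq_zero] at hprod
      · have i1 := integrable_mul_test hg hψ.continuous hψ.2
        have i2 := integrable_mul_test hGc.locallyIntegrable hψ.derivative.continuous
          hψ.derivative.2
        have i3 := integrable_mul_test hf hψ.derivative.continuous hψ.derivative.2
        rw [integral_add i1 i2] at hprod
        simp_rw [sub_mul]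
        rw [integral_sub i3 i2, h ψ hψ]
        linear_combination -hprod
      · intro x hx
        have : S ≤ |x| := by
          by_contra hlt
          exact hx (abs_le.1 (not_le.1 hlt).le)
        simp [hR x (hSR.trans this), hR' x (hSR'.trans this)]
  refine ⟨A, hA.mono fun x hx => ?_⟩
  linear_combination hx (mem_univ x)

/-- The flux identity for weak solutions of a second order system. -/
theorem exists_continuous_flux {f g h : ℝ → ℂ} (hf : LocallyIntegrable f)
    (hg : LocallyIntegrable g) (hh : LocallyIntegrable h)
    (h1 : ∀ ψ, IsTest1 ψ → ∫ x, f x * deriv ψ x = -∫ x, g x * ψ x)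
    (h2 : ∀ ψ, IsTest1 ψ → ∫ x, g x * deriv ψ x = -∫ x, h x * ψ x) :
    ∃ F G : ℝ → ℂ, Continuous F ∧ Continuous G ∧ f =ᵐ[volume] F ∧ g =ᵐ[volume] G ∧
      ∀ R : ℝ, 0 < R →
        ∫ x in (-R)..R, (h x * starRingEnd ℂ (F x) + G x * starRingEnd ℂ (G x)) =
        G R * starRingEnd ℂ (F R) - G (-R) * starRingEnd ℂ (F (-R)) := by
  obtain ⟨A, hA⟩ := ae_eq_primitive_of_weak_deriv hf hg h1
  obtain ⟨A', hA'⟩ := ae_eq_primitive_of_weak_deriv hg hh h2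
  set F : ℝ → ℂ := fun x => A + ∫ t in (0:ℝ)..x, g t with hF
  set G : ℝ → ℂ := fun x => A' + ∫ t in (0:ℝ)..x, h t with hG
  have hFc : Continuous F := continuous_const.add
    (intervalIntegral.continuous_primitive (intervalIntegrable_of_locallyIntegrable hg) 0)
  have hGc : Continuous G := continuous_const.add
    (intervalIntegral.continuous_primitive (intervalIntegrable_of_locallyIntegrable hh) 0)
  have hgc : LocallyIntegrable (fun x => starRingEnd ℂ (G x)) :=
    (Complex.continuous_conj.comp hGc).locallyIntegrable
  refine ⟨F, G, hFc, hGc, hA, hA', fun R hR => ?_⟩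
  -- In the primitive that represents conj F, the integrand conj g is replaced by its continuous
  -- representative conj G.
  refine primitive_mul_primitive hh hgc (F := G) (G := fun x => starRingEnd ℂ (F x))
    (A := A') (A' := starRingEnd ℂ A) (fun x => rfl) (fun x => ?_) hR
  rw [hF, map_add, intervalIntegral, intervalIntegral, map_sub, ← integral_conj, ← integral_conj]
  congr 2
  · exact integral_congr_ae (ae_restrict_of_ae (hA'.mono fun t ht => congrArg (starRingEnd ℂ) ht))
  · exact integral_congr_ae (ae_restrict_of_ae (hA'.mono fun t ht => congrArg (starRingEnd ℂ) ht))

/-! ### The jump identity and the interior control of exterior amplitudes -/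

lemma hasDerivAt_exp_affine (m c : ℂ) (a x : ℝ) :
    HasDerivAt (fun x : ℝ => c * Complex.exp (m * (x - a)))
      (m * (c * Complex.exp (m * (x - a)))) x := by
  have := ((((Complex.ofRealCLM.hasDerivAt (x := x)).sub_const (a : ℂ)).const_mul m).cexp).const_mul c
  refine this.congr_deriv ?_
  simp only [Complex.ofRealCLM_apply, Complex.ofReal_one]
  ring

lemma tendsto_atTop_zero_of_hasCompactSupport {ψ : ℝ → ℂ} (hψ : HasCompactSupport ψ) :
    Tendsto ψ atTop (𝓝 0) := by
  obtain ⟨R, hR⟩ := exists_forall_abs_ge_eq_zero hψ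
  refine tendsto_const_nhds.congr' ?_
  filter_upwards [eventually_ge_atTop R] with x hx
  exact (hR x (hx.trans (le_abs_self x))).symm

lemma integral_Ioi_of_hasDerivAt_of_hasCompactSupport {ψ ψ' : ℝ → ℂ} {a : ℝ}
    (hd : ∀ x, HasDerivAt ψ (ψ' x) x) (hc : Continuous ψ') (hψ : HasCompactSupport ψ) :
    ∫ x in Ioi a, ψ' x = -ψ a := by
  have hψ' : HasCompactSupport ψ' := by
    have : ψ' = deriv ψ := funext fun x => (hd x).deriv.symm
    rw [this]; exact hψ.deriv
  rw [integral_Ioi_of_hasDerivAt_of_tendsto (m := 0) (hd a).continuousAt.continuousWithinAt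
    (fun x _ => hd x)
    (hc.integrable_of_hasCompactSupport hψ').integrableOn
    (tendsto_atTop_zero_of_hasCompactSupport hψ), zero_sub]

/-- The jump identity at `x = L` for the modal equations. -/
lemma jump_identity {f g h B : ℝ → ℂ} {L : ℝ} {b c e₀ q κ : ℂ} (hq : b ^ 2 = q - κ)
    (he₀ : e₀ ≠ 0) (hf : LocallyIntegrable f) (hg : LocallyIntegrable g) (hB : IsPhase B)
    (hh : LocallyIntegrable h)
    (h1 : ∀ ψ, IsTest1 ψ → ∫ x, f x * deriv ψ x = -∫ x, g x * ψ x)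
    (h2 : ∀ ψ, IsTest1 ψ → ∫ x, B x * g x * deriv ψ x =
      -∫ x, (B x)⁻¹ * (q * f x - κ * h x) * ψ x)
    (hB1 : ∀ x, 0 < x → x < L → B x = 1) (hB2 : ∀ x, L ≤ x → B x = e₀⁻¹)
    (hfc : ∀ᵐ x : ℝ, x ∈ Ioi L → f x = c * Complex.exp (-(b * e₀) * (x - L)))
    (hgc : ∀ᵐ x : ℝ, x ∈ Ioi L → g x = -(b * e₀) * (c * Complex.exp (-(b * e₀) * (x - L))))
    (hhf : ∀ᵐ x : ℝ, x ∈ Ioi L → h x = f x)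
    {ψ : ℝ → ℂ} (hψ : IsTest1 ψ) (hψ0 : ∀ x ≤ 0, ψ x = 0 ∧ deriv ψ x = 0 ∧ deriv (deriv ψ) x = 0) :
    ∫ x in Iic L, (f x * deriv (deriv ψ) x - (q * f x - κ * h x) * ψ x) =
      c * (deriv ψ L + b * ψ L) := by
  have hψ' := hψ.derivative
  have hψ'' := hψ'.derivative
  have i1 := integrable_mul_test hf hψ''.continuous hψ''.2
  have i2 := integrable_mul_test hg hψ'.continuous hψ'.2
  have i3 : Integrable fun x => B x * g x * deriv ψ x := by
    refine (i2.bdd_mul (c := 1) hB.meas.aestronglyMeasurable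
      (Eventually.of_forall fun x => (hB.norm x).le)).congr (Eventually.of_forall fun x => ?_)
    simp only [mul_assoc]
  have i4 : Integrable fun x => (B x)⁻¹ * (q * f x - κ * h x) * ψ x := by
    have j := integrable_mul_test ((hf.smul q).sub (hh.smul κ)) hψ.continuous hψ.2
    refine (j.bdd_mul (c := 1) hB.inv.meas.aestronglyMeasurable
      (Eventually.of_forall fun x => (hB.inv.norm x).le)).congr (Eventually.of_forall fun x => ?_)
    simp only [mul_assoc, Pi.sub_apply, Pi.smul_apply, smul_eq_mul]
  have i12 : Integrable (fun x => f x * deriv (deriv ψ) x + g x * deriv ψ x) := i1.add i2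
  have i34 : Integrable (fun x => B x * g x * deriv ψ x + (B x)⁻¹ * (q * f x - κ * h x) * ψ x) :=
    i3.add i4
  have hΦ : Integrable (fun x => f x * deriv (deriv ψ) x + g x * deriv ψ x -
      (B x * g x * deriv ψ x + (B x)⁻¹ * (q * f x - κ * h x) * ψ x)) := i12.sub i34
  -- The first equation is tested with ψ', the second with ψ, and the difference integrates to zero.
  -- For 0 < x < L the coefficient B is 1 and the terms in g cancel, so the interior part involves f
  -- and h only.
  have h0 : ∫ x, (f x * deriv (deriv ψ) x + g x * deriv ψ x -
      (B x * g x * deriv ψ x + (B x)⁻¹ * (q * f x - κ * h x) * ψ x)) = 0 := by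
    rw [integral_sub i12 i34, integral_add i1 i2, integral_add i3 i4, h1 _ hψ', h2 _ hψ]
    ring
  rw [← setIntegral_univ, ← Iic_union_Ioi (a := L), setIntegral_union (Iic_disjoint_Ioi le_rfl)
    measurableSet_Ioi hΦ.integrableOn hΦ.integrableOn] at h0
  have hne : ∀ᵐ x : ℝ, x ≠ L := by simp [ae_iff]
  have e1 : ∫ x in Iic L, (f x * deriv (deriv ψ) x + g x * deriv ψ x -
      (B x * g x * deriv ψ x + (B x)⁻¹ * (q * f x - κ * h x) * ψ x)) =
      ∫ x in Iic L, (f x * deriv (deriv ψ) x - (q * f x - κ * h x) * ψ x) := by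
    refine setIntegral_congr_ae measurableSet_Iic ?_
    filter_upwards [hne] with x hx hxL
    by_cases hx0 : x ≤ 0
    · obtain ⟨z1, z2, z3⟩ := hψ0 x hx0
      simp [z1, z2, z3]
    · rw [hB1 x (not_le.1 hx0) (lt_of_le_of_ne hxL hx), inv_one]
      ring
  -- For x > L, with f = cE, the integrand is the exact derivative of cE(ψ' + bψ): this uses g = -b
  -- e₀ f, B = 1/e₀ and b² = q - κ. Only the value at x = L remains, and it is free of e₀.
  have hdΨ : ∀ x : ℝ, HasDerivAt (fun x : ℝ => c * Complex.exp (-(b * e₀) * (x - L)) *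
      (deriv ψ x + b * ψ x))
      (-(b * e₀) * (c * Complex.exp (-(b * e₀) * (x - L))) * (deriv ψ x + b * ψ x) +
      c * Complex.exp (-(b * e₀) * (x - L)) * (deriv (deriv ψ) x + b * deriv ψ x)) x := fun x =>
    (hasDerivAt_exp_affine _ _ _ _).mul ((hψ'.differentiable x).hasDerivAt.add
      ((hψ.differentiable x).hasDerivAt.const_mul b))
  have e2 : ∫ x in Ioi L, (f x * deriv (deriv ψ) x + g x * deriv ψ x -
      (B x * g x * deriv ψ x + (B x)⁻¹ * (q * f x - κ * h x) * ψ x)) =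
      -(c * (deriv ψ L + b * ψ L)) := by
    have hc0 := hψ.continuous
    have hc1 := hψ'.continuous
    have hc2 := hψ''.continuous
    have := integral_Ioi_of_hasDerivAt_of_hasCompactSupport (a := L) hdΨ (by fun_prop)
      (HasCompactSupport.mul_left (hψ'.2.add hψ.2.mul_left))
    simp only [sub_self, mul_zero, Complex.exp_zero, mul_one] at this
    rw [← this]
    refine setIntegral_congr_ae measurableSet_Ioi ?_
    filter_upwards [hfc, hgc, hhf] with x h3 h4 h5 hx
    rw [h5 hx, h4 hx, h3 hx, hB2 x (le_of_lt hx), inv_inv]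
    have : b ^ 2 = q - κ := hq
    have hinv : e₀⁻¹ * e₀ = 1 := inv_mul_cancel₀ he₀
    linear_combination (b * c * Complex.exp (-(b * e₀) * (x - L)) * deriv ψ x) * hinv +
      (e₀ * c * Complex.exp (-(b * e₀) * (x - L)) * ψ x) * this
  rw [e1, e2] at h0
  linear_combination h0

/-- The decay rate of the evanescent modes; it vanishes for the propagating ones. -/
def rate (k : ℝ) (n : ℕ) : ℝ := Real.sqrt ((n : ℝ) ^ 2 * Real.pi ^ 2 - k ^ 2)

lemma rate_nonneg (k : ℝ) (n : ℕ) : 0 ≤ rate k n := Real.sqrt_nonneg _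

/-- For n ≥ N + 1 one has k ≤ n·k/(N+1), hence rate² ≥ n²(π² - (k/(N+1))²). The bracket is positive
because k lies below the next threshold. -/
lemma exists_rate_lower_bound {N : ℕ} {k : ℝ} (hk0 : 0 < k) (hk : k < (N + 1) * Real.pi) :
    ∃ κ > 0, ∀ n : ℕ, N < n → κ * n ≤ rate k n := by
  have hd : k / (N + 1) < Real.pi := by rw [div_lt_iff₀ (by positivity)]; linarith
  have hp : 0 < Real.pi ^ 2 - (k / (N + 1)) ^ 2 := by
    have : 0 < k / (N + 1) := by positivity
    nlinarith
  refine ⟨Real.sqrt (Real.pi ^ 2 - (k / (N + 1)) ^ 2), Real.sqrt_pos.2 hp, fun n hn => ?_⟩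
  have hn' : (N : ℝ) + 1 ≤ n := by exact_mod_cast hn
  refine Real.le_sqrt_of_sq_le ?_
  rw [mul_pow, Real.sq_sqrt hp.le, sub_mul, div_pow]
  have : k ^ 2 ≤ k ^ 2 / ((N:ℝ) + 1) ^ 2 * (n:ℝ) ^ 2 := by
    rw [div_mul_eq_mul_div, le_div_iff₀ (by positivity)]
    gcongr
  nlinarith

lemma rate_sq {N n : ℕ} {k : ℝ} (hk0 : 0 < k) (hk : k < (N + 1) * Real.pi) (hn : N < n) :
    rate k n ^ 2 = (n : ℝ) ^ 2 * Real.pi ^ 2 - k ^ 2 := by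
  have hn' : (N : ℝ) + 1 ≤ n := by exact_mod_cast hn
  refine Real.sq_sqrt ?_
  have : k < n * Real.pi := hk.trans_le (by gcongr)
  nlinarith

lemma rate_pos {N n : ℕ} {k : ℝ} (hk0 : 0 < k) (hk : k < (N + 1) * Real.pi) (hn : N < n) :
    0 < rate k n := by
  obtain ⟨κ, hκ, h⟩ := exists_rate_lower_bound hk0 hk
  have : 0 < n := by omega
  exact lt_of_lt_of_le (by positivity) (h n hn)

lemma rate_eq_zero {N n : ℕ} {k : ℝ} (hk : N * Real.pi < k) (hn : n ≤ N) : rate k n = 0 := by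
  refine Real.sqrt_eq_zero_of_nonpos ?_
  have : (n : ℝ) * Real.pi ≤ k := le_trans (by gcongr) hk.le
  have h0 : 0 ≤ (n : ℝ) * Real.pi := by positivity
  nlinarith

/-- A bump centred at L with radii L/3 and 2L/3. On the inner side its derivatives live at distance
at least L/3 from the interface, where e^{b(x-L)} is small. It vanishes near x ≤ 0, where B is not
assumed to be 1. -/
lemma exists_cutoff {L : ℝ} (hL : 0 < L) : ∃ χ : ℝ → ℂ, IsTest1 χ ∧ (∀ x ≤ L / 4, χ x = 0) ∧
    (∀ x, ‖χ x‖ ≤ 1) ∧ (∀ x, 2 * L / 3 < x → x < 4 * L / 3 → χ x = 1) := by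
  let b : ContDiffBump L := ⟨L / 3, 2 * L / 3, by positivity, by linarith⟩
  have hz : ∀ x, 2 * L / 3 ≤ |x - L| → b x = 0 := fun x hx => b.zero_of_le_dist hx
  refine ⟨fun x => ((b x : ℝ) : ℂ), ⟨Complex.ofRealCLM.contDiff.comp b.contDiff, ?_⟩, ?_, ?_, ?_⟩
  · refine HasCompactSupport.intro (isCompact_closedBall L (2 * L / 3)) fun x hx => ?_
    rw [mem_closedBall_iff_norm, not_le] at hx
    simp [hz x hx.le]
  · intro x hx
    change ((b x : ℝ) : ℂ) = 0
    rw [hz x (by rw [abs_sub_comm]; exact le_trans (by linarith) (le_abs_self _))]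
    simp
  · intro x
    rw [Complex.norm_real, Real.norm_of_nonneg b.nonneg]
    exact b.le_one
  · intro x h1 h2
    change ((b x : ℝ) : ℂ) = 1
    rw [b.one_of_mem_closedBall]
    · simp
    · rw [mem_closedBall_iff_norm, Real.norm_eq_abs, abs_le]
      change -(L / 3) ≤ x - L ∧ x - L ≤ L / 3
      constructor <;> linarith

lemma mul_exp_neg_le {b δ : ℝ} (hδ : 0 < δ) : b * Real.exp (-(b * δ)) ≤ 1 / δ := by
  rw [le_div_iff₀ hδ, Real.exp_neg, mul_right_comm, ← div_eq_mul_inv,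
    div_le_one (Real.exp_pos _)]
  linarith [Real.add_one_le_exp (b * δ)]

lemma integral_exp_Ioc_le {b L : ℝ} (hb : 0 < b) (hL : 0 < L) :
    ∫ x in Ioc 0 L, Real.exp (b * (x - L)) ≤ 1 / b := by
  rw [← intervalIntegral.integral_of_le hL.le]
  have hd : ∀ x ∈ uIcc 0 L, HasDerivAt (fun x => Real.exp (b * (x - L)) / b)
      (Real.exp (b * (x - L))) x := by
    intro x _
    have h := ((((hasDerivAt_id x).sub_const L).const_mul b).exp).div_const b
    refine h.congr_deriv ?_
    field_simp
    simp
  rw [intervalIntegral.integral_eq_sub_of_hasDerivAt hd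
    (by apply Continuous.intervalIntegrable; fun_prop)]
  simp only [sub_self, mul_zero, Real.exp_zero]
  have : 0 ≤ Real.exp (b * (0 - L)) / b := by positivity
  linarith

/-- Quantitative form of the jump identity: interior control of the exterior amplitudes. -/
lemma exists_amplitude_bound {L : ℝ} (hL : 0 < L) (κ : ℂ) : ∃ K : ℝ, 0 ≤ K ∧
    ∀ (f g h B : ℝ → ℂ) (b : ℝ) (c e₀ q : ℂ), 0 < b → (b : ℂ) ^ 2 = q - κ → e₀ ≠ 0 →
    LocallyIntegrable f → LocallyIntegrable g → IsPhase B → LocallyIntegrable h →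
    (∀ ψ, IsTest1 ψ → ∫ x, f x * deriv ψ x = -∫ x, g x * ψ x) →
    (∀ ψ, IsTest1 ψ → ∫ x, B x * g x * deriv ψ x =
      -∫ x, (B x)⁻¹ * (q * f x - κ * h x) * ψ x) →
    (∀ x, 0 < x → x < L → B x = 1) → (∀ x, L ≤ x → B x = e₀⁻¹) →
    (∀ᵐ x : ℝ, x ∈ Ioi L → f x = c * Complex.exp (-(b * e₀) * (x - L))) →
    (∀ᵐ x : ℝ, x ∈ Ioi L → g x = -(b * e₀) * (c * Complex.exp (-(b * e₀) * (x - L)))) →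
    (∀ᵐ x : ℝ, x ∈ Ioi L → h x = f x) →
    MemLp f 2 (volume.restrict (Ioc 0 L)) → MemLp h 2 (volume.restrict (Ioc 0 L)) →
    ∀ t, 0 < t → b * ‖c‖ ≤ K * (t * ((∫ x in Ioc 0 L, ‖f x‖ ^ 2) + ∫ x in Ioc 0 L, ‖h x‖ ^ 2) +
      1 / (t * b)) := by
  obtain ⟨χ, hχ, hχ0, hχ1, hχone⟩ := exists_cutoff hL
  have hχ' := hχ.derivative
  have hχ'' := hχ'.derivative
  obtain ⟨C1, hC1⟩ := hχ'.continuous.bounded_above_of_compact_support hχ'.2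
  obtain ⟨C2, hC2⟩ := hχ''.continuous.bounded_above_of_compact_support hχ''.2
  have hC10 : 0 ≤ C1 := (norm_nonneg _).trans (hC1 0)
  have hC20 : 0 ≤ C2 := (norm_nonneg _).trans (hC2 0)
  have hnear : ∀ x, 2 * L / 3 < x → x < 4 * L / 3 → deriv χ x = 0 ∧ deriv (deriv χ) x = 0 := by
    intro x h1 h2
    have e : ∀ z ∈ Ioo (2 * L / 3) (4 * L / 3), deriv χ z = 0 := by
      intro z hz
      have : χ =ᶠ[𝓝 z] fun _ => 1 := by
        filter_upwards [Ioo_mem_nhds hz.1 hz.2] with s hs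
        exact hχone s hs.1 hs.2
      rw [this.deriv_eq]; simp
    refine ⟨e x ⟨h1, h2⟩, ?_⟩
    have : deriv χ =ᶠ[𝓝 x] fun _ => 0 := by
      filter_upwards [Ioo_mem_nhds h1 h2] with s hs
      exact e s hs
    rw [this.deriv_eq]; simp
  have hfar : ∀ x, x < L / 4 → deriv χ x = 0 ∧ deriv (deriv χ) x = 0 := by
    intro x h1
    have e : ∀ z ∈ Iio (L / 4), deriv χ z = 0 := by
      intro z hz
      have : χ =ᶠ[𝓝 z] fun _ => 0 := by
        filter_upwards [Iio_mem_nhds hz] with s hs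
        exact hχ0 s (le_of_lt hs)
      rw [this.deriv_eq]; simp
    refine ⟨e x h1, ?_⟩
    have : deriv χ =ᶠ[𝓝 x] fun _ => 0 := by
      filter_upwards [Iio_mem_nhds h1] with s hs
      exact e s hs
    rw [this.deriv_eq]; simp
  -- C2 bounds χ''; 2·C1·(6/L) bounds 2bχ' once half of the exponential has absorbed b; ‖κ‖ comes
  -- from the term κ(h - f)χ of the medium.
  set K : ℝ := C2 + 2 * C1 * (6 / L) + ‖κ‖ with hK
  have hK0 : 0 ≤ K := by positivity
  refine ⟨K, hK0, ?_⟩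
  intro f g h B b c e₀ q hb hq he₀ hf hg hB hh h1 h2 hB1 hB2 hfc hgc hhf hfL hhL t ht
  obtain ⟨hψ, hψd, _⟩ := hχ.exp_mul (b : ℂ)
  obtain ⟨hψ1, hψd1, _⟩ := hχ'.exp_mul (b : ℂ)
  have hdd : ∀ x, deriv (deriv fun x : ℝ => Complex.exp (b * x) * χ x) x =
      Complex.exp (b * x) * (deriv (deriv χ) x + 2 * b * deriv χ x + b ^ 2 * χ x) := by
    intro x
    rw [show (deriv fun x : ℝ => Complex.exp (b * x) * χ x) = fun x : ℝ =>
      Complex.exp (b * x) * deriv χ x + b * (Complex.exp (b * x) * χ x) from funext hψd]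
    rw [deriv_fun_add (hψ1.differentiable x) ((hψ.differentiable x).const_mul _), hψd1,
      deriv_const_mul _ (hψ.differentiable x), hψd]
    ring
  have hjump := jump_identity hq he₀ hf hg hB hh h1 h2 hB1 hB2 hfc hgc hhf hψ (by
    intro x hx
    obtain ⟨z1, z2⟩ := hfar x (by linarith)
    have z0 := hχ0 x (by linarith)
    rw [hdd, hψd, z0, z1, z2]
    simp)
  obtain ⟨hL1, hL2⟩ := hnear L (by linarith) (by linarith)
  have hLχ := hχone L (by linarith) (by linarith)
  simp_rw [hdd, hψd] at hjump
  rw [hL1, hLχ] at hjump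
  have hEL : Complex.exp (-(b * L)) * Complex.exp (b * L) = 1 := by
    rw [← Complex.exp_add]; simp
  -- With ψ = e^{bx}χ the boundary term ψ'(L) + bψ(L) equals 2b e^{bL}. Inside, ψ'' - b²ψ involves
  -- derivatives of χ only, and q f - κh = b²f - κ(h - f), so the large coefficient b² disappears.
  have h2bc : 2 * (b : ℂ) * c = ∫ x in Iic L, Complex.exp (b * (x - L)) *
      (f x * (deriv (deriv χ) x + 2 * b * deriv χ x) + κ * (h x - f x) * χ x) := by
    have e : ∀ x : ℝ, Complex.exp (b * (x - L)) *
        (f x * (deriv (deriv χ) x + 2 * b * deriv χ x) + κ * (h x - f x) * χ x) =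
        Complex.exp (-(b * L)) * (f x * (Complex.exp (b * x) *
          (deriv (deriv χ) x + 2 * b * deriv χ x + b ^ 2 * χ x)) -
          (q * f x - κ * h x) * (Complex.exp (b * x) * χ x)) := by
      intro x
      rw [show (b : ℂ) * (x - L) = -(b * L) + b * x by ring, Complex.exp_add, hq]
      ring
    simp_rw [e]
    rw [integral_const_mul, hjump]
    linear_combination (-2 * b * c) * hEL
  have hsplit : ∫ x in Iic L, Complex.exp (b * (x - L)) *
      (f x * (deriv (deriv χ) x + 2 * b * deriv χ x) + κ * (h x - f x) * χ x) =
      ∫ x in Ioc 0 L, Complex.exp (b * (x - L)) *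
      (f x * (deriv (deriv χ) x + 2 * b * deriv χ x) + κ * (h x - f x) * χ x) := by
    refine setIntegral_eq_of_subset_of_forall_sdiff_eq_zero measurableSet_Iic
      Ioc_subset_Iic_self fun x hx => ?_
    have hx0 : x ≤ 0 := by
      by_contra hcon
      exact hx.2 ⟨not_le.1 hcon, hx.1⟩
    obtain ⟨z1, z2⟩ := hfar x (by linarith)
    have z0 := hχ0 x (by linarith)
    simp [z0, z1, z2]
  have if2 : Integrable (fun x => ‖f x‖ ^ 2) (volume.restrict (Ioc 0 L)) :=
    (memLp_two_iff_integrable_sq_norm hfL.1).1 hfL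
  have ih2 : Integrable (fun x => ‖h x‖ ^ 2) (volume.restrict (Ioc 0 L)) :=
    (memLp_two_iff_integrable_sq_norm hhL.1).1 hhL
  have ie : Integrable (fun x => Real.exp (b * (x - L))) (volume.restrict (Ioc 0 L)) :=
    (Continuous.integrableOn_Icc (by fun_prop)).mono_set Ioc_subset_Icc_self
  have hbound : ‖2 * (b : ℂ) * c‖ ≤ ∫ x in Ioc 0 L,
      (K * (t * (‖f x‖ ^ 2 + ‖h x‖ ^ 2)) + K / (2 * t) * Real.exp (b * (x - L))) := by
    rw [h2bc, hsplit]
    refine norm_integral_le_of_norm_le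
      ((((if2.add ih2).const_mul t).const_mul K).add (ie.const_mul _)) ?_
    refine (ae_restrict_mem measurableSet_Ioc).mono fun x hx => ?_
    -- The exponential is split into two equal factors: one compensates the b of 2bχ', the other
    -- enters Young's inequality.
    have hexp : ‖Complex.exp (b * (x - L))‖ =
        Real.exp (b * (x - L) / 2) * Real.exp (b * (x - L) / 2) := by
      rw [Complex.norm_exp, ← Real.exp_add]
      congr 1
      rw [← Complex.ofReal_sub, ← Complex.ofReal_mul, Complex.ofReal_re]
      ring
    have hx1 : Real.exp (b * (x - L) / 2) ≤ 1 := by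
      rw [Real.exp_le_one_iff]
      nlinarith [hx.2]
    have hd : Real.exp (b * (x - L) / 2) * ‖deriv (deriv χ) x + 2 * b * deriv χ x‖ ≤
        C2 + 2 * C1 * (6 / L) := by
      by_cases hx3 : 2 * L / 3 < x
      · obtain ⟨z1, z2⟩ := hnear x hx3 (by linarith [hx.2])
        rw [z1, z2]
        simp
        positivity
      -- Here L - x ≥ L/3, so the half exponent is at most -bL/6.
      · have hm : b * Real.exp (b * (x - L) / 2) ≤ 6 / L := by
          have h6 := mul_exp_neg_le (b := b) (δ := L / 6) (by positivity)
          have h7 : 1 / (L / 6) = 6 / L := by field_simp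
          rw [h7] at h6
          refine le_trans ?_ h6
          gcongr
          nlinarith [not_lt.1 hx3]
        calc _ ≤ Real.exp (b * (x - L) / 2) * (C2 + 2 * b * C1) := by
              gcongr
              refine (norm_add_le _ _).trans (add_le_add (hC2 x) ?_)
              rw [norm_mul, norm_mul, Complex.norm_real, Real.norm_of_nonneg hb.le, Complex.norm_two]
              gcongr
              exact hC1 x
          _ = Real.exp (b * (x - L) / 2) * C2 + 2 * C1 * (b * Real.exp (b * (x - L) / 2)) := by
              ring
          _ ≤ 1 * C2 + 2 * C1 * (6 / L) := by gcongr
          _ = _ := by ring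
    have hstep : Real.exp (b * (x - L) / 2) *
        ‖f x * (deriv (deriv χ) x + 2 * b * deriv χ x) + κ * (h x - f x) * χ x‖ ≤
        K * (‖f x‖ + ‖h x‖) := by
      calc _ ≤ Real.exp (b * (x - L) / 2) *
            (‖f x‖ * ‖deriv (deriv χ) x + 2 * b * deriv χ x‖ + ‖κ‖ * (‖h x‖ + ‖f x‖) * 1) := by
            gcongr
            refine (norm_add_le _ _).trans (add_le_add (norm_mul _ _).le ?_)
            rw [norm_mul, norm_mul]
            gcongr
            · exact norm_sub_le _ _
            · exact hχ1 x
        _ = ‖f x‖ * (Real.exp (b * (x - L) / 2) * ‖deriv (deriv χ) x + 2 * b * deriv χ x‖) +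
            Real.exp (b * (x - L) / 2) * (‖κ‖ * (‖h x‖ + ‖f x‖)) := by ring
        _ ≤ ‖f x‖ * (C2 + 2 * C1 * (6 / L)) + 1 * (‖κ‖ * (‖h x‖ + ‖f x‖)) := by gcongr
        _ ≤ K * (‖f x‖ + ‖h x‖) := by
            rw [hK]
            have : 0 ≤ (C2 + 2 * C1 * (6 / L)) * ‖h x‖ := by positivity
            nlinarith
    rw [norm_mul, hexp]
    set E := Real.exp (b * (x - L) / 2) with hE
    have hE2 : Real.exp (b * (x - L)) = E ^ 2 := by
      rw [hE, sq, ← Real.exp_add]; ring_nf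
    rw [hE2]
    calc E * E * ‖f x * (deriv (deriv χ) x + 2 * b * deriv χ x) + κ * (h x - f x) * χ x‖
        ≤ E * (K * (‖f x‖ + ‖h x‖)) := by
          rw [mul_assoc]
          gcongr
      _ = K * (E * (‖f x‖ + ‖h x‖)) := by ring
      _ ≤ K * (t * (‖f x‖ ^ 2 + ‖h x‖ ^ 2) + 1 / (2 * t) * E ^ 2) := by
          gcongr
          -- Young's inequality with the free parameter t; the square of E will integrate to at most
          -- 1/b.
          have e1 : E * (‖f x‖ + ‖h x‖) ≤ t * (‖f x‖ + ‖h x‖) ^ 2 / 2 + 1 / (2 * t) * E ^ 2 := by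
            rw [div_mul_eq_mul_div, div_add_div _ _ (by norm_num) (by positivity),
              le_div_iff₀ (by positivity)]
            nlinarith [sq_nonneg (t * (‖f x‖ + ‖h x‖) - E)]
          have e2 : t * (‖f x‖ + ‖h x‖) ^ 2 / 2 ≤ t * (‖f x‖ ^ 2 + ‖h x‖ ^ 2) := by
            nlinarith [mul_nonneg ht.le (sq_nonneg (‖f x‖ - ‖h x‖))]
          linarith
      _ = _ := by ring
  have i5 : Integrable (fun x => K * (t * (‖f x‖ ^ 2 + ‖h x‖ ^ 2))) (volume.restrict (Ioc 0 L)) :=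
    ((if2.add ih2).const_mul t).const_mul K
  rw [integral_add i5 (ie.const_mul _), integral_const_mul,
    integral_const_mul, integral_const_mul, integral_add if2 ih2, norm_mul, norm_mul,
    Complex.norm_two, Complex.norm_real, Real.norm_of_nonneg hb.le] at hbound
  have h3 : K / (2 * t) * ∫ x in Ioc 0 L, Real.exp (b * (x - L)) ≤ K / (2 * t) * (1 / b) := by
    gcongr
    exact integral_exp_Ioc_le hb hL
  have h4 : K / (2 * t) * (1 / b) = K * (1 / (t * b)) / 2 := by field_simp
  have h5 : 0 ≤ K * (t * ((∫ x in Ioc 0 L, ‖f x‖ ^ 2) + ∫ x in Ioc 0 L, ‖h x‖ ^ 2)) := by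
    have a1 : 0 ≤ ∫ x in Ioc 0 L, ‖f x‖ ^ 2 := integral_nonneg fun _ => by positivity
    have a2 : 0 ≤ ∫ x in Ioc 0 L, ‖h x‖ ^ 2 := integral_nonneg fun _ => by positivity
    positivity
  have h6 : 0 ≤ K * (1 / (t * b)) := by positivity
  rw [mul_add]
  linarith

lemma coef_medium_mul {γ : ℝ × ℝ → ℝ} {L : ℝ} (hγ : IsMedium γ L) (w : ℝ × ℝ → ℂ)
    (n : ℕ) {x : ℝ} (hx : L ≤ x) : coef (fun p => (γ p : ℂ) * w p) n x = coef w n x := by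
  refine setIntegral_congr_fun measurableSet_Ioo fun y hy => ?_
  have : γ (x, y) = 1 := hγ.one (x, y) hy (hx.trans (le_abs_self x))
  simp [this]

lemma memLp_coef_Ioc {f : ℝ × ℝ → ℂ} (hf : L2Loc f) (L : ℝ) :
    MemLp f 2 ((volume.restrict (Ioc 0 L)).prod nu) := by
  refine (hf.memLp (|L| + 1)).mono_measure ?_
  refine Measure.prod_mono (Measure.restrict_mono (fun x hx => ?_) le_rfl) le_rfl
  have : x ≤ |L| := hx.2.trans (le_abs_self L)
  simp only [mem_ofPred_eq]
  rw [abs_of_pos hx.1]; linarith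

/-- Regularity up to the interface: summability of the exterior evanescent amplitudes. -/
theorem ScaledSol.summable_amplitudes {γ : ℝ × ℝ → ℝ} {L : ℝ} (hγ : IsMedium γ L) (hL : 0 < L)
    {B : ℝ → ℂ} (hB : IsPhase B) {k : ℝ} {N : ℕ} (hk0 : 0 < k) (hk1 : N * Real.pi < k)
    (hk : k < (N + 1) * Real.pi) {w wx wy : ℝ × ℝ → ℂ}
    (h : ScaledSol γ B k w wx wy) {e₀ : ℂ} (he₀ : e₀ ≠ 0)
    (hB1 : ∀ x, 0 < x → x < L → B x = 1) (hB2 : ∀ x, L ≤ x → B x = e₀⁻¹) {c : ℕ → ℂ}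
    (hc : ∀ n, N < n → ∀ᵐ x : ℝ, x ∈ Ioi L →
      coef w n x = c n * Complex.exp (-(rate k n * e₀) * (x - L))) :
    Summable fun n => rate k n ^ (3 / 4 : ℝ) * ‖c n‖ := by
  obtain ⟨K, hK0, hK⟩ := exists_amplitude_bound hL ((k : ℂ) ^ 2)
  have l1 := h.h1.l2Loc
  have l2 := hγ.l2Loc_mul l1
  set S : ℕ → ℝ := fun n => (∫ x in Ioc 0 L, ‖coef w n x‖ ^ 2) +
    ∫ x in Ioc 0 L, ‖coef (fun p => (γ p : ℂ) * w p) n x‖ ^ 2 with hS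
  have hS0 : ∀ n, 0 ≤ S n := fun n =>
    add_nonneg (integral_nonneg fun _ => by positivity) (integral_nonneg fun _ => by positivity)
  have hSs : Summable S := by
    refine summable_of_sum_le hS0 (c :=
      (∫ p, ‖w p‖ ^ 2 ∂((volume.restrict (Ioc 0 L)).prod nu)) +
      ∫ p, ‖(γ p : ℂ) * w p‖ ^ 2 ∂((volume.restrict (Ioc 0 L)).prod nu)) fun u => ?_
    rw [hS, Finset.sum_add_distrib]
    exact add_le_add (sum_integral_normSq_coef_le (memLp_coef_Ioc l1 L) u)
      (sum_integral_normSq_coef_le (memLp_coef_Ioc l2 L) u)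
  obtain ⟨κ, hκ, hκn⟩ := exists_rate_lower_bound hk0 hk
  have hrate : Summable fun n : ℕ => (κ * (n : ℝ)) ^ (-(3 / 2) : ℝ) := by
    have h1 : ∀ n : ℕ, (κ * (n : ℝ)) ^ (-(3 / 2) : ℝ) = κ ^ (-(3 / 2) : ℝ) * (n : ℝ) ^ (-(3 / 2) : ℝ) :=
      fun n => Real.mul_rpow hκ.le n.cast_nonneg
    simp_rw [h1]
    exact (Real.summable_nat_rpow.2 (by norm_num)).mul_left _
  refine Summable.of_nonneg_of_le
    (fun n => mul_nonneg (Real.rpow_nonneg (rate_nonneg k n) _) (norm_nonneg _)) (fun n => ?_)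
    ((hSs.add hrate).mul_left K)
  by_cases hn : N < n
  · have hb := rate_pos hk0 hk hn
    have hq : ((rate k n : ℝ) : ℂ) ^ 2 = ((n : ℂ) ^ 2 * (Real.pi : ℂ) ^ 2) - (k : ℂ) ^ 2 := by
      have := rate_sq hk0 hk hn
      exact_mod_cast congrArg (fun r : ℝ => (r : ℂ)) this
    have hf := l1.locallyIntegrable_coef n
    have hg := h.h1.l2Loc_x.locallyIntegrable_coef n
    have h1 : ∀ ψ, IsTest1 ψ → ∫ x, coef w n x * deriv ψ x = -∫ x, coef wx n x * ψ x :=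
      fun ψ hψ => h.h1.integral_coef_mul_deriv n hψ
    have hgc := ae_eq_of_weak_deriv_exp (hg.locallyIntegrableOn _) (fun ψ hψ _ => h1 ψ hψ) (hc n hn)
    -- The parameter is t = b^{1/4} with b the rate. Multiplying b‖c‖ ≤ K(tS + 1/(tb)) by b^{-1/4}
    -- gives b^{3/4}‖c‖ ≤ K(S + b^{-3/2}): S is summable by Bessel, and b ≥ κn makes the last term
    -- summable.
    have hmain := hK (coef w n) (coef wx n) (coef (fun p => (γ p : ℂ) * w p) n) B (rate k n) (c n)
      e₀ _ hb hq he₀ hf hg hB (l2.locallyIntegrable_coef n) h1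
      (fun ψ hψ => h.modal hγ hB n hψ) hB1 hB2 (hc n hn) hgc
      (Eventually.of_forall fun x hx => coef_medium_mul hγ w n (le_of_lt hx))
      (memLp_coef (memLp_coef_Ioc l1 L) n) (memLp_coef (memLp_coef_Ioc l2 L) n)
      (rate k n ^ (1 / 4 : ℝ)) (by positivity)
    have hr : rate k n ^ (-(3 / 2) : ℝ) ≤ (κ * (n : ℝ)) ^ (-(3 / 2) : ℝ) := by
      have hn0 : 0 < n := by omega
      exact Real.rpow_le_rpow_of_nonpos (by positivity) (hκn n hn) (by norm_num)
    set b := rate k n with hbdef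
    have e1 : b ^ (3 / 4 : ℝ) = b ^ (-(1 / 4) : ℝ) * b := by
      nth_rewrite 3 [← Real.rpow_one b]
      rw [← Real.rpow_add hb]; norm_num
    have e2 : b ^ (-(1 / 4) : ℝ) * b ^ (1 / 4 : ℝ) = 1 := by
      rw [← Real.rpow_add hb]; norm_num
    have e3 : b ^ (-(1 / 4) : ℝ) * (1 / (b ^ (1 / 4 : ℝ) * b)) = b ^ (-(3 / 2) : ℝ) := by
      have e4 : b ^ (-(3 / 2) : ℝ) = b ^ (-(1 / 4) : ℝ) * (b ^ (-(1 / 4) : ℝ) * b ^ (-1 : ℝ)) := by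
        rw [← Real.rpow_add hb, ← Real.rpow_add hb]; norm_num
      rw [one_div (b ^ (1 / 4 : ℝ) * b), mul_inv, ← Real.rpow_neg hb.le, e4, Real.rpow_neg_one]
    calc b ^ (3 / 4 : ℝ) * ‖c n‖ = b ^ (-(1 / 4) : ℝ) * (b * ‖c n‖) := by rw [e1]; ring
      _ ≤ b ^ (-(1 / 4) : ℝ) * (K * (b ^ (1 / 4 : ℝ) * S n + 1 / (b ^ (1 / 4 : ℝ) * b))) := by
          gcongr
      _ = K * ((b ^ (-(1 / 4) : ℝ) * b ^ (1 / 4 : ℝ)) * S n +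
          b ^ (-(1 / 4) : ℝ) * (1 / (b ^ (1 / 4 : ℝ) * b))) := by ring
      _ ≤ _ := by
          rw [e2, e3, one_mul]
          gcongr
  -- Propagating modes: `rate` is 0, the real square root of a negative number being 0, and 0^{3/4}
  -- = 0.
  · rw [rate_eq_zero hk1 (not_lt.1 hn), Real.zero_rpow (by norm_num), zero_mul]
    have : 0 ≤ S n := hS0 n
    positivity

/-! ### Exponents and bounds for the exterior modes -/

/-- Admissible exponents of the exterior modes: square roots of `n²π² - k²` that give decaying
exponentials for `n > N`. -/
structure IsExponent (k : ℝ) (N : ℕ) (μ : ℕ → ℂ) : Prop where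
  sq : ∀ n : ℕ, μ n ^ 2 = (n : ℂ) ^ 2 * (Real.pi : ℂ) ^ 2 - (k : ℂ) ^ 2
  tail : ∀ n, N < n → μ n = -(rate k n : ℂ)

/-- The weight dominating the terms of the exterior series. -/
def ampWeight (k : ℝ) (n : ℕ) : ℝ := 1 + rate k n ^ (3 / 4 : ℝ)

lemma one_le_ampWeight (k : ℝ) (n : ℕ) : 1 ≤ ampWeight k n := by
  have := Real.rpow_nonneg (rate_nonneg k n) (3 / 4)
  unfold ampWeight; linarith

/-- For n > N the rate is at least κ, so the weighted sum also controls Σ‖c n‖. -/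
lemma summable_ampWeight {k : ℝ} {N : ℕ} (hk0 : 0 < k) (hk : k < (N + 1) * Real.pi) {c : ℕ → ℂ}
    (hc : Summable fun n => rate k n ^ (3 / 4 : ℝ) * ‖c n‖) :
    Summable fun n => ampWeight k n * ‖c n‖ := by
  obtain ⟨κ, hκ, hκn⟩ := exists_rate_lower_bound hk0 hk
  have h1 : Summable fun n => ‖c n‖ := by
    refine summable_of_isBigO_nat hc ?_
    refine Asymptotics.IsBigO.of_bound (κ ^ (3 / 4 : ℝ))⁻¹ ?_
    filter_upwards [eventually_gt_atTop N] with n hn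
    have hn1 : (1:ℝ) ≤ n := by
      have : 1 ≤ n := by omega
      exact_mod_cast this
    have h2 : κ ^ (3 / 4 : ℝ) ≤ rate k n ^ (3 / 4 : ℝ) := by
      refine Real.rpow_le_rpow hκ.le (le_trans ?_ (hκn n hn)) (by norm_num)
      nlinarith
    have hp : 0 < κ ^ (3 / 4 : ℝ) := by positivity
    rw [norm_norm, norm_mul, norm_norm, Real.norm_of_nonneg (hp.le.trans h2),
      inv_mul_eq_div, le_div_iff₀ hp, mul_comm]
    gcongr
  have := h1.add hc
  refine this.congr fun n => ?_
  unfold ampWeight; ring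

/-- Trades a quarter power of the rate for s^{-1/4}: a derivative of a mode costs one power of the
rate, of which the summability of the amplitudes pays only 3/4. -/
lemma rpow_quarter_mul_exp_neg_le {x : ℝ} (hx : 0 ≤ x) :
    x ^ (1 / 4 : ℝ) * Real.exp (-x) ≤ 1 := by
  have h1 : x ^ (1 / 4 : ℝ) ≤ Real.exp x := by
    by_cases h : x ≤ 1
    · exact (Real.rpow_le_one hx h (by norm_num)).trans (Real.one_le_exp hx)
    · have h' := (not_le.1 h).le
      calc x ^ (1 / 4 : ℝ) ≤ x ^ (1 : ℝ) := Real.rpow_le_rpow_of_exponent_le h' (by norm_num)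
        _ = x := Real.rpow_one x
        _ ≤ Real.exp x := by linarith [Real.add_one_le_exp x]
  rw [Real.exp_neg, ← div_eq_mul_inv]
  exact div_le_one_of_le₀ h1 (Real.exp_pos x).le

/-- Bounds for the exterior modes and their derivatives, singular at the interface. -/
lemma IsExponent.exists_term_bound {k : ℝ} {N : ℕ} {μ : ℕ → ℂ} (hμ : IsExponent k N μ)
    (hk0 : 0 < k) (hk : k < (N + 1) * Real.pi) {e₀ : ℂ} (he : 0 < e₀.re) (he1 : ‖e₀‖ = 1)
    {R : ℝ} (hR : 0 < R) : ∃ M, 0 ≤ M ∧ ∀ (n : ℕ) (s : ℝ), 0 ≤ s → s ≤ R →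
      ‖Complex.exp (μ n * (e₀ * s))‖ ≤ M ∧
      (0 < s → ‖μ n‖ * ‖Complex.exp (μ n * (e₀ * s))‖ ≤ M * ampWeight k n * s ^ (-(1 / 4) : ℝ) ∧
      n * Real.pi * ‖Complex.exp (μ n * (e₀ * s))‖ ≤ M * ampWeight k n * s ^ (-(1 / 4) : ℝ)) := by
  obtain ⟨κ, hκ, hκn⟩ := exists_rate_lower_bound hk0 hk
  set ρ := e₀.re with hρ
  -- Crude bounds for the finitely many modes n ≤ N, which need not decay here. The factor with
  -- R^{1/4} is there because s^{-1/4} ≥ R^{-1/4}.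
  set X : ℕ → ℝ := fun n => (1 + ‖μ n‖ + n * Real.pi) * Real.exp (‖μ n‖ * R) * (1 + R ^ (1 / 4 : ℝ))
    with hX
  have hX0 : ∀ n, 0 ≤ X n := fun n => by positivity
  set M2 := ∑ n ∈ Finset.range (N + 1), X n with hM2
  have hM20 : 0 ≤ M2 := Finset.sum_nonneg fun n _ => hX0 n
  -- π/κ comes from nπ ≤ (π/κ)·rate, and ρ^{-1/4} from the decay e^{-rate·ρ·s} along the rotated
  -- half-line.
  set M1 := (1 + Real.pi / κ) * ρ ^ (-(1 / 4) : ℝ) with hM1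
  have hM10 : 0 ≤ M1 := by positivity
  refine ⟨1 + M1 + M2, by positivity, fun n s hs hsR => ?_⟩
  have hw := one_le_ampWeight k n
  by_cases hn : N < n
  · have hb := rate_pos hk0 hk hn
    have hexp : ‖Complex.exp (μ n * (e₀ * s))‖ = Real.exp (-(rate k n * ρ * s)) := by
      rw [Complex.norm_exp, hμ.tail n hn]
      congr 1
      simp
      ring
    rw [hexp]
    constructor
    · have : Real.exp (-(rate k n * ρ * s)) ≤ 1 := by
        rw [Real.exp_le_one_iff]
        have : 0 ≤ rate k n * ρ * s := by positivity
        linarith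
      linarith
    · intro hs0
      have hkey : rate k n * Real.exp (-(rate k n * ρ * s)) ≤
          ampWeight k n * (ρ ^ (-(1 / 4) : ℝ) * s ^ (-(1 / 4) : ℝ)) := by
        have e1 : rate k n = rate k n ^ (3 / 4 : ℝ) * rate k n ^ (1 / 4 : ℝ) := by
          rw [← Real.rpow_add hb]; norm_num
        have e2 : rate k n ^ (1 / 4 : ℝ) = (rate k n * ρ * s) ^ (1 / 4 : ℝ) *
            (ρ ^ (-(1 / 4) : ℝ) * s ^ (-(1 / 4) : ℝ)) := by
          rw [Real.mul_rpow (by positivity) hs, Real.mul_rpow hb.le he.le, Real.rpow_neg he.le,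
            Real.rpow_neg hs]
          have a1 : 0 < ρ ^ (1 / 4 : ℝ) := by positivity
          have a2 : 0 < s ^ (1 / 4 : ℝ) := by positivity
          field_simp
        calc rate k n * Real.exp (-(rate k n * ρ * s)) = rate k n ^ (3 / 4 : ℝ) *
              (rate k n ^ (1 / 4 : ℝ) * Real.exp (-(rate k n * ρ * s))) := by
                nth_rewrite 1 [e1]; ring
          _ = rate k n ^ (3 / 4 : ℝ) * ((rate k n * ρ * s) ^ (1 / 4 : ℝ) *
              Real.exp (-(rate k n * ρ * s)) * (ρ ^ (-(1 / 4) : ℝ) * s ^ (-(1 / 4) : ℝ))) := by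
                rw [e2]; ring
          _ ≤ ampWeight k n * (1 * (ρ ^ (-(1 / 4) : ℝ) * s ^ (-(1 / 4) : ℝ))) := by
                have h1 := rpow_quarter_mul_exp_neg_le (x := rate k n * ρ * s) (by positivity)
                have h2 : rate k n ^ (3 / 4 : ℝ) ≤ ampWeight k n := by
                  unfold ampWeight; linarith
                gcongr
          _ = _ := by rw [one_mul]
      have hs4 : 0 ≤ s ^ (-(1 / 4) : ℝ) := by positivity
      have hρ4 : 0 ≤ ρ ^ (-(1 / 4) : ℝ) := by positivity
      have hfin : (1 + Real.pi / κ) * (ampWeight k n * (ρ ^ (-(1 / 4) : ℝ) * s ^ (-(1 / 4) : ℝ))) ≤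
          (1 + M1 + M2) * ampWeight k n * s ^ (-(1 / 4) : ℝ) := by
        have : (1 + Real.pi / κ) * (ampWeight k n * (ρ ^ (-(1 / 4) : ℝ) * s ^ (-(1 / 4) : ℝ))) =
            M1 * ampWeight k n * s ^ (-(1 / 4) : ℝ) := by rw [hM1]; ring
        rw [this]
        gcongr
        linarith
      have hpk : 0 ≤ Real.pi / κ := by positivity
      have hnn : 0 ≤ ampWeight k n * (ρ ^ (-(1 / 4) : ℝ) * s ^ (-(1 / 4) : ℝ)) := by positivity
      constructor
      · rw [hμ.tail n hn, norm_neg, Complex.norm_real, Real.norm_of_nonneg hb.le]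
        refine (hkey.trans ?_).trans hfin
        nlinarith
      · have h3 : n * Real.pi ≤ Real.pi / κ * rate k n := by
          rw [div_mul_eq_mul_div, le_div_iff₀ hκ]
          nlinarith [hκn n hn, Real.pi_pos]
        calc n * Real.pi * Real.exp (-(rate k n * ρ * s)) ≤
              Real.pi / κ * rate k n * Real.exp (-(rate k n * ρ * s)) := by gcongr
          _ = Real.pi / κ * (rate k n * Real.exp (-(rate k n * ρ * s))) := by ring
          _ ≤ Real.pi / κ * (ampWeight k n * (ρ ^ (-(1 / 4) : ℝ) * s ^ (-(1 / 4) : ℝ))) := by gcongr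
          _ ≤ _ := by
            refine le_trans ?_ hfin
            nlinarith
  · have hmem : n ∈ Finset.range (N + 1) := by
      rw [Finset.mem_range]; omega
    have hXM : X n ≤ M2 := Finset.single_le_sum (fun i _ => hX0 i) hmem
    have hexp : ‖Complex.exp (μ n * (e₀ * s))‖ ≤ Real.exp (‖μ n‖ * R) := by
      rw [Complex.norm_exp]
      refine Real.exp_le_exp.2 ((Complex.re_le_norm _).trans ?_)
      rw [norm_mul, norm_mul, he1, one_mul, Complex.norm_real, Real.norm_of_nonneg hs]
      gcongr
    have hr4 : 0 ≤ R ^ (1 / 4 : ℝ) := by positivity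
    have hE := (Real.exp_pos (‖μ n‖ * R)).le
    have hpi : 0 ≤ n * Real.pi := by positivity
    constructor
    · have : Real.exp (‖μ n‖ * R) ≤ X n := by
        rw [hX]
        simp only
        have h1 : 1 ≤ (1 + ‖μ n‖ + n * Real.pi) := by linarith [norm_nonneg (μ n)]
        calc Real.exp (‖μ n‖ * R) = 1 * Real.exp (‖μ n‖ * R) * 1 := by ring
          _ ≤ _ := by gcongr; linarith
      linarith
    · intro hs0
      have hone : 1 ≤ R ^ (1 / 4 : ℝ) * s ^ (-(1 / 4) : ℝ) := by
        rw [Real.rpow_neg hs, ← div_eq_mul_inv, one_le_div (by positivity)]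
        gcongr
      have hs4 : 0 ≤ s ^ (-(1 / 4) : ℝ) := by positivity
      have hgen : ∀ z, 0 ≤ z → z ≤ 1 + ‖μ n‖ + n * Real.pi →
          z * ‖Complex.exp (μ n * (e₀ * s))‖ ≤
            (1 + M1 + M2) * ampWeight k n * s ^ (-(1 / 4) : ℝ) := by
        intro z hz0 hz
        calc z * ‖Complex.exp (μ n * (e₀ * s))‖
            ≤ (1 + ‖μ n‖ + n * Real.pi) * Real.exp (‖μ n‖ * R) *
              (R ^ (1 / 4 : ℝ) * s ^ (-(1 / 4) : ℝ)) := by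
              refine le_trans (mul_le_mul hz hexp (norm_nonneg _) (by positivity)) ?_
              refine le_mul_of_one_le_right (by positivity) hone
          _ ≤ X n * s ^ (-(1 / 4) : ℝ) := by
              rw [hX, ← mul_assoc]
              simp only
              gcongr
              linarith
          _ ≤ (1 + M1 + M2) * ampWeight k n * s ^ (-(1 / 4) : ℝ) := by
              gcongr
              calc X n ≤ M2 * 1 := by linarith
                _ ≤ (1 + M1 + M2) * ampWeight k n := by gcongr; linarith
      exact ⟨hgen _ (norm_nonneg _) (by linarith), hgen _ hpi (by linarith [norm_nonneg (μ n)])⟩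

/-! ### Normally convergent series beyond the interface -/

/-- The part of the waveguide on the right of `x = L`. -/
def rightPart (L : ℝ) : Set (ℝ × ℝ) := strip ∩ {p | L < p.1}

lemma measurableSet_rightPart (L : ℝ) : MeasurableSet (rightPart L) :=
  measurableSet_strip.inter (measurableSet_lt measurable_const measurable_fst)

lemma restrict_rightPart (L : ℝ) :
    (volume : Measure (ℝ × ℝ)).restrict (rightPart L) = (volume.restrict (Ioi L)).prod nu :=
  restrict_strip_inter (Ioi L)

/-- A square integrable weight that is singular at the interface `x = L`. -/
def singWeight (L : ℝ) (p : ℝ × ℝ) : ℂ :=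
  if L < p.1 then (((p.1 - L) ^ (-(1 / 4) : ℝ) : ℝ) : ℂ) else 0

/-- The square of s^{-1/4} is s^{-1/2}, integrable at 0. This is why amplitudes summable with the
weight rate^{3/4} give a gradient in L². -/
lemma l2Loc_singWeight (L : ℝ) : L2Loc (singWeight L) := by
  intro r
  rw [show (strip ∩ {p : ℝ × ℝ | |p.1| < r}) = strip ∩ {p | p.1 ∈ {x : ℝ | |x| < r}} from rfl,
    restrict_strip_inter]
  set g : ℝ → ℂ := fun x => if L < x then (((x - L) ^ (-(1 / 4) : ℝ) : ℝ) : ℂ) else 0 with hg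
  have hgm : Measurable g := Measurable.ite (measurableSet_lt measurable_const measurable_id)
    (Complex.measurable_ofReal.comp ((measurable_id.sub_const L).pow_const _)) measurable_const
  have hmem : MemLp g 2 (volume.restrict {x : ℝ | |x| < r}) := by
    rw [memLp_two_iff_integrable_sq_norm hgm.aestronglyMeasurable]
    have h1 : IntervalIntegrable (fun x : ℝ => (x - L) ^ (-(1 / 2) : ℝ)) volume L (L + (|r| + |L|)) := by
      have := (intervalIntegral.intervalIntegrable_rpow' (a := 0) (b := |r| + |L|)
        (r := (-(1 / 2) : ℝ)) (by norm_num)).comp_sub_right L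
      simpa [add_comm] using this
    rw [intervalIntegrable_iff_integrableOn_Ioc_of_le (by linarith [abs_nonneg r, abs_nonneg L])] at h1
    have h2 : IntegrableOn (fun x => ‖g x‖ ^ 2) (Ioc L (L + (|r| + |L|))) := by
      refine h1.congr_fun (fun x hx => ?_) measurableSet_Ioc
      have hx0 : 0 < x - L := sub_pos.2 hx.1
      simp only [hg, if_pos hx.1, Complex.norm_real]
      rw [Real.norm_of_nonneg (by positivity), ← Real.rpow_natCast, ← Real.rpow_mul hx0.le]
      norm_num
    refine (h2.of_forall_sdiff_eq_zero (t := {x : ℝ | |x| < r})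
      (measurableSet_lt (by fun_prop) measurable_const) fun x hx => ?_)
    have : ¬ L < x := by
      intro hLx
      refine hx.2 ⟨hLx, ?_⟩
      have a1 : |x| < r := hx.1
      have a2 := le_abs_self x
      have a3 := le_abs_self r
      have a4 := neg_abs_le L
      linarith
    simp [hg, this]
  exact hmem.comp_fst nu

/-- A family of continuous functions whose series converges normally for `x > L`, with a mild
singularity allowed at `x = L`. -/
structure Dominated (L : ℝ) (T : ℕ → ℝ × ℝ → ℂ) : Prop where
  cont : ∀ n, Continuous (T n)
  bound : ∀ R : ℝ, 0 < R → ∃ a : ℕ → ℝ, Summable a ∧ ∀ (n : ℕ) (p : ℝ × ℝ), L < p.1 →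
    p.1 ≤ L + R → ‖T n p‖ ≤ a n * (p.1 - L) ^ (-(1 / 4) : ℝ)

lemma Dominated.summable {L : ℝ} {T : ℕ → ℝ × ℝ → ℂ} (hT : Dominated L T) {p : ℝ × ℝ}
    (hp : L < p.1) : Summable fun n => ‖T n p‖ := by
  obtain ⟨a, ha, hb⟩ := hT.bound (p.1 - L) (sub_pos.2 hp)
  exact Summable.of_nonneg_of_le (fun n => norm_nonneg _) (fun n => hb n p hp (by linarith))
    (ha.mul_right _)

lemma Dominated.hasSum {L : ℝ} {T : ℕ → ℝ × ℝ → ℂ} (hT : Dominated L T) {p : ℝ × ℝ}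
    (hp : L < p.1) : HasSum (fun n => T n p) (∑' n, T n p) :=
  (hT.summable hp).of_norm.hasSum

lemma Dominated.measurable {L : ℝ} {T : ℕ → ℝ × ℝ → ℂ} (hT : Dominated L T) :
    Measurable fun p : ℝ × ℝ => if L < p.1 then ∑' n, T n p else 0 := by
  have hs : MeasurableSet {p : ℝ × ℝ | L < p.1} := measurableSet_lt measurable_const measurable_fst
  refine measurable_of_tendsto_metrizable (f := fun M p => if L < p.1 then
    ∑ n ∈ Finset.range M, T n p else 0) (fun M => ?_) ?_
  · exact Measurable.ite hs (Finset.measurable_sum _ fun n _ => (hT.cont n).measurable)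
      measurable_const
  · rw [tendsto_pi_nhds]
    intro p
    by_cases hp : L < p.1
    · simpa only [if_pos hp] using (hT.hasSum hp).tendsto_sum_nat
    · simp only [if_neg hp]
      exact tendsto_const_nhds

/-- Gluing a function on the left of `x = L` and a series on the right. -/
def glue (L : ℝ) (w F : ℝ × ℝ → ℂ) (p : ℝ × ℝ) : ℂ := if L < p.1 then F p else w p

lemma Dominated.l2Loc_zero_glue {L : ℝ} {T : ℕ → ℝ × ℝ → ℂ} (hT : Dominated L T) :
    L2Loc (glue L (fun _ => 0) fun p => ∑' n, T n p) := by
  intro r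
  obtain ⟨a, ha, hb⟩ := hT.bound (|r| + |L| + 1) (by positivity)
  have hA : MeasurableSet (strip ∩ {p : ℝ × ℝ | |p.1| < r}) :=
    measurableSet_strip.inter (measurableSet_lt (by fun_prop) measurable_const)
  refine (l2Loc_singWeight L r).of_le_mul (c := ∑' n, a n) hT.measurable.aestronglyMeasurable ?_
  refine (ae_restrict_mem hA).mono fun p hp => ?_
  by_cases hpL : L < p.1
  · have hpR : p.1 ≤ L + (|r| + |L| + 1) := by
      have a1 : |p.1| < r := hp.2
      have a2 := le_abs_self p.1
      have a3 := le_abs_self r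
      have a4 := neg_abs_le L
      linarith
    have hs := hT.summable hpL
    have h0 : 0 < p.1 - L := sub_pos.2 hpL
    simp only [glue, if_pos hpL, singWeight, Complex.norm_real]
    rw [Real.norm_of_nonneg (by positivity), ← tsum_mul_right]
    exact (norm_tsum_le_tsum_norm hs).trans
      (hs.tsum_le_tsum (fun n => hb n p hpL hpR) (ha.mul_right _))
  · simp [glue, singWeight, hpL]

lemma L2Loc.indicator_left {w : ℝ × ℝ → ℂ} (hw : L2Loc w) (L : ℝ) :
    L2Loc (glue L w fun _ => 0) := by
  have hs : MeasurableSet {p : ℝ × ℝ | L < p.1} := measurableSet_lt measurable_const measurable_fst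
  have := hw.bdd_mul (g := fun p => if L < p.1 then 0 else 1) (C := 1)
    (Measurable.ite hs measurable_const measurable_const).aestronglyMeasurable
    (fun p _ => by by_cases h : L < p.1 <;> simp [h])
  convert this using 2 with p
  by_cases h : L < p.1 <;> simp [glue, h]

lemma Dominated.l2Loc_glue {L : ℝ} {T : ℕ → ℝ × ℝ → ℂ} (hT : Dominated L T) {w : ℝ × ℝ → ℂ}
    (hw : L2Loc w) : L2Loc (glue L w fun p => ∑' n, T n p) := by
  have := (hw.indicator_left L).add hT.l2Loc_zero_glue
  convert this using 2 with p
  by_cases h : L < p.1 <;> simp [glue, h]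

/-- Termwise integration of the exterior series. -/
lemma Dominated.hasSum_integral {L : ℝ} {T : ℕ → ℝ × ℝ → ℂ} (hT : Dominated L T)
    {v : ℝ × ℝ → ℂ} (hv : Continuous v) (hs : XSupp v) :
    HasSum (fun n => ∫ p in rightPart L, T n p * v p)
      (∫ p in rightPart L, (∑' n, T n p) * v p) := by
  obtain ⟨R, hR⟩ := hs
  obtain ⟨a, ha, hb⟩ := hT.bound (|R| + |L| + 1) (by positivity)
  have hi : Integrable (fun p => singWeight L p * v p) (volume.restrict (rightPart L)) :=
    ((l2Loc_singWeight L).integrable_mul hv ⟨R, hR⟩).mono_measure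
      (Measure.restrict_mono inter_subset_left le_rfl)
  refine hasSum_integral_of_dominated_convergence (fun n p => a n * ‖singWeight L p * v p‖)
    (fun n => ((hT.cont n).mul hv).aestronglyMeasurable) (fun n => ?_)
    (Eventually.of_forall fun p => ha.mul_right _) ?_ ?_
  · refine (ae_restrict_mem (measurableSet_rightPart L)).mono fun p hp => ?_
    have hpL : L < p.1 := hp.2
    by_cases hpR : p.1 ≤ L + (|R| + |L| + 1)
    · have h0 : 0 < p.1 - L := sub_pos.2 hpL
      rw [norm_mul, norm_mul, ← mul_assoc]
      gcongr
      rw [singWeight, if_pos hpL, Complex.norm_real, Real.norm_of_nonneg (by positivity)]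
      exact hb n p hpL hpR
    · have : v p = 0 := hR p (by
        have a2 := le_abs_self p.1
        have a3 := le_abs_self R
        have a4 := neg_abs_le L
        linarith)
      simp [this]
  · simp_rw [tsum_mul_right]
    exact hi.norm.const_mul _
  · refine (ae_restrict_mem (measurableSet_rightPart L)).mono fun p hp => ?_
    exact (hT.hasSum hp.2).mul_right _

lemma continuous_integrable_rightPart {f v : ℝ × ℝ → ℂ} (hf : Continuous f) (hv : Continuous v)
    (hs : XSupp v) (L : ℝ) : Integrable (fun p => f p * v p) (volume.restrict (rightPart L)) := by
  have h1 : L2Loc (fun _ => (1 : ℂ)) := by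
    intro r
    have hfin : IsFiniteMeasure ((volume : Measure (ℝ × ℝ)).restrict (strip ∩ {p | |p.1| < r})) := by
      refine ⟨?_⟩
      rw [Measure.restrict_apply_univ]
      refine (((isCompact_Icc (a := -r) (b := r)).prod
        (isCompact_Icc (a := (0:ℝ)) (b := 1))).measure_lt_top (μ := volume)).trans_le'
          (measure_mono ?_)
      intro p hp
      exact ⟨abs_le.1 hp.2.le, hp.1.1.le, hp.1.2.le⟩
    exact memLp_const 1
  obtain ⟨R, hR⟩ := hs
  have := (h1.integrable_mul (hf.mul hv) ⟨R, fun p hp => by simp [hR p hp]⟩).mono_measure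
    (Measure.restrict_mono (s := rightPart L) inter_subset_left le_rfl)
  simpa using this

/-! ### The exterior series -/

/-- `∑ c_n e^{μ_n ζ} φ_n(y)`. -/
def modeSeries (c μ : ℕ → ℂ) (ζ : ℂ) (y : ℝ) : ℂ :=
  ∑' n, c n * Complex.exp (μ n * ζ) * (phi n y : ℂ)

/-- The direction e₀ rotates the variable x - L. The same amplitudes and exponents serve for the
scaled function, with e₀ = e^{±iθ}, and for the unscaled one, with e₀ = 1. -/
def extTerm (c μ : ℕ → ℂ) (e₀ : ℂ) (L : ℝ) (n : ℕ) (p : ℝ × ℝ) : ℂ :=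
  c n * Complex.exp (μ n * e₀ * (p.1 - L)) * (phi n p.2 : ℂ)

def extTermX (c μ : ℕ → ℂ) (e₀ : ℂ) (L : ℝ) (n : ℕ) (p : ℝ × ℝ) : ℂ :=
  μ n * e₀ * (c n * Complex.exp (μ n * e₀ * (p.1 - L))) * (phi n p.2 : ℂ)

def extTermY (c μ : ℕ → ℂ) (e₀ : ℂ) (L : ℝ) (n : ℕ) (p : ℝ × ℝ) : ℂ :=
  c n * Complex.exp (μ n * e₀ * (p.1 - L)) * (dphi n p.2 : ℂ)

def ext (c μ : ℕ → ℂ) (e₀ : ℂ) (L : ℝ) (p : ℝ × ℝ) : ℂ := ∑' n, extTerm c μ e₀ L n p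
def extX (c μ : ℕ → ℂ) (e₀ : ℂ) (L : ℝ) (p : ℝ × ℝ) : ℂ := ∑' n, extTermX c μ e₀ L n p
def extY (c μ : ℕ → ℂ) (e₀ : ℂ) (L : ℝ) (p : ℝ × ℝ) : ℂ := ∑' n, extTermY c μ e₀ L n p

/-- The standing assumptions on the exterior series. -/
structure ExtData (k : ℝ) (N : ℕ) (c μ : ℕ → ℂ) (e₀ : ℂ) : Prop where
  pos : 0 < k
  lt : k < (N + 1) * Real.pi
  exponent : IsExponent k N μ
  summable : Summable fun n => ampWeight k n * ‖c n‖
  re_pos : 0 < e₀.re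
  norm_eq : ‖e₀‖ = 1

section ExtSeries

variable {k : ℝ} {N : ℕ} {c μ : ℕ → ℂ} {e₀ : ℂ}

lemma ExtData.summable_norm (h : ExtData k N c μ e₀) : Summable fun n => ‖c n‖ :=
  Summable.of_nonneg_of_le (fun _ => norm_nonneg _)
    (fun n => le_mul_of_one_le_left (norm_nonneg _) (one_le_ampWeight k n)) h.summable

lemma norm_phi_le (n : ℕ) (y : ℝ) : ‖(phi n y : ℂ)‖ ≤ 2 := by
  rw [Complex.norm_real]; exact abs_phi_le n y

lemma norm_dphi_le (n : ℕ) (y : ℝ) : ‖(dphi n y : ℂ)‖ ≤ 2 * (n * Real.pi) := by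
  rw [Complex.norm_real]; exact abs_dphi_le n y

/-- The exterior series converges normally up to the interface. -/
lemma ExtData.exists_extTerm_bound (h : ExtData k N c μ e₀) (L : ℝ) {R : ℝ} (hR : 0 < R) :
    ∃ M, 0 ≤ M ∧ ∀ n p, L ≤ p.1 → p.1 ≤ L + R → ‖extTerm c μ e₀ L n p‖ ≤ M * ‖c n‖ := by
  obtain ⟨M, hM0, hM⟩ := h.exponent.exists_term_bound h.pos h.lt h.re_pos h.norm_eq hR
  refine ⟨2 * M, by positivity, fun n p h1 h2 => ?_⟩
  have h3 := (hM n (p.1 - L) (by linarith) (by linarith)).1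
  rw [extTerm, norm_mul, norm_mul]
  rw [show μ n * e₀ * ((p.1 : ℂ) - L) = μ n * (e₀ * ((p.1 - L : ℝ) : ℂ)) by push_cast; ring]
  calc _ ≤ ‖c n‖ * M * 2 := by
        gcongr
        exact norm_phi_le _ _
    _ = _ := by ring

lemma ExtData.dominated_Y (h : ExtData k N c μ e₀) (L : ℝ) : Dominated L (extTermY c μ e₀ L) := by
  refine ⟨fun n => by unfold extTermY; fun_prop, fun R hR => ?_⟩
  obtain ⟨M, hM0, hM⟩ := h.exponent.exists_term_bound h.pos h.lt h.re_pos h.norm_eq hR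
  refine ⟨fun n => 2 * M * (ampWeight k n * ‖c n‖), h.summable.mul_left _, fun n p h1 h2 => ?_⟩
  have h3 := ((hM n (p.1 - L) (by linarith) (by linarith)).2 (by linarith)).2
  rw [extTermY, norm_mul, norm_mul]
  rw [show μ n * e₀ * ((p.1 : ℂ) - L) = μ n * (e₀ * ((p.1 - L : ℝ) : ℂ)) by push_cast; ring]
  calc _ ≤ ‖c n‖ * ‖Complex.exp (μ n * (e₀ * ((p.1 - L : ℝ) : ℂ)))‖ * (2 * (n * Real.pi)) := by
        gcongr
        exact norm_dphi_le _ _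
    _ = 2 * ‖c n‖ * (n * Real.pi * ‖Complex.exp (μ n * (e₀ * ((p.1 - L : ℝ) : ℂ)))‖) := by ring
    _ ≤ 2 * ‖c n‖ * (M * ampWeight k n * (p.1 - L) ^ (-(1 / 4) : ℝ)) := by gcongr
    _ = _ := by ring

lemma ExtData.dominated_X (h : ExtData k N c μ e₀) (L : ℝ) : Dominated L (extTermX c μ e₀ L) := by
  refine ⟨fun n => by unfold extTermX; fun_prop, fun R hR => ?_⟩
  obtain ⟨M, hM0, hM⟩ := h.exponent.exists_term_bound h.pos h.lt h.re_pos h.norm_eq hR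
  refine ⟨fun n => 2 * M * (ampWeight k n * ‖c n‖), h.summable.mul_left _, fun n p h1 h2 => ?_⟩
  have h3 := ((hM n (p.1 - L) (by linarith) (by linarith)).2 (by linarith)).1
  rw [extTermX, norm_mul, norm_mul, norm_mul, norm_mul, h.norm_eq]
  rw [show μ n * e₀ * ((p.1 : ℂ) - L) = μ n * (e₀ * ((p.1 - L : ℝ) : ℂ)) by push_cast; ring]
  calc _ ≤ ‖μ n‖ * 1 * (‖c n‖ * ‖Complex.exp (μ n * (e₀ * ((p.1 - L : ℝ) : ℂ)))‖) * 2 := by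
        gcongr
        exact norm_phi_le _ _
    _ = 2 * ‖c n‖ * (‖μ n‖ * ‖Complex.exp (μ n * (e₀ * ((p.1 - L : ℝ) : ℂ)))‖) := by ring
    _ ≤ 2 * ‖c n‖ * (M * ampWeight k n * (p.1 - L) ^ (-(1 / 4) : ℝ)) := by gcongr
    _ = _ := by ring

lemma ExtData.dominated (h : ExtData k N c μ e₀) (L : ℝ) : Dominated L (extTerm c μ e₀ L) := by
  refine ⟨fun n => by unfold extTerm; fun_prop, fun R hR => ?_⟩
  obtain ⟨M, hM0, hM⟩ := h.exists_extTerm_bound L hR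
  -- The series itself is not singular at the interface; R^{1/4} only makes room for the factor (x -
  -- L)^{-1/4} that `Dominated` allows.
  refine ⟨fun n => M * ‖c n‖ * R ^ (1 / 4 : ℝ), (h.summable_norm.mul_left _).mul_right _,
    fun n p h1 h2 => ?_⟩
  refine (hM n p h1.le h2).trans ?_
  have hs : 0 < p.1 - L := sub_pos.2 h1
  have hone : 1 ≤ R ^ (1 / 4 : ℝ) * (p.1 - L) ^ (-(1 / 4) : ℝ) := by
    rw [Real.rpow_neg hs.le, ← div_eq_mul_inv, one_le_div (by positivity)]
    gcongr
    linarith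
  rw [mul_assoc (M * ‖c n‖)]
  exact le_mul_of_one_le_right (by positivity) hone

lemma ext_eq_modeSeries (L : ℝ) (p : ℝ × ℝ) :
    ext c μ e₀ L p = modeSeries c μ (e₀ * (p.1 - L)) p.2 := by
  simp only [ext, modeSeries, extTerm, mul_assoc]

end ExtSeries

/-! ### Green's formulas for the exterior series -/

lemma hasDerivAt_slice_x {v : ℝ × ℝ → ℂ} (hv : IsTest v) (x y : ℝ) :
    HasDerivAt (fun x : ℝ => v (x, y)) (dx v (x, y)) x := by
  have h := (hv.1.differentiable (by simp)).differentiableAt.hasFDerivAt (x := (x, y))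
  have := h.comp_hasDerivAt x ((hasDerivAt_id x).prodMk (hasDerivAt_const x y))
  exact this

lemma hasDerivAt_slice_y {v : ℝ × ℝ → ℂ} (hv : IsTest v) (x y : ℝ) :
    HasDerivAt (fun y : ℝ => v (x, y)) (dy v (x, y)) y := by
  have h := (hv.1.differentiable (by simp)).differentiableAt.hasFDerivAt (x := (x, y))
  have := h.comp_hasDerivAt y ((hasDerivAt_const y x).prodMk (hasDerivAt_id y))
  exact this

lemma IsTest.xSupp {v : ℝ × ℝ → ℂ} (hv : IsTest v) : XSupp v := xSupp_of_hasCompactSupport hv.2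

lemma IsTest.xSupp_dx {v : ℝ × ℝ → ℂ} (hv : IsTest v) : XSupp (dx v) :=
  xSupp_of_hasCompactSupport (hasCompactSupport_dx hv)

lemma IsTest.xSupp_dy {v : ℝ × ℝ → ℂ} (hv : IsTest v) : XSupp (dy v) :=
  xSupp_of_hasCompactSupport (hasCompactSupport_dy hv)

/-- Integration by parts in `x` on the right part of the waveguide. -/
lemma integral_rightPart_dx {F Fx v : ℝ × ℝ → ℂ} (hF : Continuous F) (hFx : Continuous Fx)
    (hd : ∀ x y : ℝ, HasDerivAt (fun x : ℝ => F (x, y)) (Fx (x, y)) x) (hv : IsTest v) (L : ℝ) :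
    ∫ p in rightPart L, (F p * dx v p + Fx p * v p) = -∫ y, F (L, y) * v (L, y) ∂nu := by
  have i1 := continuous_integrable_rightPart hF (continuous_dx hv) hv.xSupp_dx L
  have i2 := continuous_integrable_rightPart hFx hv.1.continuous hv.xSupp L
  have i3 : Integrable (fun p => F p * dx v p + Fx p * v p) (volume.restrict (rightPart L)) :=
    i1.add i2
  rw [restrict_rightPart] at i3 ⊢
  rw [integral_prod_symm _ i3, ← integral_neg]
  congr 1
  funext y
  have hsupp : HasCompactSupport (fun x : ℝ => F (x, y) * v (x, y)) := by
    obtain ⟨R, hR⟩ := hv.xSupp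
    refine HasCompactSupport.intro (isCompact_Icc (a := -R) (b := R)) fun x hx => ?_
    have : R ≤ |x| := by
      by_contra h
      exact hx (abs_le.1 (not_le.1 h).le)
    simp [hR (x, y) this]
  have hcv := hv.1.continuous
  have hcd := continuous_dx hv
  exact integral_Ioi_of_hasDerivAt_of_hasCompactSupport (a := L) (fun x => by
    refine ((hd x y).mul (hasDerivAt_slice_x hv x y)).congr_deriv ?_
    ring) (by fun_prop) hsupp

/-- Integration by parts in `y` on the right part of the waveguide. -/
lemma integral_rightPart_dy {F Fy v : ℝ × ℝ → ℂ} (hF : Continuous F) (hFy : Continuous Fy)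
    (hd : ∀ x y : ℝ, HasDerivAt (fun y : ℝ => F (x, y)) (Fy (x, y)) y) (hv : IsTest v)
    (h0 : ∀ x, F (x, 0) * v (x, 0) = 0) (h1 : ∀ x, F (x, 1) * v (x, 1) = 0) (L : ℝ) :
    ∫ p in rightPart L, (F p * dy v p + Fy p * v p) = 0 := by
  have i1 := continuous_integrable_rightPart hF (continuous_dy hv) hv.xSupp_dy L
  have i2 := continuous_integrable_rightPart hFy hv.1.continuous hv.xSupp L
  have i3 : Integrable (fun p => F p * dy v p + Fy p * v p) (volume.restrict (rightPart L)) :=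
    i1.add i2
  rw [restrict_rightPart] at i3 ⊢
  rw [integral_prod _ i3]
  refine integral_eq_zero_of_ae (Eventually.of_forall fun x => ?_)
  have hcv := hv.1.continuous
  have hcd := continuous_dy hv
  have := intervalIntegral.integral_eq_sub_of_hasDerivAt (a := 0) (b := 1)
    (f := fun y : ℝ => F (x, y) * v (x, y))
    (f' := fun y : ℝ => F (x, y) * dy v (x, y) + Fy (x, y) * v (x, y)) (fun y _ => by
      refine ((hd x y).mul (hasDerivAt_slice_y hv x y)).congr_deriv ?_
      ring) (Continuous.intervalIntegrable (by fun_prop) _ _)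
  rw [h0, h1, sub_zero, intervalIntegral.integral_of_le zero_le_one,
    integral_Ioc_eq_integral_Ioo] at this
  exact this

section ExtSeries

variable {k : ℝ} {N : ℕ} {c μ : ℕ → ℂ} {e₀ : ℂ}

lemma continuous_extTerm (n : ℕ) (L : ℝ) : Continuous (extTerm c μ e₀ L n) := by
  unfold extTerm; fun_prop

lemma continuous_extTermX (n : ℕ) (L : ℝ) : Continuous (extTermX c μ e₀ L n) := by
  unfold extTermX; fun_prop

lemma continuous_extTermY (n : ℕ) (L : ℝ) : Continuous (extTermY c μ e₀ L n) := by
  unfold extTermY; fun_prop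

lemma hasDerivAt_extTerm_x (n : ℕ) (L x y : ℝ) :
    HasDerivAt (fun x : ℝ => extTerm c μ e₀ L n (x, y)) (extTermX c μ e₀ L n (x, y)) x := by
  unfold extTerm extTermX
  exact (hasDerivAt_exp_affine (μ n * e₀) (c n) L x).mul_const (phi n y : ℂ)

lemma hasDerivAt_extTermX_x (n : ℕ) (L x y : ℝ) :
    HasDerivAt (fun x : ℝ => extTermX c μ e₀ L n (x, y))
      ((μ n * e₀) ^ 2 * extTerm c μ e₀ L n (x, y)) x := by
  refine (((hasDerivAt_exp_affine (μ n * e₀) (c n) L x).const_mul (μ n * e₀)).mul_const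
    (phi n y : ℂ)).congr_deriv ?_
  simp only [extTerm]
  ring

lemma hasDerivAt_extTerm_y (n : ℕ) (L x y : ℝ) :
    HasDerivAt (fun y : ℝ => extTerm c μ e₀ L n (x, y)) (extTermY c μ e₀ L n (x, y)) y := by
  unfold extTerm extTermY
  exact ((hasDerivAt_phi n y).ofReal_comp).const_mul (c n * Complex.exp (μ n * e₀ * (x - L)))

lemma hasDerivAt_extTermY_y (n : ℕ) (L x y : ℝ) :
    HasDerivAt (fun y : ℝ => extTermY c μ e₀ L n (x, y))
      (-((n : ℂ) ^ 2 * (Real.pi : ℂ) ^ 2) * extTerm c μ e₀ L n (x, y)) y := by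
  refine (((hasDerivAt_dphi n y).ofReal_comp).const_mul
    (c n * Complex.exp (μ n * e₀ * (x - L)))).congr_deriv ?_
  simp only [extTerm]
  push_cast
  ring

lemma extTerm_left (n : ℕ) (L y : ℝ) : extTerm c μ e₀ L n (L, y) = c n * (phi n y : ℂ) := by
  simp [extTerm]

lemma extTermX_left (n : ℕ) (L y : ℝ) :
    extTermX c μ e₀ L n (L, y) = μ n * e₀ * (c n * (phi n y : ℂ)) := by
  simp [extTermX, mul_assoc]

/-- Green's formula for one exterior mode. -/
lemma integral_extTerm_flux (hμ : IsExponent k N μ) (he : e₀ ≠ 0) (n : ℕ) (L : ℝ)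
    {v : ℝ × ℝ → ℂ} (hv : IsTest v) :
    e₀⁻¹ * (∫ p in rightPart L, extTermX c μ e₀ L n p * dx v p) +
      e₀ * (∫ p in rightPart L, extTermY c μ e₀ L n p * dy v p) -
      (k : ℂ) ^ 2 * e₀ * (∫ p in rightPart L, extTerm c μ e₀ L n p * v p) =
      -(μ n * ∫ y, c n * (phi n y : ℂ) * v (L, y) ∂nu) := by
  have h1 := integral_rightPart_dx (continuous_extTermX (c := c) (μ := μ) (e₀ := e₀) n L)
    ((continuous_extTerm n L).const_mul ((μ n * e₀) ^ 2)) (hasDerivAt_extTermX_x n L) hv L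
  -- φ_n' vanishes on the walls, so there is no boundary term although v is free there.
  have h2 := integral_rightPart_dy (continuous_extTermY (c := c) (μ := μ) (e₀ := e₀) n L)
    ((continuous_extTerm n L).const_mul _) (hasDerivAt_extTermY_y n L) hv
    (fun x => by simp [extTermY, dphi_zero]) (fun x => by simp [extTermY, dphi_one]) L
  have ix := continuous_integrable_rightPart (continuous_extTermX (c := c) (μ := μ) (e₀ := e₀) n L)
    (continuous_dx hv) hv.xSupp_dx L
  have iy := continuous_integrable_rightPart (continuous_extTermY (c := c) (μ := μ) (e₀ := e₀) n L)
    (continuous_dy hv) hv.xSupp_dy L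
  have i0 := continuous_integrable_rightPart (continuous_extTerm (c := c) (μ := μ) (e₀ := e₀) n L)
    hv.1.continuous hv.xSupp L
  simp only [mul_assoc _ (extTerm c μ e₀ L n _) (v _)] at h1 h2
  rw [integral_add ix (i0.const_mul _), integral_const_mul] at h1
  rw [integral_add iy (i0.const_mul _), integral_const_mul] at h2
  simp only [extTermX_left] at h1
  have h3 : ∫ y, μ n * e₀ * (c n * (phi n y : ℂ)) * v (L, y) ∂nu =
      μ n * e₀ * ∫ y, c n * (phi n y : ℂ) * v (L, y) ∂nu := by
    rw [← integral_const_mul]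
    simp only [mul_assoc]
  rw [h3] at h1
  have hinv : e₀⁻¹ * e₀ = 1 := inv_mul_cancel₀ he
  -- Since e₀⁻¹(μe₀)² - e₀n²π² = -e₀k², the volume terms cancel; and e₀⁻¹·μe₀ = μ, so the boundary
  -- term no longer contains e₀.
  linear_combination e₀⁻¹ * h1 + e₀ * h2 - e₀ * (∫ p in rightPart L, extTerm c μ e₀ L n p * v p) *
    hμ.sq n + (-(μ n * ∫ y, c n * (phi n y : ℂ) * v (L, y) ∂nu) - 
      e₀ * μ n ^ 2 * (∫ p in rightPart L, extTerm c μ e₀ L n p * v p)) * hinv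

/-- Integrability of the exterior series against test functions. -/
lemma Dominated.integrable_mul {L : ℝ} {T : ℕ → ℝ × ℝ → ℂ} (hT : Dominated L T)
    {v : ℝ × ℝ → ℂ} (hv : Continuous v) (hs : XSupp v) :
    Integrable (fun p => (∑' n, T n p) * v p) (volume.restrict (rightPart L)) := by
  refine ((hT.l2Loc_zero_glue.integrable_mul hv hs).mono_measure
    (Measure.restrict_mono inter_subset_left le_rfl)).congr ?_
  refine (ae_restrict_mem (measurableSet_rightPart L)).mono fun p hp => ?_
  have : L < p.1 := hp.2
  simp [glue, this]

/-- Green's formula for the exterior series: the flux through `x = L` does not depend on the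
scaling. -/
lemma ExtData.hasSum_flux (h : ExtData k N c μ e₀) (L : ℝ) {v : ℝ × ℝ → ℂ} (hv : IsTest v) :
    HasSum (fun n => -(μ n * ∫ y, c n * (phi n y : ℂ) * v (L, y) ∂nu))
      (∫ p in rightPart L, (e₀⁻¹ * extX c μ e₀ L p * dx v p + e₀ * extY c μ e₀ L p * dy v p -
        (k : ℂ) ^ 2 * e₀ * ext c μ e₀ L p * v p)) := by
  have he : e₀ ≠ 0 := by rw [← norm_ne_zero_iff, h.norm_eq]; norm_num
  have s1 := (h.dominated_X L).hasSum_integral (continuous_dx hv) hv.xSupp_dx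
  have s2 := (h.dominated_Y L).hasSum_integral (continuous_dy hv) hv.xSupp_dy
  have s3 := (h.dominated L).hasSum_integral hv.1.continuous hv.xSupp
  have i1 := (h.dominated_X L).integrable_mul (continuous_dx hv) hv.xSupp_dx
  have i2 := (h.dominated_Y L).integrable_mul (continuous_dy hv) hv.xSupp_dy
  have i3 := (h.dominated L).integrable_mul hv.1.continuous hv.xSupp
  have := ((s1.mul_left e₀⁻¹).add (s2.mul_left e₀)).sub (s3.mul_left ((k : ℂ) ^ 2 * e₀))
  simp only [integral_extTerm_flux h.exponent he _ L hv] at this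
  have i12 : Integrable (fun p => e₀⁻¹ * ((∑' n, extTermX c μ e₀ L n p) * dx v p) +
    e₀ * ((∑' n, extTermY c μ e₀ L n p) * dy v p)) (volume.restrict (rightPart L)) :=
    (i1.const_mul _).add (i2.const_mul _)
  rw [← integral_const_mul, ← integral_const_mul, ← integral_const_mul,
    ← integral_add (i1.const_mul _) (i2.const_mul _), ← integral_sub i12 (i3.const_mul _)] at this
  simpa only [ext, extX, extY, mul_assoc] using this

/-- At ζ = 0 the series is Σ c_n φ_n, the trace on the interface, and it converges normally. -/
lemma continuous_modeSeries_zero (h : Summable fun n => ‖c n‖) :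
    Continuous (modeSeries c μ 0) := by
  unfold modeSeries
  refine continuous_tsum (u := fun n => ‖c n‖ * 2) (fun n => ?_) (h.mul_right _) fun n y => ?_
  · have := (contDiff_phi n).continuous
    fun_prop
  · rw [mul_zero, Complex.exp_zero, mul_one, norm_mul]
    gcongr
    exact norm_phi_le n y

lemma hasSum_integral_trace (h : Summable fun n => ‖c n‖) {q : ℝ → ℂ} (hq : Continuous q) :
    HasSum (fun n => ∫ y, c n * (phi n y : ℂ) * q y ∂nu) (∫ y, modeSeries c μ 0 y * q y ∂nu) := by
  obtain ⟨M, hM⟩ := isCompact_Icc.exists_bound_of_continuousOn (s := Icc (0:ℝ) 1) hq.continuousOn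
  refine hasSum_integral_of_dominated_convergence (fun n _ => ‖c n‖ * 2 * M)
    (fun n => ?_) (fun n => ?_) (Eventually.of_forall fun y => (h.mul_right _).mul_right _)
    (integrable_const _) (Eventually.of_forall fun y => ?_)
  · have := (contDiff_phi n).continuous
    exact Continuous.aestronglyMeasurable (by fun_prop)
  · refine (ae_restrict_mem measurableSet_Ioo).mono fun y hy => ?_
    rw [norm_mul, norm_mul]
    have := hM y ⟨hy.1.le, hy.2.le⟩
    gcongr
    exact norm_phi_le n y
  · refine HasSum.mul_right _ ?_
    have : Summable fun n => c n * (phi n y : ℂ) := by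
      refine Summable.of_norm_bounded (h.mul_right 2) fun n => ?_
      rw [norm_mul]
      gcongr
      exact norm_phi_le n y
    simpa only [modeSeries, mul_zero, Complex.exp_zero, mul_one] using this.hasSum

/-- The trace of the exterior series at `x = L`. -/
lemma ExtData.integral_trace (h : ExtData k N c μ e₀) (L : ℝ) {v : ℝ × ℝ → ℂ} (hv : IsTest v) :
    ∫ p in rightPart L, (ext c μ e₀ L p * dx v p + extX c μ e₀ L p * v p) =
      -∫ y, modeSeries c μ 0 y * v (L, y) ∂nu := by
  have s1 := (h.dominated_X L).hasSum_integral hv.1.continuous hv.xSupp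
  have s3 := (h.dominated L).hasSum_integral (continuous_dx hv) hv.xSupp_dx
  have i1 := (h.dominated_X L).integrable_mul hv.1.continuous hv.xSupp
  have i3 := (h.dominated L).integrable_mul (continuous_dx hv) hv.xSupp_dx
  have hs := s3.add s1
  rw [← integral_add i3 i1] at hs
  have hcv := hv.1.continuous
  refine hs.unique ?_
  refine (hasSum_integral_trace (μ := μ) h.summable_norm (q := fun y => v (L, y))
    (by fun_prop)).neg.congr_fun fun n => ?_
  have h1 := integral_rightPart_dx (continuous_extTerm (c := c) (μ := μ) (e₀ := e₀) n L)
    (continuous_extTermX n L) (hasDerivAt_extTerm_x n L) hv L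
  simp only [extTerm_left] at h1
  rw [← h1, integral_add]
  · exact continuous_integrable_rightPart (continuous_extTerm n L) (continuous_dx hv) hv.xSupp_dx L
  · exact continuous_integrable_rightPart (continuous_extTermX n L) hcv hv.xSupp L

lemma eq_zero_of_notMem_strip {v : ℝ × ℝ → ℂ} (hs : tsupport v ⊆ strip) {p : ℝ × ℝ}
    (hp : p ∉ strip) : v p = 0 :=
  image_eq_zero_of_notMem_tsupport fun h => hp (hs h)

/-- The weak `y`-derivative of the exterior series. -/
lemma ExtData.integral_dy (h : ExtData k N c μ e₀) (L : ℝ) {v : ℝ × ℝ → ℂ} (hv : IsTest v)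
    (hs : tsupport v ⊆ strip) :
    ∫ p in rightPart L, (ext c μ e₀ L p * dy v p + extY c μ e₀ L p * v p) = 0 := by
  have s1 := (h.dominated_Y L).hasSum_integral hv.1.continuous hv.xSupp
  have s3 := (h.dominated L).hasSum_integral (continuous_dy hv) hv.xSupp_dy
  have i1 := (h.dominated_Y L).integrable_mul hv.1.continuous hv.xSupp
  have i3 := (h.dominated L).integrable_mul (continuous_dy hv) hv.xSupp_dy
  have hs' := s3.add s1
  rw [← integral_add i3 i1] at hs'
  refine hs'.unique (hasSum_zero.congr_fun fun n => ?_)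
  rw [← integral_add]
  · exact integral_rightPart_dy (continuous_extTerm (c := c) (μ := μ) (e₀ := e₀) n L)
      (continuous_extTermY n L) (hasDerivAt_extTerm_y n L) hv
      (fun x => by rw [eq_zero_of_notMem_strip hs (by simp [strip]), mul_zero])
      (fun x => by rw [eq_zero_of_notMem_strip hs (by simp [strip]), mul_zero]) L
  · exact continuous_integrable_rightPart (continuous_extTerm n L) (continuous_dy hv) hv.xSupp_dy L
  · exact continuous_integrable_rightPart (continuous_extTermY n L) hv.1.continuous hv.xSupp L

end ExtSeries

/-! ### Uniqueness of weak gradients and of cosine series -/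

lemma isOpen_rightPart (L : ℝ) : IsOpen (rightPart L) :=
  isOpen_strip.inter (isOpen_lt continuous_const continuous_fst)

lemma L2Loc.locallyIntegrableOn {f : ℝ × ℝ → ℂ} (hf : L2Loc f) {U : Set (ℝ × ℝ)} (hU : IsOpen U)
    (hs : U ⊆ strip) : LocallyIntegrableOn f U := by
  rw [locallyIntegrableOn_iff hU.isLocallyClosed]
  intro K hKU hK
  obtain ⟨R, hR⟩ := hK.isBounded.subset_closedBall 0
  have hsub : K ⊆ strip ∩ {p | |p.1| < R + 1} := fun p hp => by
    refine ⟨hs (hKU hp), ?_⟩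
    have h1 := hR hp
    rw [mem_closedBall_zero_iff] at h1
    have h2 := (norm_fst_le p).trans h1
    rw [Real.norm_eq_abs] at h2
    show |p.1| < R + 1
    linarith
  have : IsFiniteMeasure ((volume : Measure (ℝ × ℝ)).restrict K) :=
    ⟨by rw [Measure.restrict_apply_univ]; exact hK.measure_lt_top⟩
  exact ((hf (R + 1)).mono_measure (Measure.restrict_mono hsub le_rfl)).integrable one_le_two

/-- The fundamental lemma of the calculus of variations in an open part of the waveguide. -/
lemma ae_eq_of_forall_isTest {f g : ℝ × ℝ → ℂ} (hf : L2Loc f) (hg : L2Loc g) {U : Set (ℝ × ℝ)}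
    (hU : IsOpen U) (hs : U ⊆ strip)
    (h : ∀ v, IsTest v → tsupport v ⊆ U → ∫ p in strip, f p * v p = ∫ p in strip, g p * v p) :
    f =ᵐ[volume.restrict U] g := by
  have hd := (hf.locallyIntegrableOn hU hs).sub (hg.locallyIntegrableOn hU hs)
  have := hU.ae_eq_zero_of_integral_contDiff_smul_eq_zero hd fun ψ hψ hc hsupp => by
    have hv : IsTest fun p => (ψ p : ℂ) := by
      refine ⟨Complex.ofRealCLM.contDiff.comp hψ, hc.comp_left (g := fun r : ℝ => (r : ℂ)) (by simp)⟩
    have hsv : tsupport (fun p => (ψ p : ℂ)) ⊆ U := by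
      refine (closure_mono ?_).trans hsupp
      intro p hp h0
      simp [h0] at hp
    have h1 := h _ hv hsv
    have i1 := hf.integrable_mul hv.1.continuous hv.xSupp
    have i2 := hg.integrable_mul hv.1.continuous hv.xSupp
    rw [← sub_eq_zero, ← integral_sub i1 i2] at h1
    rw [← h1, ← setIntegral_eq_integral_of_forall_compl_eq_zero (s := strip)]
    · congr 1
      funext p
      simp only [Pi.sub_apply, Complex.real_smul]
      ring
    · intro p hp
      have : ψ p = 0 := image_eq_zero_of_notMem_tsupport fun hh => hp (hs (hsupp hh))
      simp [this]
  refine (ae_restrict_iff' hU.measurableSet).2 ?_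
  filter_upwards [this] with p hp hpU
  exact sub_eq_zero.1 (hp hpU)

/-- The weak gradient is unique. -/
lemma IsH1Loc.grad_unique {w wx wy wx' wy' : ℝ × ℝ → ℂ} (h : IsH1Loc w wx wy)
    (h' : IsH1Loc w wx' wy') :
    wx =ᵐ[volume.restrict strip] wx' ∧ wy =ᵐ[volume.restrict strip] wy' := by
  constructor
  · refine ae_eq_of_forall_isTest h.l2Loc_x h'.l2Loc_x isOpen_strip Subset.rfl fun v hv hs => ?_
    exact neg_injective ((h.grad v hv hs).1.symm.trans (h'.grad v hv hs).1)
  · refine ae_eq_of_forall_isTest h.l2Loc_y h'.l2Loc_y isOpen_strip Subset.rfl fun v hv hs => ?_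
    exact neg_injective ((h.grad v hv hs).2.symm.trans (h'.grad v hv hs).2)

/-- Termwise integration, after which orthonormality leaves a single term. -/
lemma modalCoeff_tsum_phi {A : ℕ → ℂ} (hA : Summable fun n => ‖A n‖) (n : ℕ) :
    modalCoeff (fun y => ∑' m, A m * (phi m y : ℂ)) n = A n := by
  have h := hasSum_integral_trace (μ := fun _ => 0) hA (q := fun y => (phi n y : ℂ))
    (by have := (contDiff_phi n).continuous; fun_prop)
  simp only [modeSeries, mul_zero, Complex.exp_zero, mul_one] at h
  refine h.unique ?_
  have : ∀ m, ∫ y, A m * (phi m y : ℂ) * (phi n y : ℂ) ∂nu = if m = n then A n else 0 := by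
    intro m
    have h2 : ∫ y, (phi m y : ℂ) * (phi n y : ℂ) ∂nu = ((if m = n then 1 else 0 : ℝ) : ℂ) := by
      rw [← integral_phi_mul_phi, ← integral_complex_ofReal]
      simp
    simp only [mul_assoc]
    rw [integral_const_mul, h2]
    split_ifs with hm
    · simp [hm]
    · simp
  simp only [this]
  exact hasSum_ite_eq n _

lemma continuous_tsum_phi {A : ℕ → ℂ} (hA : Summable fun n => ‖A n‖) :
    Continuous fun y : ℝ => ∑' m, A m * (phi m y : ℂ) := by
  have h := continuous_modeSeries_zero (μ := fun _ => 0) hA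
  unfold modeSeries at h
  simpa only [mul_zero, Complex.exp_zero, mul_one] using h

lemma integrable_nu_of_continuous {f : ℝ → ℂ} (hf : Continuous f) : Integrable f nu :=
  (hf.integrableOn_Icc (a := 0) (b := 1)).mono_set Ioo_subset_Icc_self

/-- At y = 0 every φ_n equals its normalisation constant, which is at least 1, so absolute
convergence at that point gives back the summability of the coefficients. -/
lemma summable_of_summable_mul_phi {A : ℕ → ℂ}
    (h : Summable fun n => ‖A n * (phi n 0 : ℂ)‖) : Summable fun n => ‖A n‖ := by
  refine Summable.of_nonneg_of_le (fun _ => norm_nonneg _) (fun n => ?_) h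
  rw [norm_mul, Complex.norm_real, phi_eq]
  refine le_mul_of_one_le_right (norm_nonneg _) ?_
  have : 1 ≤ amp n := by
    unfold amp
    split_ifs
    · rfl
    · exact Real.one_le_sqrt.2 one_le_two
  simp only [mul_zero, Real.cos_zero, mul_one]
  exact this.trans (le_abs_self _)

/-! ### Modal expansion of a solution beyond the interface -/

/-- On the right of `x = L`, the function and its weak gradient are given by the exterior
series. -/
structure ExtForm (k : ℝ) (N : ℕ) (c μ : ℕ → ℂ) (e₀ : ℂ) (L : ℝ) (w wx wy : ℝ × ℝ → ℂ) :
    Prop where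
  data : ExtData k N c μ e₀
  eq : w =ᵐ[volume.restrict (rightPart L)] ext c μ e₀ L
  eq_x : wx =ᵐ[volume.restrict (rightPart L)] extX c μ e₀ L
  eq_y : wy =ᵐ[volume.restrict (rightPart L)] extY c μ e₀ L

/-- A function whose modal coefficients are those of a normally convergent series. -/
lemma ae_eq_series_of_coef {L : ℝ} {f : ℝ × ℝ → ℂ} (hf : L2Loc f) {A : ℕ → ℝ → ℂ}
    (hd : Dominated L fun n p => A n p.1 * (phi n p.2 : ℂ))
    (h : ∀ n, ∀ᵐ x : ℝ, x ∈ Ioi L → coef f n x = A n x) :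
    f =ᵐ[volume.restrict (rightPart L)] fun p => ∑' n, A n p.1 * (phi n p.2 : ℂ) := by
  have hA : ∀ x, L < x → Summable fun n => ‖A n x‖ := fun x hx =>
    summable_of_summable_mul_phi (hd.summable (p := (x, 0)) hx)
  have hm : AEStronglyMeasurable (fun p : ℝ × ℝ => ∑' n, A n p.1 * (phi n p.2 : ℂ))
      (volume.restrict (rightPart L)) := by
    refine hd.measurable.aestronglyMeasurable.congr ?_
    refine (ae_restrict_mem (measurableSet_rightPart L)).mono fun p hp => ?_
    have : L < p.1 := hp.2
    simp [this]
  have hfm : AEStronglyMeasurable f (volume.restrict (rightPart L)) :=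
    hf.aestronglyMeasurable.mono_measure (Measure.restrict_mono inter_subset_left le_rfl)
  rw [restrict_rightPart] at hm hfm ⊢
  refine ae_eq_of_coef_eq hfm hm ?_ ?_ fun n => ?_
  · exact (ae_restrict_of_ae hf.memLp_slice).mono fun x hx => hx.integrable one_le_two
  · exact (ae_restrict_mem measurableSet_Ioi).mono fun x hx =>
      integrable_nu_of_continuous (continuous_tsum_phi (hA x hx))
  · filter_upwards [ae_restrict_of_ae (h n), ae_restrict_mem measurableSet_Ioi] with x hx hxL
    rw [hx hxL]
    exact (modalCoeff_tsum_phi (hA x hxL) n).symm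

/-- Modal expansion of a solution on the right of `x = L`. -/
theorem ScaledSol.extForm {γ : ℝ × ℝ → ℝ} {L : ℝ} (hγ : IsMedium γ L) (hL : 0 < L)
    {B : ℝ → ℂ} (hB : IsPhase B) {k : ℝ} {N : ℕ} (hk0 : 0 < k) (hk1 : N * Real.pi < k)
    (hk : k < (N + 1) * Real.pi) {w wx wy : ℝ × ℝ → ℂ}
    (h : ScaledSol γ B k w wx wy) {e₀ : ℂ} (he : 0 < e₀.re) (hnorm : ‖e₀‖ = 1)
    (hB1 : ∀ x, 0 < x → x < L → B x = 1) (hB2 : ∀ x, L ≤ x → B x = e₀⁻¹) {c μ : ℕ → ℂ}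
    (hμ : IsExponent k N μ)
    (hc : ∀ n, ∀ᵐ x : ℝ, x ∈ Ioi L → coef w n x = c n * Complex.exp (μ n * e₀ * (x - L))) :
    ExtForm k N c μ e₀ L w wx wy := by
  have he₀ : e₀ ≠ 0 := by rw [← norm_ne_zero_iff, hnorm]; norm_num
  have hdata : ExtData k N c μ e₀ := by
    refine ⟨hk0, hk, hμ, summable_ampWeight hk0 hk (h.summable_amplitudes hγ hL hB hk0 hk1 hk he₀
      hB1 hB2 fun n hn => ?_), he, hnorm⟩
    filter_upwards [hc n] with x hx hxL
    rw [hx hxL, hμ.tail n hn]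
    congr 2
    ring
  have e1 : w =ᵐ[volume.restrict (rightPart L)] ext c μ e₀ L :=
    ae_eq_series_of_coef h.h1.l2Loc (A := fun n x => c n * Complex.exp (μ n * e₀ * (x - L)))
      (hdata.dominated L) hc
  have e2 : wx =ᵐ[volume.restrict (rightPart L)] extX c μ e₀ L :=
    ae_eq_series_of_coef h.h1.l2Loc_x
      (A := fun n x => μ n * e₀ * (c n * Complex.exp (μ n * e₀ * (x - L))))
      (hdata.dominated_X L) fun n =>
        ae_eq_of_weak_deriv_exp ((h.h1.l2Loc_x.locallyIntegrable_coef n).locallyIntegrableOn _)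
          (fun ψ hψ _ => h.h1.integral_coef_mul_deriv n hψ) (hc n)
  refine ⟨hdata, e1, e2, ?_⟩
  -- `wy` would naturally expand on sines rather than on the φ_n. It is identified instead by
  -- uniqueness of the weak y-derivative, w being already known as a series.
  have hY : L2Loc (glue L (fun _ => 0) (extY c μ e₀ L)) := (hdata.dominated_Y L).l2Loc_zero_glue
  have hgl : glue L (fun _ => 0) (extY c μ e₀ L) =ᵐ[volume.restrict (rightPart L)]
      extY c μ e₀ L := (ae_restrict_mem (measurableSet_rightPart L)).mono fun p hp => by
    have : L < p.1 := hp.2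
    simp [glue, this]
  refine (ae_eq_of_forall_isTest h.h1.l2Loc_y hY (isOpen_rightPart L) inter_subset_left
    fun v hv hs => ?_).trans hgl
  have hs' : tsupport v ⊆ strip := hs.trans inter_subset_left
  have hred : ∀ f : ℝ × ℝ → ℂ, (∀ p, p ∉ rightPart L → f p = 0) →
      ∫ p in strip, f p = ∫ p in rightPart L, f p := fun f hf => by
    rw [setIntegral_eq_integral_of_forall_compl_eq_zero fun p hp => hf p fun hh => hp hh.1,
      setIntegral_eq_integral_of_forall_compl_eq_zero hf]
  have hv0 : ∀ p, p ∉ rightPart L → v p = 0 := fun p hp =>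
    image_eq_zero_of_notMem_tsupport fun hh => hp (hs hh)
  have hdv0 : ∀ p, p ∉ rightPart L → dy v p = 0 := fun p hp => by
    have : fderiv ℝ v p = 0 := image_eq_zero_of_notMem_tsupport fun hh =>
      hp (hs (tsupport_fderiv_subset ℝ hh))
    simp [dy, this]
  have g1 := (h.h1.grad v hv hs').2
  have g2 := hdata.integral_dy L hv hs'
  have i1 := (hdata.dominated L).integrable_mul (continuous_dy hv) hv.xSupp_dy
  have i2 := (hdata.dominated_Y L).integrable_mul hv.1.continuous hv.xSupp
  have g3 := integral_add i1 i2
  rw [hred _ fun p hp => by rw [hdv0 p hp, mul_zero]] at g1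
  rw [hred (fun p => glue L (fun _ => 0) (extY c μ e₀ L) p * v p)
    fun p hp => by rw [hv0 p hp, mul_zero]]
  have g4 : ∫ p in rightPart L, w p * dy v p = ∫ p in rightPart L, ext c μ e₀ L p * dy v p :=
    integral_congr_ae (e1.mono fun p hp => by simp only [hp])
  have g5 : ∫ p in rightPart L, glue L (fun _ => 0) (extY c μ e₀ L) p * v p =
    ∫ p in rightPart L, extY c μ e₀ L p * v p :=
    integral_congr_ae (hgl.mono fun p hp => by simp only [hp])
  have g6 : ∫ p in rightPart L, (ext c μ e₀ L p * dy v p + extY c μ e₀ L p * v p) =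
    (∫ p in rightPart L, ext c μ e₀ L p * dy v p) + ∫ p in rightPart L, extY c μ e₀ L p * v p := g3
  rw [g6] at g2
  rw [g4] at g1
  rw [g5]
  linear_combination g1 - g2

/-! ### Gluing across the interface and change of scaling -/

/-- The part of the waveguide on the left of `x = L`. -/
def leftPart (L : ℝ) : Set (ℝ × ℝ) := strip ∩ {p | p.1 ≤ L}

lemma measurableSet_leftPart (L : ℝ) : MeasurableSet (leftPart L) :=
  measurableSet_strip.inter (measurableSet_le measurable_fst measurable_const)

lemma integral_strip_split {f : ℝ × ℝ → ℂ} (hf : Integrable f (volume.restrict strip)) (L : ℝ) :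
    ∫ p in strip, f p = (∫ p in leftPart L, f p) + ∫ p in rightPart L, f p := by
  have h : strip = leftPart L ∪ rightPart L := by
    rw [leftPart, rightPart, ← inter_union_distrib_left]
    refine (inter_eq_left.2 fun p _ => ?_).symm
    exact le_or_gt p.1 L
  have hd : Disjoint (leftPart L) (rightPart L) :=
    disjoint_left.2 fun p h1 h2 => absurd (show L < p.1 from h2.2) (not_lt.2 h1.2)
  have hi : IntegrableOn f strip := hf
  conv_lhs => rw [h]
  exact setIntegral_union hd (measurableSet_rightPart L) (hi.mono_set inter_subset_left)
    (hi.mono_set inter_subset_left)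

/-- Two integrals that agree on both sides of `x = L`. -/
lemma integral_strip_eq {f g : ℝ × ℝ → ℂ} (hf : Integrable f (volume.restrict strip))
    (hg : Integrable g (volume.restrict strip)) (L : ℝ)
    (hl : ∀ᵐ p ∂(volume.restrict (leftPart L)), f p = g p)
    (hr : ∫ p in rightPart L, f p = ∫ p in rightPart L, g p) :
    ∫ p in strip, f p = ∫ p in strip, g p := by
  rw [integral_strip_split hf L, integral_strip_split hg L, hr, integral_congr_ae hl]

lemma ae_fst_ne (L : ℝ) : ∀ᵐ p : ℝ × ℝ, p.1 ≠ L :=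
  Measure.quasiMeasurePreserving_fst.ae (p := fun x : ℝ => x ≠ L) (by simp [ae_iff])

lemma glue_ae_left (L : ℝ) (w F : ℝ × ℝ → ℂ) :
    ∀ᵐ p ∂(volume.restrict (leftPart L)), glue L w F p = w p :=
  (ae_restrict_mem (measurableSet_leftPart L)).mono fun p hp => by
    have : ¬ L < p.1 := not_lt.2 hp.2
    simp [glue, this]

lemma glue_ae_right (L : ℝ) (w F : ℝ × ℝ → ℂ) :
    ∀ᵐ p ∂(volume.restrict (rightPart L)), glue L w F p = F p :=
  (ae_restrict_mem (measurableSet_rightPart L)).mono fun p hp => by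
    have : L < p.1 := hp.2
    simp [glue, this]

lemma integrable_weak {γ : ℝ × ℝ → ℝ} {L : ℝ} (hγ : IsMedium γ L) {B : ℝ → ℂ} (hB : IsPhase B)
    (k : ℝ) {w wx wy v : ℝ × ℝ → ℂ} (hw : L2Loc w) (hwx : L2Loc wx) (hwy : L2Loc wy)
    (hv : IsTest v) :
    Integrable (fun p => B p.1 * wx p * dx v p + (B p.1)⁻¹ * wy p * dy v p
      - (k : ℂ) ^ 2 * (γ p : ℂ) * (B p.1)⁻¹ * w p * v p) (volume.restrict strip) := by
  have i1 := (hB.l2Loc_mul hwx).integrable_mul (continuous_dx hv) hv.xSupp_dx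
  have i2 := (hB.inv.l2Loc_mul hwy).integrable_mul (continuous_dy hv) hv.xSupp_dy
  have i3 := ((hγ.l2Loc_mul (hB.inv.l2Loc_mul hw)).integrable_mul hv.1.continuous
    hv.xSupp).const_mul ((k : ℂ) ^ 2)
  refine ((i1.add i2).sub i3).congr (Eventually.of_forall fun p => ?_)
  simp only [Pi.add_apply, Pi.sub_apply]
  ring

/-- Replacing the scaled exterior series by the unscaled one gives a solution of the problem that
is not scaled on the right. -/
theorem ScaledSol.unscale {γ : ℝ × ℝ → ℝ} {L : ℝ} (hγ : IsMedium γ L)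
    {B : ℝ → ℂ} (hB : IsPhase B) {k : ℝ} {N : ℕ} {w wx wy : ℝ × ℝ → ℂ}
    (h : ScaledSol γ B k w wx wy) {e₀ : ℂ} (hB2 : ∀ x, L ≤ x → B x = e₀⁻¹) {c μ : ℕ → ℂ}
    (hγ1 : ∀ p ∈ rightPart L, γ p = 1) (hE : ExtForm k N c μ e₀ L w wx wy) :
    ScaledSol γ (fun x => if L ≤ x then 1 else B x) k (glue L w (ext c μ 1 L))
      (glue L wx (extX c μ 1 L)) (glue L wy (extY c μ 1 L)) := by
  have hD := hE.data
  have hD1 : ExtData k N c μ 1 := ⟨hD.pos, hD.lt, hD.exponent, hD.summable, by simp, by simp⟩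
  have hw := h.h1.l2Loc
  have hwx := h.h1.l2Loc_x
  have hwy := h.h1.l2Loc_y
  have gw : L2Loc (glue L w (ext c μ 1 L)) := (hD1.dominated L).l2Loc_glue hw
  have gwx : L2Loc (glue L wx (extX c μ 1 L)) := (hD1.dominated_X L).l2Loc_glue hwx
  have gwy : L2Loc (glue L wy (extY c μ 1 L)) := (hD1.dominated_Y L).l2Loc_glue hwy
  have lw := glue_ae_left L w (ext c μ 1 L)
  have lwx := glue_ae_left L wx (extX c μ 1 L)
  have lwy := glue_ae_left L wy (extY c μ 1 L)
  have rw' := glue_ae_right L w (ext c μ 1 L)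
  have rwx := glue_ae_right L wx (extX c μ 1 L)
  have rwy := glue_ae_right L wy (extY c μ 1 L)
  have hB' : IsPhase fun x => if L ≤ x then 1 else B x :=
    ⟨Measurable.ite measurableSet_Ici measurable_const hB.meas, fun x => by
      by_cases hx : L ≤ x <;> simp [hx, hB.norm]⟩
  refine ⟨⟨gw, gwx, gwy, fun v hv hs => ⟨?_, ?_⟩⟩, fun v hv => ?_⟩
  · have i1 := gw.integrable_mul (continuous_dx hv) hv.xSupp_dx
    have i2 := gwx.integrable_mul hv.1.continuous hv.xSupp
    have j1 := hw.integrable_mul (continuous_dx hv) hv.xSupp_dx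
    have j2 := hwx.integrable_mul hv.1.continuous hv.xSupp
    rw [eq_neg_iff_add_eq_zero, ← integral_add i1 i2]
    have h0 := (h.h1.grad v hv hs).1
    rw [eq_neg_iff_add_eq_zero, ← integral_add j1 j2] at h0
    rw [← h0]
    refine integral_strip_eq (i1.add i2) (j1.add j2) L ?_ ?_
    · filter_upwards [lw, lwx] with p h1 h2
      rw [h1, h2]
    -- Both exterior integrals equal minus the trace Σ c_nφ_n tested on x = L, which does not
    -- involve the direction of scaling.
    · trans ∫ p in rightPart L, (ext c μ 1 L p * dx v p + extX c μ 1 L p * v p)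
      · refine integral_congr_ae ?_
        filter_upwards [rw', rwx] with p h1 h2
        rw [h1, h2]
      · rw [hD1.integral_trace L hv, ← hD.integral_trace L hv]
        refine integral_congr_ae ?_
        filter_upwards [hE.eq, hE.eq_x] with p h1 h2
        rw [h1, h2]
  · have i1 := gw.integrable_mul (continuous_dy hv) hv.xSupp_dy
    have i2 := gwy.integrable_mul hv.1.continuous hv.xSupp
    have j1 := hw.integrable_mul (continuous_dy hv) hv.xSupp_dy
    have j2 := hwy.integrable_mul hv.1.continuous hv.xSupp
    rw [eq_neg_iff_add_eq_zero, ← integral_add i1 i2]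
    have h0 := (h.h1.grad v hv hs).2
    rw [eq_neg_iff_add_eq_zero, ← integral_add j1 j2] at h0
    rw [← h0]
    refine integral_strip_eq (i1.add i2) (j1.add j2) L ?_ ?_
    · filter_upwards [lw, lwy] with p h1 h2
      rw [h1, h2]
    · trans ∫ p in rightPart L, (ext c μ 1 L p * dy v p + extY c μ 1 L p * v p)
      · refine integral_congr_ae ?_
        filter_upwards [rw', rwy] with p h1 h2
        rw [h1, h2]
      · rw [hD1.integral_dy L hv hs, ← hD.integral_dy L hv hs]
        refine integral_congr_ae ?_
        filter_upwards [hE.eq, hE.eq_y] with p h1 h2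
        rw [h1, h2]
  · rw [← h.weak v hv]
    refine integral_strip_eq (integrable_weak hγ hB' k gw gwx gwy hv)
      (integrable_weak hγ hB k hw hwx hwy hv) L ?_ ?_
    · filter_upwards [lw, lwx, lwy, ae_restrict_of_ae (ae_fst_ne L),
        ae_restrict_mem (measurableSet_leftPart L)] with p h1 h2 h3 h4 h5
      have : ¬ L ≤ p.1 := not_le.2 (lt_of_le_of_ne h5.2 h4)
      rw [h1, h2, h3, if_neg this]
    -- Equal fluxes: the same series of boundary terms sums to both exterior integrals, the scaled
    -- one and the unscaled one.
    · have hu := (hD.hasSum_flux L hv).unique (hD1.hasSum_flux L hv)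
      trans ∫ p in rightPart L, ((1:ℂ)⁻¹ * extX c μ 1 L p * dx v p + 1 * extY c μ 1 L p * dy v p -
        (k : ℂ) ^ 2 * 1 * ext c μ 1 L p * v p)
      · refine integral_congr_ae ?_
        filter_upwards [rw', rwx, rwy, ae_restrict_mem (measurableSet_rightPart L)]
          with p h1 h2 h3 h4
        have : L ≤ p.1 := le_of_lt h4.2
        rw [h1, h2, h3, if_pos this, hγ1 p h4]
        simp
      · rw [← hu]
        refine integral_congr_ae ?_
        filter_upwards [hE.eq, hE.eq_x, hE.eq_y, ae_restrict_mem (measurableSet_rightPart L)]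
          with p h1 h2 h3 h4
        rw [h1, h2, h3, hB2 p.1 (le_of_lt h4.2), hγ1 p h4]
        simp

/-! ### Reflection -/

/-- The reflection `(x, y) ↦ (-x, y)`. -/
def refl (p : ℝ × ℝ) : ℝ × ℝ := (-p.1, p.2)

lemma refl_refl (p : ℝ × ℝ) : refl (refl p) = p := by simp [refl]

lemma contDiff_refl : ContDiff ℝ ∞ refl := contDiff_fst.neg.prodMk contDiff_snd

def reflHomeomorph : ℝ × ℝ ≃ₜ ℝ × ℝ where
  toFun := refl
  invFun := refl
  left_inv := refl_refl
  right_inv := refl_refl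
  continuous_toFun := contDiff_refl.continuous
  continuous_invFun := contDiff_refl.continuous

lemma measurePreserving_refl : MeasurePreserving refl (volume : Measure (ℝ × ℝ)) volume :=
  (Measure.measurePreserving_neg (volume : Measure ℝ)).prod (MeasurePreserving.id volume)

lemma measurableEmbedding_refl : MeasurableEmbedding refl :=
  reflHomeomorph.measurableEmbedding

lemma refl_mem_strip {p : ℝ × ℝ} : refl p ∈ strip ↔ p ∈ strip := Iff.rfl

lemma measurePreserving_refl_restrict (s : Set (ℝ × ℝ)) :
    MeasurePreserving refl (volume.restrict (refl ⁻¹' s)) (volume.restrict s) :=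
  measurePreserving_refl.restrict_preimage_emb measurableEmbedding_refl s

lemma integral_strip_refl (f : ℝ × ℝ → ℂ) : ∫ p in strip, f (refl p) = ∫ p in strip, f p :=
  measurePreserving_refl.setIntegral_preimage_emb measurableEmbedding_refl f strip

lemma ae_strip_refl {P : ℝ × ℝ → Prop} (h : ∀ᵐ p ∂(volume.restrict strip), P p) :
    ∀ᵐ p ∂(volume.restrict strip), P (refl p) :=
  (measurePreserving_refl_restrict strip).quasiMeasurePreserving.ae h

lemma L2Loc.reflect {f : ℝ × ℝ → ℂ} (hf : L2Loc f) : L2Loc fun p => f (refl p) := fun r => by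
  have h := (hf r).comp_measurePreserving (measurePreserving_refl_restrict _)
  have : Waveguide.refl ⁻¹' (strip ∩ {p | |p.1| < r}) = strip ∩ {p | |p.1| < r} := by
    ext p
    simp [Waveguide.refl, strip]
  rwa [this] at h

lemma IsTest.reflect {v : ℝ × ℝ → ℂ} (hv : IsTest v) : IsTest fun p => v (refl p) :=
  ⟨hv.1.comp contDiff_refl, hv.2.comp_homeomorph reflHomeomorph⟩

lemma hasFDerivAt_refl (p : ℝ × ℝ) : HasFDerivAt refl
    ((-ContinuousLinearMap.fst ℝ ℝ ℝ).prod (ContinuousLinearMap.snd ℝ ℝ ℝ)) p :=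
  hasFDerivAt_fst.neg.prodMk hasFDerivAt_snd

lemma dx_refl {v : ℝ × ℝ → ℂ} (hv : IsTest v) (p : ℝ × ℝ) :
    dx (fun p => v (refl p)) p = -dx v (refl p) := by
  have h := ((hv.1.differentiable (by simp)) (refl p)).hasFDerivAt.comp p (hasFDerivAt_refl p)
  have e : ((-1, 0) : ℝ × ℝ) = -(1, 0) := by simp
  have := congrArg (fun A : ℝ × ℝ →L[ℝ] ℂ => A (1, 0)) h.fderiv
  simp only [Function.comp_def] at this
  simp only [dx, this]
  simp [e, -Prod.neg_mk]

lemma dy_refl {v : ℝ × ℝ → ℂ} (hv : IsTest v) (p : ℝ × ℝ) :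
    dy (fun p => v (refl p)) p = dy v (refl p) := by
  have h := ((hv.1.differentiable (by simp)) (refl p)).hasFDerivAt.comp p (hasFDerivAt_refl p)
  have := congrArg (fun A : ℝ × ℝ →L[ℝ] ℂ => A (0, 1)) h.fderiv
  simp only [Function.comp_def] at this
  simp only [dy, this]
  simp

lemma IsH1Loc.reflect {w wx wy : ℝ × ℝ → ℂ} (h : IsH1Loc w wx wy) :
    IsH1Loc (fun p => w (refl p)) (fun p => -wx (refl p)) (fun p => wy (refl p)) := by
  refine ⟨h.l2Loc.reflect, fun r => (h.l2Loc_x.reflect r).neg, h.l2Loc_y.reflect, fun v hv hs => ?_⟩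
  have hs' : tsupport (fun p => v (Waveguide.refl p)) ⊆ strip := by
    intro p hp
    have := tsupport_comp_subset_preimage v contDiff_refl.continuous hp
    exact refl_mem_strip.1 (hs this)
  have h0 := h.grad _ hv.reflect hs'
  constructor
  · rw [← integral_strip_refl, ← integral_strip_refl fun p => -wx (Waveguide.refl p) * v p]
    simp only [refl_refl]
    have := h0.1
    simp only [dx_refl hv, mul_neg, integral_neg] at this
    simp only [neg_mul, integral_neg]
    linear_combination -this
  · rw [← integral_strip_refl, ← integral_strip_refl fun p => wy (Waveguide.refl p) * v p]
    simp only [refl_refl]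
    have := h0.2
    simpa only [dy_refl hv] using this

lemma ScaledSol.reflect {γ : ℝ × ℝ → ℝ} {B : ℝ → ℂ} {k : ℝ} {w wx wy : ℝ × ℝ → ℂ}
    (h : ScaledSol γ B k w wx wy) :
    ScaledSol (fun p => γ (refl p)) (fun x => B (-x)) k (fun p => w (refl p))
      (fun p => -wx (refl p)) (fun p => wy (refl p)) := by
  refine ⟨h.h1.reflect, fun v hv => ?_⟩
  rw [← integral_strip_refl, ← h.weak _ hv.reflect]
  congr 1
  funext p
  simp only [refl_refl, dx_refl hv, dy_refl hv]
  simp only [Waveguide.refl, neg_neg]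
  ring

lemma IsPhase.reflect {B : ℝ → ℂ} (hB : IsPhase B) : IsPhase fun x => B (-x) :=
  ⟨hB.meas.comp measurable_neg, fun _ => hB.norm _⟩

lemma IsMedium.reflect {γ : ℝ × ℝ → ℝ} {L : ℝ} (hγ : IsMedium γ L) :
    IsMedium (fun p => γ (refl p)) L where
  meas := by
    have h := hγ.meas.comp_quasiMeasurePreserving
      (measurePreserving_refl_restrict strip).quasiMeasurePreserving
    exact h
  bdd := by
    obtain ⟨M, hM⟩ := hγ.bdd
    exact ⟨M, fun p hp => hM _ hp⟩
  one p hp hL := hγ.one _ hp (by simpa [Waveguide.refl] using hL)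

/-! ### From an eigenpair to its unscaled solution -/

/-- Integration by parts in the whole plane: φ vanishes outside the strip, while v need not. Smooth
test functions, free on the walls, thus become admissible in `OpB`. -/
lemma hasWeakGrad_of_isTest {v : ℝ × ℝ → ℂ} (hv : IsTest v) : HasWeakGrad v (dx v) (dy v) := by
  intro φ hφ hs
  have hred : ∀ f : ℝ × ℝ → ℂ, (∀ p, p ∉ strip → f p = 0) → ∫ p in strip, f p = ∫ p, f p :=
    fun f hf => setIntegral_eq_integral_of_forall_compl_eq_zero hf
  have hφ0 : ∀ p, p ∉ strip → φ p = 0 := fun p hp => eq_zero_of_notMem_strip hs hp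
  have hdφ0 : ∀ p, p ∉ strip → fderiv ℝ φ p = 0 := fun p hp =>
    image_eq_zero_of_notMem_tsupport fun hh => hp (hs (tsupport_fderiv_subset ℝ hh))
  have hcv := hv.1.continuous
  have hcφ := hφ.1.continuous
  have key : ∀ a : ℝ × ℝ, ∫ p, v p * fderiv ℝ φ p a = -∫ p, fderiv ℝ v p a * φ p := fun a =>
    integral_mul_fderiv_eq_neg_fderiv_mul_of_integrable
      (((((hv.1.continuous_fderiv (by simp)).clm_apply continuous_const).mul
        hcφ)).integrable_of_hasCompactSupport hφ.2.mul_left)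
      ((hcv.mul ((hφ.1.continuous_fderiv (by simp)).clm_apply
        continuous_const)).integrable_of_hasCompactSupport hv.2.mul_right)
      ((hcv.mul hcφ).integrable_of_hasCompactSupport hv.2.mul_right)
      (fun p _ => hv.1.differentiable (by simp) p) (fun p _ => hφ.1.differentiable (by simp) p)
  constructor
  · rw [hred _ fun p hp => by simp [dx, hdφ0 p hp], hred _ fun p hp => by simp [hφ0 p hp]]
    exact key (1, 0)
  · rw [hred _ fun p hp => by simp [dy, hdφ0 p hp], hred _ fun p hp => by simp [hφ0 p hp]]
    exact key (0, 1)

lemma isH1_of_isTest {v : ℝ × ℝ → ℂ} (hv : IsTest v) : IsH1 v (dx v) (dy v) where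
  memLp := (hv.1.continuous.memLp_of_hasCompactSupport hv.2).restrict _
  memLp_x := ((continuous_dx hv).memLp_of_hasCompactSupport (hasCompactSupport_dx hv)).restrict _
  memLp_y := ((continuous_dy hv).memLp_of_hasCompactSupport (hasCompactSupport_dy hv)).restrict _
  grad := hasWeakGrad_of_isTest hv

lemma IsH1.isH1Loc {w wx wy : ℝ × ℝ → ℂ} (h : IsH1 w wx wy) : IsH1Loc w wx wy :=
  ⟨memLp_l2Loc h.memLp, memLp_l2Loc h.memLp_x, memLp_l2Loc h.memLp_y, h.grad⟩

lemma isPhase_scalingCoeff (L θ : ℝ) : IsPhase (scalingCoeff L θ) := by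
  constructor
  · exact Measurable.ite measurableSet_Iic measurable_const
      (Measurable.ite measurableSet_Ici measurable_const measurable_const)
  · intro x
    unfold scalingCoeff
    have h1 : ‖Complex.exp (Complex.I * θ)‖ = 1 := by
      rw [mul_comm]; exact Complex.norm_exp_ofReal_mul_I θ
    split_ifs
    · exact h1
    · rw [Complex.exp_neg, norm_inv, h1, inv_one]
    · exact norm_one

/-- Among all H¹ test functions of the variational formulation, only the smooth compactly supported
ones are kept; they suffice for the rest. -/
lemma IsEigenpairB.exists_scaledSol {γ : ℝ × ℝ → ℝ} {L θ k : ℝ} (hγ : IsMedium γ L)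
    {w : ℝ × ℝ → ℂ} (h : IsEigenpairB γ L θ ((k ^ 2 : ℝ) : ℂ) w) :
    ∃ wx wy, IsH1 w wx wy ∧ ScaledSol γ (scalingCoeff L θ) k w wx wy := by
  obtain ⟨⟨-, wx, wy, hH, hv⟩, -⟩ := h
  have hB := isPhase_scalingCoeff L θ
  have hl := hH.isH1Loc
  refine ⟨wx, wy, hH, hl, fun v hvt => ?_⟩
  have h0 := hv v _ _ (isH1_of_isTest hvt)
  have i1 := (hB.l2Loc_mul hl.l2Loc_x).integrable_mul (continuous_dx hvt) hvt.xSupp_dx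
  have i2 := (hB.inv.l2Loc_mul hl.l2Loc_y).integrable_mul (continuous_dy hvt) hvt.xSupp_dy
  have i12 : Integrable (fun p => scalingCoeff L θ p.1 * wx p * dx v p +
      (scalingCoeff L θ p.1)⁻¹ * wy p * dy v p) (volume.restrict strip) := i1.add i2
  have i3 : Integrable (fun p => (γ p : ℂ) * (scalingCoeff L θ p.1)⁻¹ *
      (((k ^ 2 : ℝ) : ℂ) * w p) * v p) (volume.restrict strip) := by
    refine (((hγ.l2Loc_mul (hB.inv.l2Loc_mul hl.l2Loc)).integrable_mul hvt.1.continuous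
      hvt.xSupp).const_mul ((k : ℂ) ^ 2)).congr (Eventually.of_forall fun p => ?_)
    simp only
    push_cast
    ring
  rw [← sub_eq_zero, ← integral_sub i12 i3] at h0
  rw [← h0]
  congr 1
  funext p
  push_cast
  ring

/-- For x > L the coefficient B is constant and γ = 1, so the modal equation reduces to w_n'' = (μ_n
e₀)² w_n. Square integrability keeps only the decaying root, and `hm` says that this root is μ_n e₀:
this is how the rotation selects a direction of propagation. -/
lemma ScaledSol.exists_extForm {γ : ℝ × ℝ → ℝ} {L : ℝ} (hγ : IsMedium γ L) (hL : 0 < L)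
    {B : ℝ → ℂ} (hB : IsPhase B) {k : ℝ} {N : ℕ} (hk0 : 0 < k) (hk1 : N * Real.pi < k)
    (hk : k < (N + 1) * Real.pi) {w wx wy : ℝ × ℝ → ℂ}
    (h : ScaledSol γ B k w wx wy) (hw : MemLp w 2 (volume.restrict strip))
    (hwx : MemLp wx 2 (volume.restrict strip)) {e₀ : ℂ} (he : 0 < e₀.re) (hnorm : ‖e₀‖ = 1)
    (hB1 : ∀ x, 0 < x → x < L → B x = 1) (hB2 : ∀ x, L ≤ x → B x = e₀⁻¹) {μ : ℕ → ℂ}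
    (hμ : IsExponent k N μ) (hm : ∀ n, (μ n * e₀).re < 0) :
    ∃ c, ExtForm k N c μ e₀ L w wx wy := by
  have he₀ : e₀ ≠ 0 := by rw [← norm_ne_zero_iff, hnorm]; norm_num
  have hcoef : ∀ {f : ℝ × ℝ → ℂ}, MemLp f 2 (volume.restrict strip) → ∀ n,
      MemLp (coef f n) 2 (volume.restrict (Ioi L)) := fun {f} hf n => by
    refine memLp_coef ?_ n
    rw [← restrict_rightPart]
    exact hf.mono_measure (Measure.restrict_mono inter_subset_left le_rfl)
  have : ∀ n, ∃ c : ℂ, ∀ᵐ x : ℝ, x ∈ Ioi L →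
      coef w n x = c * Complex.exp (μ n * e₀ * (x - L)) ∧
      coef wx n x = μ n * e₀ * (c * Complex.exp (μ n * e₀ * (x - L))) := fun n => by
    refine ae_eq_exp_of_weak_second_order (hm n) (hcoef hw n) (hcoef hwx n)
      (fun ψ hψ _ => h.h1.integral_coef_mul_deriv n hψ) fun ψ hψ hs => ?_
    have h2 := h.modal hγ hB n hψ
    have hz : ∀ x, ¬ L < x → ψ x = 0 ∧ deriv ψ x = 0 := fun x hx =>
      ⟨image_eq_zero_of_notMem_tsupport fun hh => hx (hs hh),
        image_eq_zero_of_notMem_tsupport fun hh => hx (hs (tsupport_deriv_subset hh))⟩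
    have e1 : ∫ x, B x * coef wx n x * deriv ψ x = e₀⁻¹ * ∫ x, coef wx n x * deriv ψ x := by
      rw [← integral_const_mul]
      congr 1
      funext x
      by_cases hx : L < x
      · rw [hB2 x hx.le, mul_assoc]
      · simp [(hz x hx).2]
    have e2 : ∫ x, (B x)⁻¹ * (((n : ℂ) ^ 2 * (Real.pi : ℂ) ^ 2) * coef w n x -
        (k : ℂ) ^ 2 * coef (fun p => (γ p : ℂ) * w p) n x) * ψ x =
        e₀ * μ n ^ 2 * ∫ x, coef w n x * ψ x := by
      rw [← integral_const_mul]
      congr 1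
      funext x
      by_cases hx : L < x
      · rw [hB2 x hx.le, coef_medium_mul hγ w n hx.le, hμ.sq, inv_inv]
        ring
      · simp [(hz x hx).1]
    rw [e1, e2] at h2
    have hinv : e₀⁻¹ * e₀ = 1 := inv_mul_cancel₀ he₀
    linear_combination e₀ * h2 - (∫ x, coef wx n x * deriv ψ x) * hinv
  choose c hc using this
  exact ⟨c, h.extForm hγ hL hB hk0 hk1 hk he hnorm hB1 hB2 hμ fun n =>
    (hc n).mono fun x hx hxL => (hx hxL).1⟩

/-- A solution of the unscaled problem together with its modal expansions on both sides. -/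
structure BiExt (γ : ℝ × ℝ → ℝ) (L k : ℝ) (N : ℕ) (c μ d μ' : ℕ → ℂ) (u ux uy : ℝ × ℝ → ℂ) :
    Prop where
  sol : ScaledSol γ (fun _ => 1) k u ux uy
  right : ExtForm k N c μ 1 L u ux uy
  left : ExtForm k N d μ' 1 L (fun p => u (refl p)) (fun p => -ux (refl p)) (fun p => uy (refl p))

/-- The unscaled function. -/
def unscaled (L : ℝ) (c μ d μ' : ℕ → ℂ) (w : ℝ × ℝ → ℂ) (p : ℝ × ℝ) : ℂ :=
  if L < -p.1 then ext d μ' 1 L (refl p) else glue L w (ext c μ 1 L) p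

/-- Unscale on the right, reflect, unscale again, reflect back. The two operations do not interfere,
as gluing changes a function only beyond the interface concerned. -/
theorem ScaledSol.exists_biExt {γ : ℝ × ℝ → ℝ} {L : ℝ} (hγ : IsMedium γ L) (hL : 0 < L)
    {B : ℝ → ℂ} (hB : IsPhase B) {k : ℝ} {N : ℕ} {w wx wy : ℝ × ℝ → ℂ}
    (h : ScaledSol γ B k w wx wy) {e₁ e₂ : ℂ} (hB0 : ∀ x, |x| < L → B x = 1)
    (hB1 : ∀ x, L ≤ x → B x = e₁⁻¹) (hB2 : ∀ x, L ≤ x → B (-x) = e₂⁻¹) {c μ d μ' : ℕ → ℂ}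
    (hr : ExtForm k N c μ e₁ L w wx wy)
    (hl : ExtForm k N d μ' e₂ L (fun p => w (refl p)) (fun p => -wx (refl p))
      (fun p => wy (refl p))) :
    ∃ ux uy, BiExt γ L k N c μ d μ' (unscaled L c μ d μ' w) ux uy := by
  have hγr : ∀ p ∈ rightPart L, γ p = 1 := fun p hp =>
    hγ.one p hp.1 ((le_of_lt hp.2).trans (le_abs_self _))
  have hγl : ∀ p ∈ rightPart L, γ (refl p) = 1 := fun p hp =>
    hγ.reflect.one p hp.1 ((le_of_lt hp.2).trans (le_abs_self _))
  have s1 := (h.unscale hγ hB hB1 hγr hr)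
  have hB' : IsPhase fun x => if L ≤ x then 1 else B x :=
    ⟨Measurable.ite measurableSet_Ici measurable_const hB.meas, fun x => by
      by_cases hx : L ≤ x <;> simp [hx, hB.norm]⟩
  have hneg : ∀ x, L ≤ x → ¬ L ≤ -x := fun x h1 h2 => by linarith
  have hgl : ∀ (F G : ℝ × ℝ → ℂ) (p : ℝ × ℝ), p ∈ rightPart L → glue L F G (refl p) = F (refl p) :=
    fun F G p hp => by
      have h1 : L < p.1 := hp.2
      have : ¬ L < (refl p).1 := by
        simp only [refl]; linarith
      simp [glue, this]
  have hl1 : ExtForm k N d μ' e₂ L (fun p => glue L w (ext c μ 1 L) (refl p))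
      (fun p => -glue L wx (extX c μ 1 L) (refl p))
      (fun p => glue L wy (extY c μ 1 L) (refl p)) := by
    refine ⟨hl.data, ?_, ?_, ?_⟩
    · filter_upwards [hl.eq, ae_restrict_mem (measurableSet_rightPart L)] with p h1 h2
      rw [hgl _ _ p h2, h1]
    · filter_upwards [hl.eq_x, ae_restrict_mem (measurableSet_rightPart L)] with p h1 h2
      rw [hgl _ _ p h2, h1]
    · filter_upwards [hl.eq_y, ae_restrict_mem (measurableSet_rightPart L)] with p h1 h2
      rw [hgl _ _ p h2, h1]
  have s2 := (s1.reflect.unscale hγ.reflect hB'.reflect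
    (fun x hx => by rw [if_neg (hneg x hx), hB2 x hx]) hγl hl1).reflect
  have hphase : (fun x : ℝ => if L ≤ -x then (1:ℂ) else if L ≤ - -x then 1 else B (- -x)) =
      fun _ => 1 := by
    funext x
    rw [neg_neg]
    split_ifs with h1 h2
    · rfl
    · rfl
    · exact hB0 x (abs_lt.2 ⟨by linarith, by linarith⟩)
  rw [hphase] at s2
  simp only [refl_refl] at s2
  set u2 := glue L (fun p => glue L w (ext c μ 1 L) (refl p)) (ext d μ' 1 L) with hu2
  set ux2 := glue L (fun p => -glue L wx (extX c μ 1 L) (refl p)) (extX d μ' 1 L) with hux2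
  set uy2 := glue L (fun p => glue L wy (extY c μ 1 L) (refl p)) (extY d μ' 1 L) with huy2
  have hu : (fun p => u2 (refl p)) = unscaled L c μ d μ' w := by
    funext p
    simp only [hu2, unscaled, glue, refl_refl]
    rfl
  have hDr := hr.data
  have hDl := hl.data
  have hDr1 : ExtData k N c μ 1 := ⟨hDr.pos, hDr.lt, hDr.exponent, hDr.summable, by simp, by simp⟩
  have hDl1 : ExtData k N d μ' 1 := ⟨hDl.pos, hDl.lt, hDl.exponent, hDl.summable, by simp, by simp⟩
  refine ⟨fun p => -ux2 (refl p), fun p => uy2 (refl p), hu ▸ s2, ⟨hDr1, ?_, ?_, ?_⟩,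
    ⟨hDl1, ?_, ?_, ?_⟩⟩
  · rw [← hu]
    filter_upwards [ae_restrict_mem (measurableSet_rightPart L),
      glue_ae_right L w (ext c μ 1 L)] with p h1 h2
    rw [hu2, hgl _ _ p h1, refl_refl, h2]
  · filter_upwards [ae_restrict_mem (measurableSet_rightPart L),
      glue_ae_right L wx (extX c μ 1 L)] with p h1 h2
    rw [hux2, hgl _ _ p h1, refl_refl, h2, neg_neg]
  · filter_upwards [ae_restrict_mem (measurableSet_rightPart L),
      glue_ae_right L wy (extY c μ 1 L)] with p h1 h2
    rw [huy2, hgl _ _ p h1, refl_refl, h2]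
  · simp only [← hu, refl_refl]
    exact glue_ae_right L _ _
  · simp only [refl_refl, neg_neg]
    exact glue_ae_right L _ _
  · simp only [refl_refl]
    exact glue_ae_right L _ _

lemma isSolution_iff {γ : ℝ × ℝ → ℝ} {k : ℝ} {u : ℝ × ℝ → ℂ} :
    IsSolution γ k u ↔ ∃ ux uy, ScaledSol γ (fun _ => 1) k u ux uy := by
  constructor
  · rintro ⟨ux, uy, h1, h2⟩
    exact ⟨ux, uy, h1, fun v hv => by simpa only [inv_one, one_mul, mul_one] using h2 v hv⟩
  · rintro ⟨ux, uy, h1, h2⟩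
    exact ⟨ux, uy, h1, fun v hv => by simpa only [inv_one, one_mul, mul_one] using h2 v hv⟩

/-! ### Coefficients of exterior series and conservation of energy -/

lemma coef_congr_ae {μ : Measure ℝ} [SFinite μ] {f g : ℝ × ℝ → ℂ} (h : f =ᵐ[μ.prod nu] g) (n : ℕ) :
    ∀ᵐ x ∂μ, coef f n x = coef g n x :=
  (Measure.ae_ae_of_ae_prod h).mono fun _ hx => modalCoeff_congr hx n

section ExtCoef

variable {k : ℝ} {N : ℕ} {c μ : ℕ → ℂ} {e₀ : ℂ} {L : ℝ}

lemma ExtData.summable_slice (h : ExtData k N c μ e₀) {x : ℝ} (hx : L < x) :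
    Summable fun n => ‖c n * Complex.exp (μ n * e₀ * (x - L))‖ :=
  summable_of_summable_mul_phi ((h.dominated L).summable (p := (x, 0)) hx)

lemma ExtData.coef_ext (h : ExtData k N c μ e₀) (n : ℕ) {x : ℝ} (hx : L < x) :
    coef (ext c μ e₀ L) n x = c n * Complex.exp (μ n * e₀ * (x - L)) :=
  modalCoeff_tsum_phi (h.summable_slice hx) n

lemma ExtData.coef_extX (h : ExtData k N c μ e₀) (n : ℕ) {x : ℝ} (hx : L < x) :
    coef (extX c μ e₀ L) n x = μ n * e₀ * (c n * Complex.exp (μ n * e₀ * (x - L))) :=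
  modalCoeff_tsum_phi (A := fun n => μ n * e₀ * (c n * Complex.exp (μ n * e₀ * (x - L))))
    (summable_of_summable_mul_phi ((h.dominated_X L).summable (p := (x, 0)) hx)) n

lemma ExtForm.coef {w wx wy : ℝ × ℝ → ℂ} (h : ExtForm k N c μ e₀ L w wx wy) (n : ℕ) :
    ∀ᵐ x ∂(volume.restrict (Ioi L)),
      coef w n x = c n * Complex.exp (μ n * e₀ * (x - L)) ∧
      coef wx n x = μ n * e₀ * (c n * Complex.exp (μ n * e₀ * (x - L))) := by
  have e1 := h.eq
  have e2 := h.eq_x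
  rw [restrict_rightPart] at e1 e2
  filter_upwards [coef_congr_ae e1 n, coef_congr_ae e2 n, ae_restrict_mem measurableSet_Ioi]
    with x h1 h2 hx
  exact ⟨h1.trans (h.data.coef_ext n hx), h2.trans (h.data.coef_extX n hx)⟩

end ExtCoef

lemma coef_neg (f : ℝ × ℝ → ℂ) (n : ℕ) (x : ℝ) : coef (fun p => -f p) n x = -coef f n x := by
  simp only [coef, modalCoeff, neg_mul, integral_neg]

lemma coef_refl (f : ℝ × ℝ → ℂ) (n : ℕ) (x : ℝ) :
    coef (fun p => f (refl p)) n x = coef f n (-x) := rfl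

lemma ae_comp_neg {P : ℝ → Prop} (h : ∀ᵐ x : ℝ, P x) : ∀ᵐ x : ℝ, P (-x) :=
  (Measure.measurePreserving_neg (volume : Measure ℝ)).quasiMeasurePreserving.ae h

/-- The total energy flux of the modal coefficients vanishes. -/
lemma hasSum_im_integral_coef {γ : ℝ × ℝ → ℝ} {L : ℝ} (hγ : IsMedium γ L) {u : ℝ × ℝ → ℂ}
    (hu : L2Loc u) (r : ℝ) :
    HasSum (fun n => (∫ x in {x : ℝ | |x| < r},
      starRingEnd ℂ (coef u n x) * coef (fun p => (γ p : ℂ) * u p) n x).im) 0 := by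
  set v : ℝ × ℝ → ℂ := fun p => (γ p : ℂ) * u p with hv
  have hvl : L2Loc v := hγ.l2Loc_mul hu
  have mu' := hu.memLp r
  have mv := hvl.memLp r
  have cu := memLp_coef mu'
  have cv := memLp_coef mv
  have hint : ∀ n, Integrable (fun x => starRingEnd ℂ (coef u n x) * coef v n x)
      (volume.restrict {x : ℝ | |x| < r}) := fun n => by
    have := (cv n).integrable_mul ((cu n).star)
    refine this.congr (Eventually.of_forall fun x => ?_)
    simp only [Pi.mul_apply, Pi.star_apply, RCLike.star_def]
    ring
  have hsq : ∀ {f : ℝ × ℝ → ℂ}, MemLp f 2 ((volume.restrict {x : ℝ | |x| < r}).prod nu) →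
      Summable fun n => ∫ x in {x : ℝ | |x| < r}, ‖coef f n x‖ ^ 2 := fun {f} hf =>
    summable_of_sum_le (fun n => integral_nonneg fun x => by positivity)
      fun s => sum_integral_normSq_coef_le hf s
  have hsum : Summable fun n => ∫ x in {x : ℝ | |x| < r},
      ‖starRingEnd ℂ (coef u n x) * coef v n x‖ := by
    refine Summable.of_nonneg_of_le (fun n => integral_nonneg fun x => norm_nonneg _) (fun n => ?_)
      ((hsq mu').add (hsq mv))
    have i1 : Integrable (fun x => ‖coef u n x‖ ^ 2) (volume.restrict {x : ℝ | |x| < r}) :=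
      (cu n).integrable_norm_pow two_ne_zero
    have i2 : Integrable (fun x => ‖coef v n x‖ ^ 2) (volume.restrict {x : ℝ | |x| < r}) :=
      (cv n).integrable_norm_pow two_ne_zero
    rw [← integral_add i1 i2]
    refine integral_mono (hint n).norm (i1.add i2) fun x => ?_
    simp only [norm_mul, RCLike.norm_conj]
    nlinarith [sq_nonneg (‖coef u n x‖ - ‖coef v n x‖), sq_nonneg ‖coef u n x‖,
      sq_nonneg ‖coef v n x‖]
  have h1 := hasSum_integral_of_summable_integral_norm hint hsum
  -- By Parseval the sum under the integral is ∫ γ|u|² over the cross-section, which is real.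
  have h2 : (∫ x in {x : ℝ | |x| < r}, ∑' n, starRingEnd ℂ (coef u n x) * coef v n x).im = 0 := by
    have : ∫ x in {x : ℝ | |x| < r}, ∑' n, starRingEnd ℂ (coef u n x) * coef v n x =
        ((∫ x in {x : ℝ | |x| < r}, ∫ y, γ (x, y) * ‖u (x, y)‖ ^ 2 ∂nu : ℝ) : ℂ) := by
      rw [← integral_complex_ofReal]
      refine integral_congr_ae ?_
      filter_upwards [ae_restrict_of_ae hu.memLp_slice, ae_restrict_of_ae hvl.memLp_slice]
        with x m1 m2
      rw [← integral_complex_ofReal]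
      refine (hasSum_modalCoeff m1 m2).tsum_eq.trans ?_
      congr 1
      funext y
      simp only [hv]
      push_cast
      rw [← Complex.conj_mul']
      ring
    rw [this, Complex.ofReal_im]
  have h3 := Complex.hasSum_im h1
  rwa [h2] at h3

/-- Conservation of energy: the fluxes of the propagating modes balance. -/
theorem BiExt.flux {γ : ℝ × ℝ → ℝ} {L k : ℝ} {N : ℕ} {c μ d μ' : ℕ → ℂ} {u ux uy : ℝ × ℝ → ℂ}
    (hγ : IsMedium γ L) (hL : 0 < L) (h : BiExt γ L k N c μ d μ' u ux uy)
    (hμ : ∀ n ≤ N, (μ n).re = 0) (hμ' : ∀ n ≤ N, (μ' n).re = 0) :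
    ∑ n ∈ Finset.range (N + 1), ((μ n).im * ‖c n‖ ^ 2 + (μ' n).im * ‖d n‖ ^ 2) = 0 := by
  have hB : IsPhase (fun _ => (1:ℂ)) := ⟨measurable_const, fun _ => norm_one⟩
  set v : ℝ × ℝ → ℂ := fun p => (γ p : ℂ) * u p with hv
  have hl := h.sol.h1
  have hvl : L2Loc v := hγ.l2Loc_mul hl.l2Loc
  set a : ℕ → ℝ := fun n => (μ n).im * ‖c n * Complex.exp (μ n)‖ ^ 2 +
    (μ' n).im * ‖d n * Complex.exp (μ' n)‖ ^ 2 with ha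
  -- Flux identity for mode n between -(L+1) and L+1. Its only non real volume term couples u_n with
  -- the n-th coefficient of γu; it need not vanish for a given n, but the imaginary parts sum to
  -- zero over n.
  have key : ∀ n, a n = k ^ 2 * (∫ x in {x : ℝ | |x| < L + 1},
      starRingEnd ℂ (coef u n x) * coef v n x).im * (-1) := by
    intro n
    have lu := hl.l2Loc.locallyIntegrable_coef n
    have lx := hl.l2Loc_x.locallyIntegrable_coef n
    have lv := hvl.locallyIntegrable_coef n
    set q : ℝ → ℂ := fun x => ((n : ℂ) ^ 2 * (Real.pi : ℂ) ^ 2) * coef u n x -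
      (k : ℂ) ^ 2 * coef v n x with hq
    have lq : LocallyIntegrable q :=
      (lu.smul ((n : ℂ) ^ 2 * (Real.pi : ℂ) ^ 2)).sub (lv.smul ((k : ℂ) ^ 2))
    obtain ⟨F, G, hF, hG, hfF, hgG, hflux⟩ := exists_continuous_flux lu lx lq
      (fun ψ hψ => hl.integral_coef_mul_deriv n hψ) (fun ψ hψ => by
        simpa only [inv_one, one_mul] using h.sol.modal hγ hB n hψ)
    -- Evaluation at ±(L+1) rather than ±L: these points lie in the open exterior, where the
    -- continuous representatives coincide with the exponentials.
    have hR := hflux (L + 1) (by linarith)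
    have hmem : L + 1 ∈ Ioi L := by simp
    have eF : F (L + 1) = c n * Complex.exp (μ n) := by
      have : EqOn F (fun x : ℝ => c n * Complex.exp (μ n * 1 * (x - L))) (Ioi L) :=
        Measure.eqOn_open_of_ae_eq (μ := volume) (by
          filter_upwards [h.right.coef n, ae_restrict_of_ae hfF] with x h1 h2
          rw [← h2, h1.1]) isOpen_Ioi hF.continuousOn (by fun_prop)
      rw [this hmem]
      simp
    have eG : G (L + 1) = μ n * (c n * Complex.exp (μ n)) := by
      have : EqOn G (fun x : ℝ => μ n * 1 * (c n * Complex.exp (μ n * 1 * (x - L)))) (Ioi L) :=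
        Measure.eqOn_open_of_ae_eq (μ := volume) (by
          filter_upwards [h.right.coef n, ae_restrict_of_ae hgG] with x h1 h2
          rw [← h2, h1.2]) isOpen_Ioi hG.continuousOn (by fun_prop)
      rw [this hmem]
      simp
    have eF' : F (-(L + 1)) = d n * Complex.exp (μ' n) := by
      have : EqOn (fun x => F (-x)) (fun x : ℝ => d n * Complex.exp (μ' n * 1 * (x - L)))
          (Ioi L) :=
        Measure.eqOn_open_of_ae_eq (μ := volume) (by
          filter_upwards [h.left.coef n, ae_restrict_of_ae (ae_comp_neg hfF)] with x h1 h2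
          rw [← h2, ← h1.1, coef_refl]) isOpen_Ioi (by fun_prop) (by fun_prop)
      refine (this hmem).trans ?_
      simp
    have eG' : G (-(L + 1)) = -(μ' n * (d n * Complex.exp (μ' n))) := by
      have : EqOn (fun x => G (-x))
          (fun x : ℝ => -(μ' n * 1 * (d n * Complex.exp (μ' n * 1 * (x - L))))) (Ioi L) :=
        Measure.eqOn_open_of_ae_eq (μ := volume) (by
          filter_upwards [h.left.coef n, ae_restrict_of_ae (ae_comp_neg hgG)] with x h1 h2
          rw [← h2, ← h1.2, coef_neg, coef_refl, neg_neg]) isOpen_Ioi (by fun_prop) (by fun_prop)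
      refine (this hmem).trans ?_
      simp
    rw [eF, eG, eF', eG'] at hR
    have hset : {x : ℝ | |x| < L + 1} = Ioo (-(L + 1)) (L + 1) := by
      ext x; simp [abs_lt]
    have mu' := memLp_coef (hl.l2Loc.memLp (L + 1)) n
    have mv := memLp_coef (hvl.memLp (L + 1)) n
    have mx := memLp_coef (hl.l2Loc_x.memLp (L + 1)) n
    have i1 : Integrable (fun x => ‖coef u n x‖ ^ 2) (volume.restrict {x : ℝ | |x| < L + 1}) :=
      mu'.integrable_norm_pow two_ne_zero
    have i2 : Integrable (fun x => ‖coef ux n x‖ ^ 2) (volume.restrict {x : ℝ | |x| < L + 1}) :=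
      mx.integrable_norm_pow two_ne_zero
    have i3 : Integrable (fun x => starRingEnd ℂ (coef u n x) * coef v n x)
        (volume.restrict {x : ℝ | |x| < L + 1}) := by
      refine (mv.integrable_mul mu'.star).congr (Eventually.of_forall fun x => ?_)
      simp only [Pi.mul_apply, Pi.star_apply, RCLike.star_def]
      ring
    have hR2 : ∫ x in (-(L + 1))..(L + 1), (q x * starRingEnd ℂ (F x) + G x * starRingEnd ℂ (G x)) =
        ((∫ x in {x : ℝ | |x| < L + 1}, ((n : ℝ) ^ 2 * Real.pi ^ 2 * ‖coef u n x‖ ^ 2 +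
          ‖coef ux n x‖ ^ 2) : ℝ) : ℂ) - (k : ℂ) ^ 2 * ∫ x in {x : ℝ | |x| < L + 1},
            starRingEnd ℂ (coef u n x) * coef v n x := by
      have i4 : Integrable (fun x => (((n : ℝ) ^ 2 * Real.pi ^ 2 * ‖coef u n x‖ ^ 2 +
          ‖coef ux n x‖ ^ 2 : ℝ) : ℂ)) (volume.restrict {x : ℝ | |x| < L + 1}) :=
        ((i1.const_mul _).add i2).ofReal
      rw [intervalIntegral.integral_of_le (by linarith), integral_Ioc_eq_integral_Ioo, ← hset,
        ← integral_complex_ofReal, ← integral_const_mul, ← integral_sub i4 (i3.const_mul _)]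
      refine integral_congr_ae ?_
      filter_upwards [ae_restrict_of_ae hfF, ae_restrict_of_ae hgG] with x h1 h2
      rw [← h1, ← h2, hq]
      push_cast
      rw [← Complex.conj_mul', ← Complex.conj_mul']
      ring
    rw [hR2] at hR
    have him := congrArg Complex.im hR
    have hz : ∀ m z : ℂ, (m * z * starRingEnd ℂ z).im = m.im * ‖z‖ ^ 2 := fun m z => by
      rw [mul_assoc, Complex.mul_conj']
      have : ((‖z‖ : ℂ) ^ 2) = ((‖z‖ ^ 2 : ℝ) : ℂ) := by push_cast; rfl
      rw [this, Complex.im_mul_ofReal]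
    have hk2 : ((k : ℂ) ^ 2) = ((k ^ 2 : ℝ) : ℂ) := by push_cast; rfl
    rw [neg_mul, sub_neg_eq_add, Complex.add_im, hz, hz, Complex.sub_im, Complex.ofReal_im, hk2,
      Complex.im_ofReal_mul] at him
    rw [ha]
    simp only
    linarith
  have hs : HasSum a 0 := by
    have := ((hasSum_im_integral_coef hγ hl.l2Loc (L + 1)).mul_left (k ^ 2)).mul_right (-1 : ℝ)
    simp only [mul_zero, zero_mul] at this
    exact this.congr_fun fun n => key n
  -- Evanescent exponents are real, so these modes carry no flux and only finitely many terms
  -- remain; for those the exponential factor has modulus 1.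
  have hfin : HasSum a (∑ n ∈ Finset.range (N + 1), a n) := by
    refine hasSum_sum_of_ne_finset_zero fun n hn => ?_
    have hn' : N < n := by
      rw [Finset.mem_range] at hn; omega
    rw [ha]
    simp [h.right.data.exponent.tail n hn', h.left.data.exponent.tail n hn']
  rw [← hfin.unique hs]
  refine Finset.sum_congr rfl fun n hn => ?_
  have hn' : n ≤ N := by
    rw [Finset.mem_range] at hn; omega
  rw [ha]
  simp [Complex.norm_exp, hμ n hn', hμ' n hn']

/-! ### Exponents of the outgoing and incoming modes -/

section Beta

variable {N : ℕ} {k : ℝ}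

lemma beta_of_le (hk : N * Real.pi < k) {n : ℕ} (hn : n ≤ N) :
    beta k n = (Real.sqrt (k ^ 2 - (n : ℝ) ^ 2 * Real.pi ^ 2) : ℂ) ∧
      0 < Real.sqrt (k ^ 2 - (n : ℝ) ^ 2 * Real.pi ^ 2) := by
  have h1 : (n : ℝ) * Real.pi < k := lt_of_le_of_lt (by gcongr) hk
  have h0 : 0 ≤ (n : ℝ) * Real.pi := by positivity
  have h2 : (n : ℝ) ^ 2 * Real.pi ^ 2 < k ^ 2 := by nlinarith
  exact ⟨by rw [beta, if_pos h2.le], Real.sqrt_pos.2 (by linarith)⟩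

lemma beta_of_lt (hk0 : 0 < k) (hk : k < (N + 1) * Real.pi) {n : ℕ} (hn : N < n) :
    beta k n = Complex.I * (rate k n : ℂ) := by
  have h1 := rate_sq hk0 hk hn
  have h2 := rate_pos hk0 hk hn
  rw [beta, if_neg, rate]
  nlinarith

/-- Exponents of the outgoing modes. -/
def muOut (k : ℝ) (n : ℕ) : ℂ := Complex.I * beta k n

/-- Exponents of the modes that are incoming, or evanescent. -/
def muIn (k : ℝ) (N n : ℕ) : ℂ := if n ≤ N then -(Complex.I * beta k n) else Complex.I * beta k n

lemma muOut_sq (hk0 : 0 < k) (hk1 : N * Real.pi < k) (hk : k < (N + 1) * Real.pi) (n : ℕ) :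
    (Complex.I * beta k n) ^ 2 = (n : ℂ) ^ 2 * (Real.pi : ℂ) ^ 2 - (k : ℂ) ^ 2 := by
  by_cases hn : n ≤ N
  · obtain ⟨h1, h2⟩ := beta_of_le hk1 hn
    have h3 : Real.sqrt (k ^ 2 - (n : ℝ) ^ 2 * Real.pi ^ 2) ^ 2 =
      k ^ 2 - (n : ℝ) ^ 2 * Real.pi ^ 2 := Real.sq_sqrt (Real.sqrt_pos.1 h2).le
    rw [h1, mul_pow, Complex.I_sq, ← Complex.ofReal_pow, h3]
    push_cast
    ring
  · have hn' := not_le.1 hn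
    have h3 := rate_sq hk0 hk hn'
    rw [beta_of_lt hk0 hk hn', ← mul_assoc, Complex.I_mul_I, neg_one_mul, neg_sq,
      ← Complex.ofReal_pow, h3]
    push_cast
    ring

lemma isExponent_muOut (hk0 : 0 < k) (hk1 : N * Real.pi < k) (hk : k < (N + 1) * Real.pi) :
    IsExponent k N (muOut k) where
  sq n := muOut_sq hk0 hk1 hk n
  tail n hn := by
    rw [muOut, beta_of_lt hk0 hk hn, ← mul_assoc, Complex.I_mul_I, neg_one_mul]

lemma isExponent_muIn (hk0 : 0 < k) (hk1 : N * Real.pi < k) (hk : k < (N + 1) * Real.pi) :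
    IsExponent k N (muIn k N) where
  sq n := by
    unfold muIn
    split_ifs
    · rw [neg_sq]; exact muOut_sq hk0 hk1 hk n
    · exact muOut_sq hk0 hk1 hk n
  tail n hn := by
    rw [muIn, if_neg (not_le.2 hn)]
    exact (isExponent_muOut hk0 hk1 hk).tail n hn

lemma muOut_re_im (hk1 : N * Real.pi < k) {n : ℕ} (hn : n ≤ N) :
    (muOut k n).re = 0 ∧ 0 < (muOut k n).im := by
  obtain ⟨h1, h2⟩ := beta_of_le hk1 hn
  rw [muOut, h1]
  simpa using h2

lemma muIn_eq (k : ℝ) {N n : ℕ} (hn : n ≤ N) : muIn k N n = -muOut k n := by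
  rw [muIn, if_pos hn, muOut]

lemma muIn_eq_of_lt (k : ℝ) {N n : ℕ} (hn : N < n) : muIn k N n = muOut k n := by
  rw [muIn, if_neg (not_le.2 hn), muOut]

/-- For a propagating mode μ = iβ with β > 0, the real part of μe is -β Im e: a rotation with Im e >
0 makes outgoing waves decay. Evanescent modes decay as soon as Re e > 0. -/
lemma muOut_mul_re_neg (hk0 : 0 < k) (hk1 : N * Real.pi < k) (hk : k < (N + 1) * Real.pi) {e : ℂ}
    (he : 0 < e.re) (he' : 0 < e.im) (n : ℕ) : (muOut k n * e).re < 0 := by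
  by_cases hn : n ≤ N
  · obtain ⟨h1, h2⟩ := muOut_re_im hk1 hn
    rw [Complex.mul_re, h1]
    nlinarith
  · rw [(isExponent_muOut hk0 hk1 hk).tail n (not_le.1 hn)]
    have := rate_pos hk0 hk (not_le.1 hn)
    simp only [neg_mul, Complex.neg_re, Complex.re_ofReal_mul]
    nlinarith

/-- The conjugate rotation makes incoming waves decay instead. At the left end these are the waves
w_n^+. -/
lemma muIn_mul_re_neg (hk0 : 0 < k) (hk1 : N * Real.pi < k) (hk : k < (N + 1) * Real.pi) {e : ℂ}
    (he : 0 < e.re) (he' : e.im < 0) (n : ℕ) : (muIn k N n * e).re < 0 := by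
  by_cases hn : n ≤ N
  · obtain ⟨h1, h2⟩ := muOut_re_im hk1 hn
    rw [muIn_eq k hn, Complex.mul_re, Complex.neg_re, Complex.neg_im, h1]
    nlinarith
  · rw [(isExponent_muIn hk0 hk1 hk).tail n (not_le.1 hn)]
    have := rate_pos hk0 hk (not_le.1 hn)
    simp only [neg_mul, Complex.neg_re, Complex.re_ofReal_mul]
    nlinarith

lemma beta_ne_zero (hk0 : 0 < k) (hk1 : N * Real.pi < k) (hk : k < (N + 1) * Real.pi) (n : ℕ) :
    beta k n ≠ 0 := by
  by_cases hn : n ≤ N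
  · obtain ⟨h1, h2⟩ := beta_of_le hk1 hn
    rw [h1]
    exact_mod_cast h2.ne'
  · rw [beta_of_lt hk0 hk (not_le.1 hn)]
    have := rate_pos hk0 hk (not_le.1 hn)
    exact mul_ne_zero Complex.I_ne_zero (by exact_mod_cast this.ne')

/-- The normalisation of the modes. -/
def normFactor (k : ℝ) (n : ℕ) : ℂ := (Real.sqrt (2 * ‖beta k n‖) : ℂ)

lemma normFactor_ne_zero (hk0 : 0 < k) (hk1 : N * Real.pi < k) (hk : k < (N + 1) * Real.pi)
    (n : ℕ) : normFactor k n ≠ 0 := by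
  have := norm_pos_iff.2 (beta_ne_zero hk0 hk1 hk n)
  have h2 : 0 < Real.sqrt (2 * ‖beta k n‖) := Real.sqrt_pos.2 (by positivity)
  unfold normFactor
  exact_mod_cast h2.ne'

/-- The amplitude at `x = L` of the mode with coefficient `b`. -/
def edgeAmp (k L : ℝ) (b : ℕ → ℂ) (n : ℕ) : ℂ :=
  b n * (normFactor k n)⁻¹ * Complex.exp (Complex.I * beta k n * L)

/-- The coefficient of the mode with amplitude `c` at `x = L`. -/
def modeCoeff (k L : ℝ) (c : ℕ → ℂ) (n : ℕ) : ℂ :=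
  c n * normFactor k n * Complex.exp (-(Complex.I * beta k n * L))

lemma edgeAmp_modeCoeff (hk0 : 0 < k) (hk1 : N * Real.pi < k) (hk : k < (N + 1) * Real.pi) (L : ℝ)
    (c : ℕ → ℂ) : edgeAmp k L (modeCoeff k L c) = c := by
  funext n
  have h := normFactor_ne_zero hk0 hk1 hk n
  unfold edgeAmp modeCoeff
  rw [Complex.exp_neg]
  have := Complex.exp_ne_zero (Complex.I * beta k n * L)
  field_simp

lemma extTerm_edgeAmp (L : ℝ) (b : ℕ → ℂ) (n : ℕ) (p : ℝ × ℝ) :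
    extTerm (edgeAmp k L b) (muOut k) 1 L n p = b n * modePlus k n p := by
  unfold extTerm edgeAmp modePlus muOut normFactor
  have : Complex.exp (Complex.I * beta k n * p.1) = Complex.exp (Complex.I * beta k n * L) *
      Complex.exp (Complex.I * beta k n * 1 * (p.1 - L)) := by
    rw [← Complex.exp_add]
    congr 1
    ring
  rw [this]
  push_cast
  ring

lemma modePlus_refl (n : ℕ) (p : ℝ × ℝ) : modePlus k n (refl p) = modeMinus k n p := by
  simp [modePlus, modeMinus, refl]

end Beta

/-! ### Decay -/

section Decay

variable {k : ℝ} {N : ℕ} {c μ : ℕ → ℂ} {L : ℝ}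

/-- Beyond n = N every rate is at least κ, so the tail is bounded by 2e^{-κ(x-L)} Σ‖c n‖. The factor
e^{κ|L|} in the constant converts x - L into |x|. -/
lemma ExtData.exists_decay (h : ExtData k N c μ 1) (L : ℝ) : ∃ C κ : ℝ, 0 < κ ∧
    ∀ p : ℝ × ℝ, L < p.1 → ‖ext c μ 1 L p - ∑ n ∈ Finset.range (N + 1), extTerm c μ 1 L n p‖ ≤
      C * Real.exp (-(κ * |p.1|)) := by
  obtain ⟨κ, hκ, hκn⟩ := exists_rate_lower_bound h.pos h.lt
  refine ⟨(∑' n, ‖c n‖) * 2 * Real.exp (κ * |L|), κ, hκ, fun p hp => ?_⟩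
  have hs := h.summable_norm
  have hsum : Summable fun n => extTerm c μ 1 L n p := ((h.dominated L).summable hp).of_norm
  rw [ext, ← hsum.sum_add_tsum_nat_add (N + 1), add_sub_cancel_left]
  have hb : ∀ n, ‖extTerm c μ 1 L (n + (N + 1)) p‖ ≤
      ‖c (n + (N + 1))‖ * (2 * (Real.exp (κ * |L|) * Real.exp (-(κ * |p.1|)))) := fun n => by
    have hn : N < n + (N + 1) := by omega
    have h1 := hκn _ hn
    have hn1 : (1:ℝ) ≤ ((n + (N + 1) : ℕ) : ℝ) := by exact_mod_cast (by omega)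
    have h2 : κ ≤ rate k (n + (N + 1)) := by nlinarith
    rw [extTerm, norm_mul, norm_mul, Complex.norm_exp, h.exponent.tail _ hn]
    have h3 : (-(rate k (n + (N + 1)) : ℂ) * 1 * ((p.1 : ℂ) - L)).re ≤
        κ * |L| + -(κ * |p.1|) := by
      have : (-(rate k (n + (N + 1)) : ℂ) * 1 * ((p.1 : ℂ) - L)).re =
        -(rate k (n + (N + 1)) * (p.1 - L)) := by simp
      rw [this]
      have h4 : 0 < p.1 - L := sub_pos.2 hp
      have h5 : |p.1| ≤ (p.1 - L) + |L| := by
        calc |p.1| = |(p.1 - L) + L| := by ring_nf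
          _ ≤ |p.1 - L| + |L| := abs_add_le _ _
          _ = _ := by rw [abs_of_pos h4]
      nlinarith
    have h6 := norm_phi_le (n + (N + 1)) p.2
    rw [← Real.exp_add]
    calc _ ≤ ‖c (n + (N + 1))‖ * Real.exp (κ * |L| + -(κ * |p.1|)) * 2 := by gcongr
      _ = _ := by ring
  have hs' := (summable_nat_add_iff (N + 1)).2 hs
  have hle : ∑' n, ‖c (n + (N + 1))‖ ≤ ∑' n, ‖c n‖ := by
    rw [← hs.sum_add_tsum_nat_add (N + 1)]
    have : 0 ≤ ∑ i ∈ Finset.range (N + 1), ‖c i‖ := Finset.sum_nonneg fun _ _ => norm_nonneg _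
    linarith
  calc _ ≤ ∑' n, ‖c (n + (N + 1))‖ * (2 * (Real.exp (κ * |L|) * Real.exp (-(κ * |p.1|)))) :=
        tsum_of_norm_bounded (hs'.mul_right _).hasSum hb
    _ = (∑' n, ‖c (n + (N + 1))‖) * (2 * (Real.exp (κ * |L|) * Real.exp (-(κ * |p.1|)))) :=
        tsum_mul_right
    _ ≤ (∑' n, ‖c n‖) * (2 * (Real.exp (κ * |L|) * Real.exp (-(κ * |p.1|)))) := by gcongr
    _ = _ := by ring

lemma expDecayRight_of_ext {f g : ℝ × ℝ → ℂ} (h : ExtData k N c μ 1)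
    (hf : f =ᵐ[volume.restrict (rightPart L)] ext c μ 1 L)
    (hg : ∀ p, g p = f p - ∑ n ∈ Finset.range (N + 1), extTerm c μ 1 L n p) :
    ExpDecayRight L g := by
  obtain ⟨C, κ, hκ, hb⟩ := h.exists_decay L
  refine ⟨C, κ, hκ, ?_⟩
  have hf' := (ae_restrict_iff' (measurableSet_rightPart L)).1 hf
  filter_upwards [ae_restrict_of_ae hf', ae_restrict_of_ae (ae_fst_ne L),
    ae_restrict_mem measurableSet_strip] with p h1 h2 h3 h4
  have h5 : L < p.1 := lt_of_le_of_ne h4 (Ne.symm h2)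
  rw [hg, h1 ⟨h3, h5⟩]
  exact hb p h5

lemma expDecayLeft_of_refl {f : ℝ × ℝ → ℂ} (h : ExpDecayRight L fun p => f (refl p)) :
    ExpDecayLeft L f := by
  obtain ⟨C, κ, hκ, hb⟩ := h
  refine ⟨C, κ, hκ, ?_⟩
  filter_upwards [ae_strip_refl hb] with p hp hL
  have := hp (by simp only [refl]; linarith)
  simpa [refl_refl, refl] using this

lemma ExpDecayLeft.add {f g : ℝ × ℝ → ℂ} (hf : ExpDecayLeft L f) (hg : ExpDecayLeft L g) :
    ExpDecayLeft L fun p => f p + g p := by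
  obtain ⟨C, κ, hκ, hb⟩ := hf
  obtain ⟨C', κ', hκ', hb'⟩ := hg
  refine ⟨|C| + |C'|, min κ κ', lt_min hκ hκ', ?_⟩
  filter_upwards [hb, hb'] with p h1 h2 h3
  have e1 : Real.exp (-(κ * |p.1|)) ≤ Real.exp (-(min κ κ' * |p.1|)) := by
    gcongr
    exact min_le_left _ _
  have e2 : Real.exp (-(κ' * |p.1|)) ≤ Real.exp (-(min κ κ' * |p.1|)) := by
    gcongr
    exact min_le_right _ _
  calc _ ≤ ‖f p‖ + ‖g p‖ := norm_add_le _ _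
    _ ≤ |C| * Real.exp (-(κ * |p.1|)) + |C'| * Real.exp (-(κ' * |p.1|)) := by
        refine add_le_add ((h1 h3).trans ?_) ((h2 h3).trans ?_)
        · gcongr; exact le_abs_self _
        · gcongr; exact le_abs_self _
    _ ≤ _ := by
        rw [add_mul]
        gcongr

/-- Without propagating part the exponential bound gives square integrability, the cross-section
being bounded. -/
lemma memLp_rightPart_of_ext {f : ℝ × ℝ → ℂ} (h : ExtData k N c μ 1)
    (hf : f =ᵐ[volume.restrict (rightPart L)] ext c μ 1 L)
    (hm : AEStronglyMeasurable f (volume.restrict (rightPart L))) (hc : ∀ n ≤ N, c n = 0) :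
    MemLp f 2 (volume.restrict (rightPart L)) := by
  obtain ⟨C, κ, hκ, hb⟩ := h.exists_decay L
  have h1 : MemLp (fun x : ℝ => Real.exp (-(κ * |x|))) 2 (volume.restrict (Ioi L)) := by
    have h2 : MemLp (fun x : ℝ => Real.exp (-κ * x)) 2 (volume.restrict (Ioi L)) := by
      rw [memLp_two_iff_integrable_sq (by fun_prop)]
      refine (exp_neg_integrableOn_Ioi L (b := 2 * κ) (by positivity)).congr
        (Eventually.of_forall fun x => ?_)
      simp only
      rw [← Real.exp_nat_mul]
      congr 1
      push_cast
      ring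
    refine h2.mono (by fun_prop) (Eventually.of_forall fun x => ?_)
    rw [Real.norm_of_nonneg (Real.exp_pos _).le, Real.norm_of_nonneg (Real.exp_pos _).le]
    have := le_abs_self x
    exact Real.exp_le_exp.2 (by nlinarith)
  have h2 : MemLp (fun p : ℝ × ℝ => Real.exp (-(κ * |p.1|))) 2 (volume.restrict (rightPart L)) := by
    rw [restrict_rightPart]
    exact h1.comp_fst nu
  refine h2.of_le_mul (c := C) hm ?_
  filter_upwards [hf, ae_restrict_mem (measurableSet_rightPart L)] with p h3 h4
  have h5 := hb p h4.2
  rw [Finset.sum_eq_zero, sub_zero] at h5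
  · rw [h3, Real.norm_of_nonneg (Real.exp_pos _).le]
    exact h5
  · intro n hn
    rw [extTerm, hc n (by rw [Finset.mem_range] at hn; omega)]
    simp

end Decay

/-! ### Expansions on cross-sections and their coefficients -/

section Expansion

variable {k : ℝ} {N : ℕ} {c μ : ℕ → ℂ} {L : ℝ}

/-- The exterior series converges in `L²` on almost every cross-section. -/
lemma ExtData.tendsto_slice (h : ExtData k N c μ 1) {f : ℝ × ℝ → ℂ}
    (hf : f =ᵐ[volume.restrict (rightPart L)] ext c μ 1 L) :
    ∀ᵐ x : ℝ, x ∈ Ioi L → Tendsto (fun M : ℕ => eLpNorm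
      (fun y : ℝ => f (x, y) - ∑ n ∈ Finset.range M, extTerm c μ 1 L n (x, y)) 2 nu)
      atTop (𝓝 0) := by
  rw [restrict_rightPart] at hf
  refine (ae_restrict_iff' measurableSet_Ioi).1 ?_
  filter_upwards [Measure.ae_ae_of_ae_prod hf, ae_restrict_mem measurableSet_Ioi] with x hx hxL
  have hA := h.summable_slice (L := L) hxL
  set A : ℕ → ℂ := fun n => c n * Complex.exp (μ n * 1 * (x - L)) with hAdef
  have hlim : Tendsto (fun M => ENNReal.ofReal (∑' n, ‖A (n + M)‖ * 2)) atTop (𝓝 0) := by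
    rw [← ENNReal.ofReal_zero]
    exact ENNReal.tendsto_ofReal (tendsto_sum_nat_add fun n => ‖A n‖ * 2)
  refine tendsto_of_tendsto_of_tendsto_of_le_of_le tendsto_const_nhds hlim
    (fun _ => bot_le) fun M => ?_
  refine (eLpNorm_le_of_ae_bound (C := ∑' n, ‖A (n + M)‖ * 2) ?_).trans ?_
  · filter_upwards [hx] with y hy
    have hsum : Summable fun n => extTerm c μ 1 L n (x, y) :=
      ((h.dominated L).summable (p := (x, y)) hxL).of_norm
    rw [hy, ext, ← hsum.sum_add_tsum_nat_add M, add_sub_cancel_left]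
    refine tsum_of_norm_bounded (((summable_nat_add_iff M).2 hA).mul_right 2).hasSum fun n => ?_
    rw [extTerm, norm_mul]
    have := norm_phi_le (n + M) y
    gcongr
  · simp

lemma norm_modalCoeff_le {f : ℝ → ℂ} (hf : MemLp f 2 nu) (n : ℕ) :
    ‖modalCoeff f n‖ ≤ (eLpNorm f 2 nu).toReal := by
  rw [← inner_toLp_phi hf n, ← Lp.norm_toLp f hf]
  refine (norm_inner_le_norm _ _).trans ?_
  have : ‖(memLp_phi n).toLp _‖ = 1 := by
    rw [← phiBasis_apply]; exact phiBasis.orthonormal.1 n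
  rw [this, one_mul]

lemma modalCoeff_sub {f g : ℝ → ℂ} (hf : MemLp f 2 nu) (hg : MemLp g 2 nu) (n : ℕ) :
    modalCoeff (fun y => f y - g y) n = modalCoeff f n - modalCoeff g n := by
  have hc := (contDiff_phi n).continuous
  simp only [modalCoeff, sub_mul]
  exact integral_sub (integrable_mul_continuous (hf.integrable one_le_two) hc)
    (integrable_mul_continuous (hg.integrable one_le_two) hc)

lemma memLp_sum_phi (A : ℕ → ℂ) (s : Finset ℕ) :
    MemLp (fun y => ∑ n ∈ s, A n * (phi n y : ℂ)) 2 nu :=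
  memLp_finsetSum s fun n _ => (memLp_phi n).const_mul (A n)

lemma modalCoeff_sum_phi (A : ℕ → ℂ) {M n : ℕ} (hn : n < M) :
    modalCoeff (fun y => ∑ m ∈ Finset.range M, A m * (phi m y : ℂ)) n = A n := by
  have h := modalCoeff_tsum_phi (A := fun m => if m < M then A m else 0)
    (summable_of_ne_finset_zero (s := Finset.range M) fun m hm => by
      rw [Finset.mem_range] at hm
      simp [hm]) n
  rw [if_pos hn] at h
  rw [← h]
  congr 1
  funext y
  rw [tsum_eq_sum (s := Finset.range M) fun m hm => by
    rw [Finset.mem_range] at hm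
    simp [hm]]
  refine Finset.sum_congr rfl fun m hm => ?_
  rw [if_pos (Finset.mem_range.1 hm)]

/-- A modal coefficient is a continuous functional on L²(0,1), and all partial sums of length M > n
have the same n-th coefficient A n. -/
lemma modalCoeff_of_tendsto {g : ℝ → ℂ} (hg : MemLp g 2 nu) {A : ℕ → ℂ}
    (h : Tendsto (fun M : ℕ => eLpNorm
      (fun y => g y - ∑ n ∈ Finset.range M, A n * (phi n y : ℂ)) 2 nu) atTop (𝓝 0)) (n : ℕ) :
    modalCoeff g n = A n := by
  have h1 := (ENNReal.tendsto_toReal ENNReal.zero_ne_top).comp h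
  rw [ENNReal.toReal_zero] at h1
  have h2 : ‖modalCoeff g n - A n‖ ≤ 0 := by
    refine ge_of_tendsto h1 ?_
    filter_upwards [eventually_gt_atTop n] with M hM
    have h3 := norm_modalCoeff_le (hg.sub (memLp_sum_phi A (Finset.range M))) n
    rw [show (g - fun y => ∑ n ∈ Finset.range M, A n * (phi n y : ℂ)) =
      fun y => g y - ∑ n ∈ Finset.range M, A n * (phi n y : ℂ) from rfl,
      modalCoeff_sub hg (memLp_sum_phi A _), modalCoeff_sum_phi A hM] at h3
    exact h3
  exact sub_eq_zero.1 (norm_le_zero_iff.1 h2)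

lemma ExpandsRight.coef {f : ℝ × ℝ → ℂ} (hf : ∀ᵐ x : ℝ, MemLp (fun y => f (x, y)) 2 nu)
    {b : ℕ → ℂ} (h : ExpandsRight L k f b) (n : ℕ) : ∀ᵐ x : ℝ, x ∈ Ioi L →
      coef f n x = edgeAmp k L b n * Complex.exp (muOut k n * 1 * (x - L)) := by
  filter_upwards [hf, h] with x h1 h2 h3
  have h4 := h2 (le_of_lt h3)
  simp only [← extTerm_edgeAmp L b] at h4
  exact modalCoeff_of_tendsto h1
    (A := fun n => edgeAmp k L b n * Complex.exp (muOut k n * 1 * (x - L))) h4 n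

lemma ExpandsLeft.refl {f : ℝ × ℝ → ℂ} {b : ℕ → ℂ} (h : ExpandsLeft L k f b) :
    ExpandsRight L k (fun p => f (refl p)) b := by
  filter_upwards [ae_comp_neg h] with x hx hxL
  have := hx (by linarith)
  simpa only [← modePlus_refl, Waveguide.refl, neg_neg] using this

lemma ExpandsRight.refl {f : ℝ × ℝ → ℂ} {b : ℕ → ℂ}
    (h : ExpandsRight L k (fun p => f (refl p)) b) : ExpandsLeft L k f b := by
  filter_upwards [ae_comp_neg h] with x hx hxL
  have := hx (by linarith)
  simpa only [← modePlus_refl, Waveguide.refl, neg_neg] using this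

/-- On the right, incident waves are themselves outgoing modes. Subtracting them changes only the
first N + 1 coefficients, and partial sums of length at least N + 1 contain the whole incident
field. -/
lemma ExpandsRight.sub_incident {f : ℝ × ℝ → ℂ} {b : ℕ → ℂ} (h : ExpandsRight L k f b)
    (a : Fin (N + 1) → ℂ) : ExpandsRight L k (fun p => f p - incident k a p)
      (fun n => b n - if hn : n < N + 1 then a ⟨n, hn⟩ else 0) := by
  filter_upwards [h] with x hx hxL
  refine (hx hxL).congr' ?_
  filter_upwards [eventually_ge_atTop (N + 1)] with M hM
  congr 1
  funext y
  simp only [sub_mul, Finset.sum_sub_distrib]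
  have : incident k a (x, y) = ∑ n ∈ Finset.range M,
      (if hn : n < N + 1 then a ⟨n, hn⟩ else 0) * modePlus k n (x, y) := by
    rw [incident, ← Finset.sum_subset (Finset.range_subset_range.2 hM), Finset.sum_range]
    · refine Finset.sum_congr rfl fun n _ => ?_
      rw [dif_pos n.2]
    · intro n _ hn
      rw [Finset.mem_range] at hn
      rw [dif_neg hn, zero_mul]
  rw [this]
  ring

end Expansion

/-! ### Linearity -/

lemma IsH1Loc.add {f fx fy g gx gy : ℝ × ℝ → ℂ} (hf : IsH1Loc f fx fy) (hg : IsH1Loc g gx gy) :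
    IsH1Loc (fun p => f p + g p) (fun p => fx p + gx p) (fun p => fy p + gy p) := by
  refine ⟨hf.l2Loc.add hg.l2Loc, hf.l2Loc_x.add hg.l2Loc_x, hf.l2Loc_y.add hg.l2Loc_y,
    fun v hv hs => ?_⟩
  obtain ⟨a1, a2⟩ := hf.grad v hv hs
  obtain ⟨b1, b2⟩ := hg.grad v hv hs
  have hc := hv.1.continuous
  have hx := continuous_dx hv
  have hy := continuous_dy hv
  simp only [add_mul]
  rw [integral_add (hf.l2Loc.integrable_mul hx hv.xSupp_dx) (hg.l2Loc.integrable_mul hx hv.xSupp_dx),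
    integral_add (hf.l2Loc.integrable_mul hy hv.xSupp_dy) (hg.l2Loc.integrable_mul hy hv.xSupp_dy),
    integral_add (hf.l2Loc_x.integrable_mul hc hv.xSupp) (hg.l2Loc_x.integrable_mul hc hv.xSupp),
    integral_add (hf.l2Loc_y.integrable_mul hc hv.xSupp) (hg.l2Loc_y.integrable_mul hc hv.xSupp),
    a1, a2, b1, b2]
  constructor <;> ring

lemma IsH1Loc.const_mul {f fx fy : ℝ × ℝ → ℂ} (hf : IsH1Loc f fx fy) (a : ℂ) :
    IsH1Loc (fun p => a * f p) (fun p => a * fx p) (fun p => a * fy p) := by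
  refine ⟨hf.l2Loc.const_mul a, hf.l2Loc_x.const_mul a, hf.l2Loc_y.const_mul a,
    fun v hv hs => ?_⟩
  obtain ⟨a1, a2⟩ := hf.grad v hv hs
  simp only [mul_assoc, integral_const_mul, a1, a2]
  constructor <;> ring

section Linear

variable {γ : ℝ × ℝ → ℝ} {L k : ℝ}

lemma IsSolution.l2Loc {u : ℝ × ℝ → ℂ} (h : IsSolution γ k u) : L2Loc u := by
  obtain ⟨ux, uy, h1, -⟩ := h
  exact h1.l2Loc

lemma IsSolution.add (hγ : IsMedium γ L) {u v : ℝ × ℝ → ℂ} (hu : IsSolution γ k u)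
    (hv : IsSolution γ k v) : IsSolution γ k fun p => u p + v p := by
  rw [isSolution_iff] at *
  obtain ⟨ux, uy, hu⟩ := hu
  obtain ⟨vx, vy, hv⟩ := hv
  have hB : IsPhase (fun _ => (1:ℂ)) := ⟨measurable_const, fun _ => norm_one⟩
  refine ⟨_, _, hu.h1.add hv.h1, fun φ hφ => ?_⟩
  have h1 := hu.weak φ hφ
  have h2 := hv.weak φ hφ
  have h3 := integral_add (integrable_weak hγ hB k hu.h1.l2Loc hu.h1.l2Loc_x hu.h1.l2Loc_y hφ)
    (integrable_weak hγ hB k hv.h1.l2Loc hv.h1.l2Loc_x hv.h1.l2Loc_y hφ)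
  rw [h1, h2, add_zero] at h3
  rw [← h3]
  congr 1
  funext p
  ring

lemma IsSolution.const_mul {u : ℝ × ℝ → ℂ} (hu : IsSolution γ k u) (a : ℂ) :
    IsSolution γ k fun p => a * u p := by
  rw [isSolution_iff] at *
  obtain ⟨ux, uy, hu⟩ := hu
  refine ⟨_, _, hu.h1.const_mul a, fun φ hφ => ?_⟩
  have h1 := congrArg (fun z => a * z) (hu.weak φ hφ)
  simp only [mul_zero] at h1
  rw [← h1, ← integral_const_mul]
  congr 1
  funext p
  ring

lemma IsSolution.sub (hγ : IsMedium γ L) {u v : ℝ × ℝ → ℂ} (hu : IsSolution γ k u)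
    (hv : IsSolution γ k v) : IsSolution γ k fun p => u p - v p := by
  have := hu.add hγ (hv.const_mul (-1))
  simpa only [neg_one_mul, ← sub_eq_add_neg] using this

lemma isSolution_zero : IsSolution γ k fun _ => 0 :=
  ⟨fun _ => 0, fun _ => 0, ⟨fun _ => MemLp.zero, fun _ => MemLp.zero, fun _ => MemLp.zero,
    fun v _ _ => by simp⟩, fun v _ => by simp⟩

lemma isSolution_sum (hγ : IsMedium γ L) {ι : Type*} (s : Finset ι) (a : ι → ℂ)
    {u : ι → ℝ × ℝ → ℂ} (hu : ∀ i, IsSolution γ k (u i)) :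
    IsSolution γ k fun p => ∑ i ∈ s, a i * u i p := by
  classical
  induction s using Finset.induction_on with
  | empty => simpa using isSolution_zero
  | insert i s hi ih =>
    simp only [Finset.sum_insert hi]
    exact ((hu i).const_mul (a i)).add hγ ih

/-- The propagating amplitudes of an outgoing solution vanish. -/
theorem IsSolution.outgoing {N : ℕ} (hγ : IsMedium γ L) (hL : 0 < L) (hk0 : 0 < k)
    (hk1 : N * Real.pi < k) (hk : k < (N + 1) * Real.pi) {e : ℝ × ℝ → ℂ} (he : IsSolution γ k e)
    {c d : ℕ → ℂ}
    (hc : ∀ n, ∀ᵐ x : ℝ, x ∈ Ioi L → coef e n x = c n * Complex.exp (muOut k n * 1 * (x - L)))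
    (hd : ∀ n, ∀ᵐ x : ℝ, x ∈ Ioi L →
      coef (fun p => e (refl p)) n x = d n * Complex.exp (muOut k n * 1 * (x - L))) :
    (∀ n ≤ N, d n = 0) ∧ ExpDecayLeft L e := by
  obtain ⟨ex, ey, hs⟩ := isSolution_iff.1 he
  have hB : IsPhase (fun _ => (1:ℂ)) := ⟨measurable_const, fun _ => norm_one⟩
  have hμ := isExponent_muOut hk0 hk1 hk
  have hr := hs.extForm hγ hL hB hk0 hk1 hk (e₀ := 1) (by simp) (by simp) (fun _ _ _ => rfl)
    (fun _ _ => by simp) hμ hc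
  have hl := hs.reflect.extForm hγ.reflect hL hB hk0 hk1 hk (e₀ := 1) (by simp) (by simp)
    (fun _ _ _ => rfl) (fun _ _ => by simp) hμ hd
  have hE : BiExt γ L k N c (muOut k) d (muOut k) e ex ey := ⟨hs, hr, hl⟩
  -- With outgoing exponents on both sides all terms of the balance are nonnegative, so each of them
  -- vanishes.
  have hfl := hE.flux hγ hL (fun n hn => (muOut_re_im hk1 hn).1) (fun n hn => (muOut_re_im hk1 hn).1)
  have hd0 : ∀ n ≤ N, d n = 0 := fun n hn => by
    have him := (muOut_re_im hk1 hn).2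
    have h0 := (Finset.sum_eq_zero_iff_of_nonneg fun m hm => by
      have := (muOut_re_im hk1 (n := m) (by rw [Finset.mem_range] at hm; omega)).2
      positivity).1 hfl n (by rw [Finset.mem_range]; omega)
    have h1 : 0 ≤ (muOut k n).im * ‖c n‖ ^ 2 := by positivity
    have h2 : 0 ≤ (muOut k n).im * ‖d n‖ ^ 2 := by positivity
    have h3 : (muOut k n).im * ‖d n‖ ^ 2 = 0 := by linarith
    have h4 := (mul_eq_zero.1 h3).resolve_left him.ne'
    exact norm_eq_zero.1 (pow_eq_zero_iff two_ne_zero |>.1 h4)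
  refine ⟨hd0, expDecayLeft_of_refl (expDecayRight_of_ext hl.data hl.eq fun p => ?_)⟩
  rw [Finset.sum_eq_zero, sub_zero]
  intro n hn
  rw [extTerm, hd0 n (by rw [Finset.mem_range] at hn; omega)]
  simp

end Linear

/-! ### The trace -/

section Trace

variable {k : ℝ} {N : ℕ} {d μ : ℕ → ℂ} {e₀ : ℂ} {L : ℝ} {w wx wy : ℝ × ℝ → ℂ}

lemma modalCoeff_modeSeries_zero (h : Summable fun n => ‖d n‖) (n : ℕ) :
    modalCoeff (modeSeries d μ 0) n = d n := by
  have := modalCoeff_tsum_phi h n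
  unfold modeSeries
  simpa only [mul_zero, Complex.exp_zero, mul_one] using this

lemma memLp_nu_of_continuous {f : ℝ → ℂ} (hf : Continuous f) : MemLp f 2 nu := by
  obtain ⟨M, hM⟩ := isCompact_Icc.exists_bound_of_continuousOn (s := Icc (0:ℝ) 1) hf.continuousOn
  refine MemLp.of_bound hf.aestronglyMeasurable M ?_
  exact (ae_restrict_mem measurableSet_Ioo).mono fun y hy => hM y ⟨hy.1.le, hy.2.le⟩

/-- Green's formula on the left of `x = -L`, for a function given by a series there. -/
lemma ExtForm.integral_left (h : ExtForm k N d μ e₀ L (fun p => w (refl p))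
    (fun p => -wx (refl p)) (fun p => wy (refl p))) {φ : ℝ × ℝ → ℂ} (hφ : IsTest φ) :
    ∫ p in strip ∩ {p | p.1 < -L}, (w p * dx φ p + wx p * φ p) =
      ∫ y, modeSeries d μ 0 y * φ (-L, y) ∂nu := by
  have hset : refl ⁻¹' (strip ∩ {p | p.1 < -L}) = rightPart L := by
    ext p
    simp [refl, strip, rightPart]
  rw [← measurePreserving_refl.setIntegral_preimage_emb measurableEmbedding_refl, hset]
  have h1 := h.data.integral_trace L hφ.reflect
  rw [← neg_eq_iff_eq_neg, ← integral_neg] at h1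
  rw [show (∫ y, modeSeries d μ 0 y * φ (-L, y) ∂nu) =
    ∫ y, modeSeries d μ 0 y * φ (refl (L, y)) ∂nu from rfl, ← h1]
  refine integral_congr_ae ?_
  filter_upwards [h.eq, h.eq_x] with p h2 h3
  rw [← h2, ← h3, dx_refl hφ]
  ring

lemma ExtForm.isTraceAt (hw : IsH1 w wx wy) (h : ExtForm k N d μ e₀ L (fun p => w (refl p))
    (fun p => -wx (refl p)) (fun p => wy (refl p))) : IsTraceAt (-L) w (modeSeries d μ 0) :=
  ⟨memLp_nu_of_continuous (continuous_modeSeries_zero h.data.summable_norm), wx, wy, hw,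
    fun _ hφ => h.integral_left hφ⟩

lemma exists_isTest1_eq_one (x : ℝ) : ∃ ψ, IsTest1 ψ ∧ ψ x = 1 := by
  let b : ContDiffBump x := ⟨1, 2, one_pos, one_lt_two⟩
  refine ⟨fun t => (b t : ℂ), ⟨Complex.ofRealCLM.contDiff.comp b.contDiff,
    b.hasCompactSupport.comp_left (g := fun r : ℝ => (r : ℂ)) (by simp)⟩, ?_⟩
  have : b x = 1 := b.one_of_mem_closedBall (Metric.mem_closedBall_self zero_le_one)
  simp [this]

/-- The modal coefficients of the trace. -/
lemma ExtForm.modalCoeff_trace (hw : IsH1 w wx wy)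
    (h : ExtForm k N d μ e₀ L (fun p => w (refl p)) (fun p => -wx (refl p))
      (fun p => wy (refl p))) {τ : ℝ → ℂ} (hτ : IsTraceAt (-L) w τ) (n : ℕ) :
    modalCoeff τ n = d n := by
  obtain ⟨hτ2, wx', wy', hw', hG⟩ := hτ
  -- A test function equal to φ_n on the cross-section x = -L extracts the n-th coefficient from
  -- Green's formula.
  obtain ⟨ψ, hψ, hψ1⟩ := exists_isTest1_eq_one (-L)
  set φ := tensor ψ (fun y => ((phi n y * plateau y : ℝ) : ℂ)) with hφdef
  have hφ : IsTest φ := isTest_tensor hψ (isTest1_mul_plateau (contDiff_phi n))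
  have hval : ∀ y ∈ Ioo (0:ℝ) 1, φ (-L, y) = (phi n y : ℂ) := fun y hy => by
    simp only [hφdef, tensor]
    rw [hψ1, plateau_eq_one (by linarith [hy.1]) (by linarith [hy.2])]
    simp
  have h1 := hG φ hφ
  have h2 := h.integral_left hφ
  -- The trace comes with its own weak gradient, which agrees almost everywhere with the given one.
  have hgrad := (hw'.isH1Loc.grad_unique hw.isH1Loc).1
  have hgrad' := ae_restrict_of_ae_restrict_of_subset
    (inter_subset_left (s := strip) (t := {p : ℝ × ℝ | p.1 < -L})) hgrad
  have h3 : ∫ p in strip ∩ {p | p.1 < -L}, (w p * dx φ p + wx' p * φ p) =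
      ∫ p in strip ∩ {p | p.1 < -L}, (w p * dx φ p + wx p * φ p) :=
    integral_congr_ae (hgrad'.mono fun p hp => by simp only [hp])
  rw [h3, h2] at h1
  rw [← modalCoeff_modeSeries_zero (μ := μ) h.data.summable_norm n]
  have hc : ∀ f : ℝ → ℂ, ∫ y, f y * φ (-L, y) ∂nu = modalCoeff f n := fun f =>
    setIntegral_congr_fun measurableSet_Ioo fun y hy => by simp only [hval y hy]
  rw [← hc, ← hc]
  exact h1.symm

end Trace

/-! ### Analytic continuation -/

/-- Normal convergence on bounded parts of Re ζ > 0: evanescent exponentials are at most 1 there,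
and the finitely many others are bounded on each ball. -/
lemma differentiableOn_modeSeries {k : ℝ} {N : ℕ} {c μ : ℕ → ℂ} (hμ : IsExponent k N μ)
    (hc : Summable fun n => ‖c n‖) (y : ℝ) :
    DifferentiableOn ℂ (fun ζ => modeSeries c μ ζ y) {ζ | 0 < ζ.re} := by
  intro ζ₀ hζ₀
  set R := ‖ζ₀‖ + 1
  set M : ℝ := ∑ n ∈ Finset.range (N + 1), Real.exp (‖μ n‖ * R) + 1
  have hU : IsOpen ({ζ : ℂ | 0 < ζ.re} ∩ Metric.ball 0 R) :=
    (isOpen_lt continuous_const Complex.continuous_re).inter Metric.isOpen_ball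
  have hmem : ζ₀ ∈ {ζ : ℂ | 0 < ζ.re} ∩ Metric.ball 0 R := ⟨hζ₀, by simp [R]⟩
  have hs0 : 0 ≤ ∑ n ∈ Finset.range (N + 1), Real.exp (‖μ n‖ * R) :=
    Finset.sum_nonneg fun n _ => (Real.exp_pos _).le
  have hd : DifferentiableOn ℂ (fun ζ => ∑' n, c n * Complex.exp (μ n * ζ) * (phi n y : ℂ))
      ({ζ : ℂ | 0 < ζ.re} ∩ Metric.ball 0 R) := by
    refine Complex.differentiableOn_tsum_of_summable_norm (u := fun n => ‖c n‖ * M * 2)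
      ((hc.mul_right _).mul_right _) (fun n => by fun_prop) hU fun n ζ hζ => ?_
    have h1 : ‖Complex.exp (μ n * ζ)‖ ≤ M := by
      rw [Complex.norm_exp]
      by_cases hn : n ≤ N
      · have h2 : Real.exp (μ n * ζ).re ≤ Real.exp (‖μ n‖ * R) := by
          refine Real.exp_le_exp.2 ((Complex.re_le_norm _).trans ?_)
          rw [norm_mul]
          have : ‖ζ‖ < R := by simpa using hζ.2
          gcongr
        have h3 := Finset.single_le_sum (f := fun n => Real.exp (‖μ n‖ * R))
          (fun i _ => (Real.exp_pos _).le) (Finset.mem_range.2 (Nat.lt_succ_of_le hn))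
        linarith
      · rw [hμ.tail n (not_le.1 hn)]
        have h2 : Real.exp (-(rate k n : ℂ) * ζ).re ≤ 1 := by
          rw [Real.exp_le_one_iff, neg_mul, Complex.neg_re, Complex.re_ofReal_mul]
          have h4 := rate_nonneg k n
          have h5 : 0 < ζ.re := hζ.1
          have := mul_nonneg h4 h5.le
          linarith
        linarith
    rw [norm_mul, norm_mul]
    have := norm_phi_le n y
    gcongr
  exact ((hd ζ₀ hmem).differentiableAt (hU.mem_nhds hmem)).differentiableWithinAt

lemma exp_mul_I_re_im {θ : ℝ} :
    (Complex.exp (Complex.I * θ)).re = Real.cos θ ∧ (Complex.exp (Complex.I * θ)).im = Real.sin θ ∧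
    (Complex.exp (-(Complex.I * θ))).re = Real.cos θ ∧
    (Complex.exp (-(Complex.I * θ))).im = -Real.sin θ := by
  have h : -(Complex.I * θ) = ((-θ : ℝ) : ℂ) * Complex.I := by push_cast; ring
  have h' : Complex.I * θ = (θ : ℂ) * Complex.I := by ring
  rw [h, h']
  simp only [Complex.exp_ofReal_mul_I_re, Complex.exp_ofReal_mul_I_im, Real.cos_neg, Real.sin_neg]
  tauto

/-- The analytic continuation of the two exterior series. -/
def continuation (L : ℝ) (c μ d μ' : ℕ → ℂ) (w : ℝ × ℝ → ℂ) (z : ℂ) (y : ℝ) : ℂ :=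
  if L < z.re then modeSeries c μ (z - L) y
  else if z.re < -L then modeSeries d μ' (-z - L) y else w (z.re, y)

section Unscaled

variable {k : ℝ} {N : ℕ} {c d μ μ' : ℕ → ℂ} {L θ : ℝ} {w wx wy : ℝ × ℝ → ℂ}

lemma continuation_ofReal (hL : 0 < L) (p : ℝ × ℝ) :
    continuation L c μ d μ' w (p.1 : ℂ) p.2 = unscaled L c μ d μ' w p := by
  simp only [continuation, unscaled, glue, Complex.ofReal_re, ext_eq_modeSeries, one_mul, refl]
  by_cases h1 : L < p.1
  · rw [if_pos h1, if_neg (by linarith), if_pos h1]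
  · by_cases h2 : p.1 < -L
    · rw [if_neg h1, if_pos h2, if_pos (by linarith)]
      push_cast
      rfl
    · rw [if_neg h1, if_neg h2, if_neg (by linarith), if_neg h1]

lemma differentiableOn_continuation (hL : 0 < L) (hμ : IsExponent k N μ) (hμ' : IsExponent k N μ')
    (hc : Summable fun n => ‖c n‖) (hd : Summable fun n => ‖d n‖) (y : ℝ) :
    DifferentiableOn ℂ (fun z => continuation L c μ d μ' w z y) {z | L < |z.re|} := by
  intro z hz
  refine DifferentiableAt.differentiableWithinAt ?_
  rcases lt_abs.1 (show L < |z.re| from hz) with h | h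
  · have hU : {z : ℂ | L < z.re} ∈ 𝓝 z :=
      (isOpen_lt continuous_const Complex.continuous_re).mem_nhds h
    have h1 := (differentiableOn_modeSeries hμ hc y).differentiableAt (x := z - L)
      ((isOpen_lt continuous_const Complex.continuous_re).mem_nhds (by simpa using h))
    refine (h1.comp z (f := fun z : ℂ => z - L) (by fun_prop)).congr_of_eventuallyEq ?_
    filter_upwards [hU] with ζ hζ
    exact if_pos hζ
  · have hU : {z : ℂ | z.re < -L} ∈ 𝓝 z :=
      (isOpen_lt Complex.continuous_re continuous_const).mem_nhds (by
        show z.re < -L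
        linarith)
    have h1 := (differentiableOn_modeSeries hμ' hd y).differentiableAt (x := -z - L)
      ((isOpen_lt continuous_const Complex.continuous_re).mem_nhds (by simpa using h))
    refine (h1.comp z (f := fun z : ℂ => -z - L) (by fun_prop)).congr_of_eventuallyEq ?_
    filter_upwards [hU] with ζ hζ
    have h2 : ζ.re < -L := hζ
    simp only [continuation, Function.comp_def]
    rw [if_neg (by linarith), if_pos h2]

lemma scalingMap_right (hL : 0 < L) {x : ℝ} (hx : L < x) :
    scalingMap L θ x = L + (x - L) * Complex.exp (Complex.I * θ) := by
  rw [scalingMap, if_neg (by linarith), if_pos hx.le]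

lemma scalingMap_left {x : ℝ} (hx : x < -L) :
    scalingMap L θ x = -L + (x + L) * Complex.exp (-(Complex.I * θ)) := by
  rw [scalingMap, if_pos hx.le]

lemma scalingMap_middle {x : ℝ} (hx : |x| < L) : scalingMap L θ x = x := by
  rw [abs_lt] at hx
  rw [scalingMap, if_neg (by linarith), if_neg (by linarith)]

lemma scalingMap_right_re (hL : 0 < L) (hθ : 0 < Real.cos θ) {x : ℝ} (hx : L < x) :
    L < (scalingMap L θ x).re := by
  rw [scalingMap_right hL hx]
  have : ((L : ℂ) + (x - L) * Complex.exp (Complex.I * θ)).re = L + (x - L) * Real.cos θ := by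
    rw [← Complex.ofReal_sub, Complex.add_re, Complex.re_ofReal_mul, exp_mul_I_re_im.1,
      Complex.ofReal_re]
  rw [this]
  have := mul_pos (sub_pos.2 hx) hθ
  linarith

lemma scalingMap_left_re (hθ : 0 < Real.cos θ) {x : ℝ} (hx : x < -L) :
    (scalingMap L θ x).re < -L := by
  rw [scalingMap_left hx]
  have : (-(L : ℂ) + (x + L) * Complex.exp (-(Complex.I * θ))).re = -L + (x + L) * Real.cos θ := by
    rw [← Complex.ofReal_add, Complex.add_re, Complex.re_ofReal_mul, exp_mul_I_re_im.2.2.1,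
      Complex.neg_re, Complex.ofReal_re]
  rw [this]
  have := mul_pos (show 0 < -(x + L) by linarith) hθ
  linarith

/-- Beyond the interfaces J_θ(x) - L, respectively -J_θ(x) - L, is the outward distance times
e^{iθ}, respectively e^{-iθ}. The scaled expansions are therefore the continuation read on the
rotated half-lines. -/
lemma ae_continuation_scalingMap (hL : 0 < L) (hθ : 0 < Real.cos θ)
    (hr : ExtForm k N c μ (Complex.exp (Complex.I * θ)) L w wx wy)
    (hl : ExtForm k N d μ' (Complex.exp (-(Complex.I * θ))) L (fun p => w (refl p))
      (fun p => -wx (refl p)) (fun p => wy (refl p))) :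
    ∀ᵐ p ∂(volume.restrict strip),
      w p = continuation L c μ d μ' w (scalingMap L θ p.1) p.2 := by
  have h1 := ae_restrict_of_ae (s := strip) ((ae_restrict_iff' (measurableSet_rightPart L)).1 hr.eq)
  have h2 := ae_strip_refl (ae_restrict_of_ae (s := strip)
    ((ae_restrict_iff' (measurableSet_rightPart L)).1 hl.eq))
  filter_upwards [h1, h2, ae_restrict_of_ae (ae_fst_ne L), ae_restrict_of_ae (ae_fst_ne (-L)),
    ae_restrict_mem measurableSet_strip] with p a1 a2 a3 a4 a5
  rcases lt_trichotomy L p.1 with h | h | h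
  · rw [a1 ⟨a5, h⟩, continuation, if_pos (scalingMap_right_re hL hθ h), scalingMap_right hL h,
      ext_eq_modeSeries]
    congr 1
    ring
  · exact absurd h.symm a3
  rcases lt_trichotomy p.1 (-L) with h' | h' | h'
  · have h3 := a2 ⟨a5, by
      show L < -p.1
      linarith⟩
    rw [refl_refl] at h3
    have h4 := scalingMap_left_re hθ h'
    rw [h3, continuation, if_neg (by linarith), if_pos h4, scalingMap_left h', ext_eq_modeSeries]
    simp only [refl]
    congr 1
    push_cast
    ring
  · exact absurd h' a4
  · rw [scalingMap_middle (abs_lt.2 ⟨h', h⟩), continuation, Complex.ofReal_re,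
      if_neg (by linarith), if_neg (by linarith)]

lemma isUnscaled_unscaled (hL : 0 < L) (hθ : 0 < Real.cos θ)
    (hr : ExtForm k N c μ (Complex.exp (Complex.I * θ)) L w wx wy)
    (hl : ExtForm k N d μ' (Complex.exp (-(Complex.I * θ))) L (fun p => w (refl p))
      (fun p => -wx (refl p)) (fun p => wy (refl p))) :
    IsUnscaled L θ w (unscaled L c μ d μ' w) :=
  ⟨continuation L c μ d μ' w, fun y _ => differentiableOn_continuation hL hr.data.exponent
    hl.data.exponent hr.data.summable_norm hl.data.summable_norm y,
    ae_continuation_scalingMap hL hθ hr hl,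
    Eventually.of_forall fun p => (continuation_ofReal hL p).symm⟩

/-- Two holomorphic functions on a half-plane that agree at almost every point of a half-line. -/
lemma eqOn_of_ae_halfLine {f g : ℂ → ℂ} {V : Set ℂ} (hV : IsOpen V) (hVc : IsPreconnected V)
    (hf : DifferentiableOn ℂ f V) (hg : DifferentiableOn ℂ g V) {I : Set ℝ} (hI : IsOpen I)
    {s : ℝ → ℂ} (hs : Continuous s) (hinj : Function.Injective s) {x₀ : ℝ} (hx₀ : x₀ ∈ I)
    (hsI : ∀ x ∈ I, s x ∈ V) (h : ∀ᵐ x : ℝ, x ∈ I → f (s x) = g (s x)) : EqOn f g V := by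
  refine (hf.analyticOnNhd hV).eqOn_of_preconnected_of_frequently_eq (hg.analyticOnNhd hV) hVc
    (hsI x₀ hx₀) ?_
  have h1 : ∃ᶠ x in 𝓝[≠] x₀, f (s x) = g (s x) := by
    have h2 : ∀ᶠ x in 𝓝[≠] x₀, x ∈ I := mem_nhdsWithin_of_mem_nhds (hI.mem_nhds hx₀)
    -- A property true almost everywhere holds on a dense set, so x₀ is a limit of other points
    -- where it holds. The identity theorem needs no more.
    have hd : Dense {x : ℝ | x ≠ x₀ ∧ (x ∈ I → f (s x) = g (s x))} := by
      refine Measure.dense_of_ae (μ := volume) ?_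
      filter_upwards [h, (by simp [ae_iff] : ∀ᵐ x : ℝ, x ≠ x₀)] with x a1 a2
      exact ⟨a2, a1⟩
    have h3 : ∃ᶠ x in 𝓝[≠] x₀, (x ∈ I → f (s x) = g (s x)) := by
      rw [frequently_nhdsWithin_iff]
      refine (mem_closure_iff_frequently.1 (hd x₀)).mono fun x hx => ⟨hx.2, hx.1⟩
    exact (h3.and_eventually h2).mono fun x hx => hx.1 hx.2
  have ht : Tendsto s (𝓝[≠] x₀) (𝓝[≠] (s x₀)) :=
    tendsto_nhdsWithin_of_tendsto_nhds_of_eventually_within _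
      (hs.continuousAt.tendsto.mono_left nhdsWithin_le_nhds)
      (eventually_nhdsWithin_of_forall fun x hx => fun hh => hx (hinj hh))
  exact ht.frequently h1

lemma ae_nu_ae_of_ae_strip {P : ℝ × ℝ → Prop} (h : ∀ᵐ p ∂(volume.restrict strip), P p) :
    ∀ᵐ y ∂nu, ∀ᵐ x : ℝ, P (x, y) := by
  rw [restrict_strip] at h
  exact Measure.ae_ae_of_ae_prod
    (Measure.measurePreserving_swap (μ := nu) (ν := (volume : Measure ℝ))
      |>.quasiMeasurePreserving.ae h)

/-- The unscaled function is unique. -/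
lemma IsUnscaled.ae_eq (hL : 0 < L) (hθ : 0 < Real.cos θ)
    (hr : ExtForm k N c μ (Complex.exp (Complex.I * θ)) L w wx wy)
    (hl : ExtForm k N d μ' (Complex.exp (-(Complex.I * θ))) L (fun p => w (refl p))
      (fun p => -wx (refl p)) (fun p => wy (refl p))) {u : ℝ × ℝ → ℂ} (hu : IsUnscaled L θ w u) :
    u =ᵐ[volume.restrict strip] unscaled L c μ d μ' w := by
  obtain ⟨U, hUd, hUw, hUu⟩ := hu
  set V := continuation L c μ d μ' w with hV
  have hVd := fun y => differentiableOn_continuation (w := w) hL hr.data.exponent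
    hl.data.exponent hr.data.summable_norm hl.data.summable_norm y
  have hUV : ∀ᵐ p ∂(volume.restrict strip),
      U (scalingMap L θ p.1) p.2 = V (scalingMap L θ p.1) p.2 := by
    filter_upwards [hUw, ae_continuation_scalingMap hL hθ hr hl] with p h1 h2
    rw [← h1, h2]
  -- For almost every y the two continuations agree at almost every point of each rotated half-line,
  -- hence on the whole open half-plane, which contains the real half-line.
  have key : ∀ᵐ y ∂nu, ∀ z : ℂ, L < |z.re| → U z y = V z y := by
    filter_upwards [ae_nu_ae_of_ae_strip hUV, ae_restrict_mem measurableSet_Ioo] with y hy hy01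
    intro z hz
    have hsub1 : {z : ℂ | L < z.re} ⊆ {z | L < |z.re|} := fun z hz =>
      show L < |z.re| from lt_abs.2 (Or.inl hz)
    have hsub2 : {z : ℂ | z.re < -L} ⊆ {z | L < |z.re|} := fun z hz => by
      have : z.re < -L := hz
      exact show L < |z.re| from lt_abs.2 (Or.inr (by linarith))
    have hne : ∀ a : ℂ, Complex.exp a ≠ 0 := Complex.exp_ne_zero
    rcases lt_abs.1 hz with h | h
    · refine eqOn_of_ae_halfLine (f := fun z => U z y) (g := fun z => V z y)
        (isOpen_lt continuous_const Complex.continuous_re)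
        (convex_halfSpace_re_gt L).isPreconnected ((hUd y hy01).mono hsub1) ((hVd y).mono hsub1)
        (isOpen_Ioi (a := L)) (s := fun x : ℝ => (L : ℂ) + (x - L) * Complex.exp (Complex.I * θ))
        (by fun_prop) (fun x x' hx => ?_) (x₀ := L + 1) (by simp) (fun x hx => ?_) ?_ h
      · have := mul_right_cancel₀ (hne _) (add_left_cancel hx)
        simpa using this
      · have h1 : L < x := hx
        rw [← scalingMap_right hL h1]
        exact scalingMap_right_re hL hθ h1
      · filter_upwards [hy] with x h1 h2
        rwa [scalingMap_right hL h2] at h1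
    · refine eqOn_of_ae_halfLine (f := fun z => U z y) (g := fun z => V z y)
        (isOpen_lt Complex.continuous_re continuous_const)
        (convex_halfSpace_re_lt (-L)).isPreconnected ((hUd y hy01).mono hsub2) ((hVd y).mono hsub2)
        (isOpen_Iio (a := -L))
        (s := fun x : ℝ => -(L : ℂ) + (x + L) * Complex.exp (-(Complex.I * θ)))
        (by fun_prop) (fun x x' hx => ?_) (x₀ := -L - 1) (by simp) (fun x hx => ?_) ?_
        (show z.re < -L by linarith)
      · have := mul_right_cancel₀ (hne _) (add_left_cancel hx)
        simpa using this
      · have h1 : x < -L := hx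
        rw [← scalingMap_left h1]
        exact scalingMap_left_re hθ h1
      · filter_upwards [hy] with x h1 h2
        rwa [scalingMap_left h2] at h1
  have key' : ∀ᵐ p ∂(volume.restrict strip), ∀ z : ℂ, L < |z.re| → U z p.2 = V z p.2 := by
    rw [restrict_strip]
    exact Measure.quasiMeasurePreserving_snd.ae key
  filter_upwards [hUu, hUV, key', ae_restrict_of_ae (ae_fst_ne L),
    ae_restrict_of_ae (ae_fst_ne (-L))] with p h1 h2 h3 h4 h5
  rw [h1, ← continuation_ofReal hL]
  rcases lt_trichotomy |p.1| L with h | h | h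
  · rwa [scalingMap_middle h] at h2
  · rcases eq_or_eq_neg_of_abs_eq h with h | h
    · exact absurd h h4
    · exact absurd h h5
  · exact h3 _ (by simpa using h)

end Unscaled

/-! ### Outgoing fields -/

/-- The modal coefficients of `f` are those of an outgoing field. -/
structure Outgoing (L k : ℝ) (f : ℝ × ℝ → ℂ) (c d : ℕ → ℂ) : Prop where
  slice : ∀ᵐ x : ℝ, MemLp (fun y => f (x, y)) 2 nu
  right : ∀ n, ∀ᵐ x : ℝ, x ∈ Ioi L → coef f n x = c n * Complex.exp (muOut k n * 1 * (x - L))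
  left : ∀ n, ∀ᵐ x : ℝ, x ∈ Ioi L →
    coef (fun p => f (refl p)) n x = d n * Complex.exp (muOut k n * 1 * (x - L))

section Outgoing

variable {L k : ℝ}

lemma coef_sub {f g : ℝ × ℝ → ℂ} {x : ℝ} (hf : MemLp (fun y => f (x, y)) 2 nu)
    (hg : MemLp (fun y => g (x, y)) 2 nu) (n : ℕ) :
    coef (fun p => f p - g p) n x = coef f n x - coef g n x :=
  modalCoeff_sub hf hg n

lemma Outgoing.sub {f g : ℝ × ℝ → ℂ} {c d c' d' : ℕ → ℂ} (hf : Outgoing L k f c d)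
    (hg : Outgoing L k g c' d') :
    Outgoing L k (fun p => f p - g p) (fun n => c n - c' n) (fun n => d n - d' n) where
  slice := by filter_upwards [hf.slice, hg.slice] with x h1 h2 using h1.sub h2
  right n := by
    filter_upwards [hf.slice, hg.slice, hf.right n, hg.right n] with x h1 h2 h3 h4 hx
    rw [coef_sub h1 h2, h3 hx, h4 hx, sub_mul]
  left n := by
    filter_upwards [ae_comp_neg hf.slice, ae_comp_neg hg.slice, hf.left n, hg.left n]
      with x h1 h2 h3 h4 hx
    rw [coef_sub (f := fun p => f (refl p)) (g := fun p => g (refl p)) h1 h2, h3 hx, h4 hx, sub_mul]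

lemma coef_const_mul (a : ℂ) (f : ℝ × ℝ → ℂ) (n : ℕ) (x : ℝ) :
    coef (fun p => a * f p) n x = a * coef f n x := by
  simp only [coef, modalCoeff, mul_assoc, integral_const_mul]

lemma Outgoing.const_mul {f : ℝ × ℝ → ℂ} {c d : ℕ → ℂ} (hf : Outgoing L k f c d) (a : ℂ) :
    Outgoing L k (fun p => a * f p) (fun n => a * c n) (fun n => a * d n) where
  slice := hf.slice.mono fun x h => h.const_mul a
  right n := by
    filter_upwards [hf.right n] with x h hx
    rw [coef_const_mul, h hx]
    ring
  left n := by
    filter_upwards [hf.left n] with x h hx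
    rw [coef_const_mul a fun p => f (refl p), h hx]
    ring

lemma outgoing_zero : Outgoing L k (fun _ => 0) (fun _ => 0) (fun _ => 0) where
  slice := Eventually.of_forall fun _ => MemLp.zero
  right n := Eventually.of_forall fun x _ => by simp [coef, modalCoeff]
  left n := Eventually.of_forall fun x _ => by simp [coef, modalCoeff]

lemma outgoing_sum {ι : Type*} (s : Finset ι) (a : ι → ℂ) {f : ι → ℝ × ℝ → ℂ} {c d : ι → ℕ → ℂ}
    (hf : ∀ i, Outgoing L k (f i) (c i) (d i)) :
    Outgoing L k (fun p => ∑ i ∈ s, a i * f i p) (fun n => ∑ i ∈ s, a i * c i n)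
      (fun n => ∑ i ∈ s, a i * d i n) := by
  classical
  induction s using Finset.induction_on with
  | empty => simpa using outgoing_zero
  | insert i s hi ih =>
    simp only [Finset.sum_insert hi]
    have := ((hf i).const_mul (a i)).sub (ih.const_mul (-1))
    simpa only [neg_one_mul, sub_neg_eq_add] using this

lemma continuous_incident {N : ℕ} (a : Fin (N + 1) → ℂ) : Continuous (incident k a) := by
  unfold incident modePlus
  have := fun n => (contDiff_phi n).continuous
  fun_prop

/-- The expansions in the definition are L² limits, so the coefficients can be read from them once
the slices of us are known to be square integrable, as differences of the total and incident fields.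
-/
lemma IsScatteredField.outgoing {γ : ℝ × ℝ → ℝ} {N : ℕ} {a : Fin (N + 1) → ℂ} {us : ℝ × ℝ → ℂ}
    {bm bp : ℕ → ℂ} (h : IsScatteredField γ L k a us bm bp) :
    Outgoing L k us (edgeAmp k L bp) (edgeAmp k L bm) := by
  have hs : ∀ᵐ x : ℝ, MemLp (fun y => us (x, y)) 2 nu := by
    filter_upwards [h.solution.l2Loc.memLp_slice] with x hx
    have hc := continuous_incident (k := k) a
    have := hx.sub (memLp_nu_of_continuous (f := fun y => incident k a (x, y)) (by fun_prop))
    refine this.congr_norm (hx.1.sub (memLp_nu_of_continuous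
      (f := fun y => incident k a (x, y)) (by fun_prop)).1 |>.congr ?_) ?_
    · exact Eventually.of_forall fun y => by simp
    · exact Eventually.of_forall fun y => by simp
  exact ⟨hs, fun n => h.right.coef hs n, fun n => h.left.refl.coef (ae_comp_neg hs) n⟩

/-- Uniqueness of the reflected propagating amplitudes, up to exponentially decaying terms. -/
lemma reflected_unique {γ : ℝ × ℝ → ℝ} {N : ℕ} (hγ : IsMedium γ L) (hL : 0 < L) (hk0 : 0 < k)
    (hk1 : N * Real.pi < k) (hk : k < (N + 1) * Real.pi) {f g : ℝ × ℝ → ℂ} {c c' : ℕ → ℂ}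
    {b b' : ℕ → ℂ} (hf : Outgoing L k f c (edgeAmp k L b)) (hg : Outgoing L k g c' (edgeAmp k L b'))
    (hs : IsSolution γ k fun p => f p - g p) :
    (∀ n ≤ N, b n = b' n) ∧ ExpDecayLeft L fun p => f p - g p := by
  have ho := hf.sub hg
  obtain ⟨h1, h2⟩ := hs.outgoing hγ hL hk0 hk1 hk ho.right ho.left
  refine ⟨fun n hn => ?_, h2⟩
  have h3 := h1 n hn
  simp only [edgeAmp, ← sub_mul] at h3
  have h4 := (mul_eq_zero.1 h3).resolve_right (Complex.exp_ne_zero _)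
  have h5 := (mul_eq_zero.1 h4).resolve_right (inv_ne_zero (normFactor_ne_zero hk0 hk1 hk n))
  exact sub_eq_zero.1 h5

end Outgoing

/-! ### The unscaled eigenfunction -/

lemma ScaledSol.congr {γ : ℝ × ℝ → ℝ} {B : ℝ → ℂ} {k : ℝ} {w w' wx wy : ℝ × ℝ → ℂ}
    (h : ScaledSol γ B k w wx wy) (hw : w' =ᵐ[volume.restrict strip] w) :
    ScaledSol γ B k w' wx wy := by
  refine ⟨⟨fun r => ?_, h.h1.memLp_x, h.h1.memLp_y, fun v hv hs => ?_⟩, fun v hv => ?_⟩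
  · exact (memLp_congr_ae (ae_restrict_of_ae_restrict_of_subset inter_subset_left hw)).2
      (h.h1.memLp r)
  · rw [← (h.h1.grad v hv hs).1, ← (h.h1.grad v hv hs).2]
    exact ⟨integral_congr_ae (hw.mono fun p hp => by simp only [hp]),
      integral_congr_ae (hw.mono fun p hp => by simp only [hp])⟩
  · rw [← h.weak v hv]
    exact integral_congr_ae (hw.mono fun p hp => by simp only [hp])

section BiExt

variable {γ : ℝ × ℝ → ℝ} {L k : ℝ} {N : ℕ} {c μ d μ' : ℕ → ℂ} {u ux uy : ℝ × ℝ → ℂ}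

lemma BiExt.congr (h : BiExt γ L k N c μ d μ' u ux uy) {u' : ℝ × ℝ → ℂ}
    (hu : u' =ᵐ[volume.restrict strip] u) : BiExt γ L k N c μ d μ' u' ux uy := by
  refine ⟨h.sol.congr hu, ⟨h.right.data, ?_, h.right.eq_x, h.right.eq_y⟩,
    ⟨h.left.data, ?_, h.left.eq_x, h.left.eq_y⟩⟩
  · exact EventuallyEq.trans (ae_restrict_of_ae_restrict_of_subset inter_subset_left hu) h.right.eq
  · have hr : (fun p => u' (refl p)) =ᵐ[volume.restrict strip] fun p => u (refl p) :=
      ae_strip_refl hu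
    exact EventuallyEq.trans (ae_restrict_of_ae_restrict_of_subset inter_subset_left hr) h.left.eq

lemma BiExt.isSolution (h : BiExt γ L k N c μ d μ' u ux uy) : IsSolution γ k u :=
  isSolution_iff.2 ⟨ux, uy, h.sol⟩

/-- The strip is covered by a bounded piece and two ends, and only evanescent modes remain in the
ends. -/
lemma BiExt.memLp (h : BiExt γ L k N c μ d μ' u ux uy) (hc : ∀ n ≤ N, c n = 0)
    (hd : ∀ n ≤ N, d n = 0) : MemLp u 2 (volume.restrict strip) := by
  have hm := h.sol.h1.l2Loc.aestronglyMeasurable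
  have hmr : ∀ {f : ℝ × ℝ → ℂ}, L2Loc f → AEStronglyMeasurable f (volume.restrict (rightPart L)) :=
    fun hf => hf.aestronglyMeasurable.mono_measure (Measure.restrict_mono inter_subset_left le_rfl)
  have m1 := memLp_rightPart_of_ext h.right.data h.right.eq (hmr h.sol.h1.l2Loc) hc
  have m2 := memLp_rightPart_of_ext h.left.data h.left.eq (hmr h.sol.h1.l2Loc.reflect) hd
  have m3 := h.sol.h1.l2Loc (L + 1)
  have m2' : MemLp u 2 (volume.restrict (refl ⁻¹' rightPart L)) := by
    have := m2.comp_measurePreserving (measurePreserving_refl_restrict (rightPart L))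
    simpa only [Function.comp_def, refl_refl] using this
  have i1 : IntegrableOn (fun p => ‖u p‖ ^ 2) (rightPart L) := m1.integrable_norm_pow two_ne_zero
  have i2 : IntegrableOn (fun p => ‖u p‖ ^ 2) (refl ⁻¹' rightPart L) :=
    m2'.integrable_norm_pow two_ne_zero
  have i3 : IntegrableOn (fun p => ‖u p‖ ^ 2) (strip ∩ {p | |p.1| < L + 1}) :=
    m3.integrable_norm_pow two_ne_zero
  rw [memLp_two_iff_integrable_sq_norm hm]
  refine ((i1.union i2).union i3).mono_set fun p hp => ?_
  by_cases h1 : L < p.1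
  · exact Or.inl (Or.inl ⟨hp, h1⟩)
  · by_cases h2 : L < -p.1
    · exact Or.inl (Or.inr ⟨hp, h2⟩)
    · refine Or.inr ⟨hp, ?_⟩
      show |p.1| < L + 1
      rw [abs_lt]
      constructor <;> linarith

lemma incident_modeCoeff (hk0 : 0 < k) (hk1 : N * Real.pi < k) (hk : k < (N + 1) * Real.pi)
    (c : ℕ → ℂ) (p : ℝ × ℝ) : incident k (fun n : Fin (N + 1) => modeCoeff k L c n) p =
      ∑ n ∈ Finset.range (N + 1), extTerm c (muOut k) 1 L n p := by
  rw [incident, Finset.sum_range]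
  refine Finset.sum_congr rfl fun n _ => ?_
  rw [← extTerm_edgeAmp L, edgeAmp_modeCoeff hk0 hk1 hk]

/-- The incident amplitudes associated with the coefficients `d` of the trace at `x = -L`. -/
def incAmp (k L : ℝ) (N : ℕ) (d : ℕ → ℂ) (n : Fin (N + 1)) : ℂ :=
  normFactor k n * Complex.exp (Complex.I * beta k n * (L : ℂ)) * d n

/-- In the reflected variable the exponent -iβ_n is the wave e^{iβ_n x}: the propagating amplitudes
on the left are those of incident waves. -/
lemma incAmp_mul_modePlus (hk0 : 0 < k) (hk1 : N * Real.pi < k) (hk : k < (N + 1) * Real.pi)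
    (d : ℕ → ℂ) (n : Fin (N + 1)) (p : ℝ × ℝ) :
    incAmp k L N d n * modePlus k n p = extTerm d (muIn k N) 1 L n (refl p) := by
  have hn := normFactor_ne_zero hk0 hk1 hk n
  rw [incAmp, modePlus, extTerm, muIn, if_pos (Nat.lt_succ_iff.1 n.2)]
  have h1 : (((Real.sqrt (2 * ‖beta k n‖))⁻¹ : ℝ) : ℂ) = (normFactor k n)⁻¹ := by
    rw [normFactor]; push_cast; rfl
  have h2 : Complex.exp (-(Complex.I * beta k n) * 1 * (((refl p).1 : ℂ) - L)) =
      Complex.exp (Complex.I * beta k n * L) * Complex.exp (Complex.I * beta k n * p.1) := by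
    rw [← Complex.exp_add]
    congr 1
    simp only [refl]
    push_cast
    ring
  rw [h1, h2]
  simp only [refl]
  field_simp

lemma incident_incAmp (hk0 : 0 < k) (hk1 : N * Real.pi < k) (hk : k < (N + 1) * Real.pi)
    (d : ℕ → ℂ) (p : ℝ × ℝ) : incident k (incAmp k L N d) p =
      ∑ n ∈ Finset.range (N + 1), extTerm d (muIn k N) 1 L n (refl p) := by
  rw [incident, Finset.sum_range]
  exact Finset.sum_congr rfl fun n _ => incAmp_mul_modePlus hk0 hk1 hk d n p

lemma BiExt.expDecayLeft_sub_incident (hk1 : N * Real.pi < k)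
    (h : BiExt γ L k N c (muOut k) d (muIn k N) u ux uy) :
    ExpDecayLeft L fun p => u p - incident k (incAmp k L N d) p := by
  refine expDecayLeft_of_refl (expDecayRight_of_ext h.left.data h.left.eq fun p => ?_)
  rw [incident_incAmp h.right.data.pos hk1 h.right.data.lt, refl_refl]

lemma BiExt.isReflectionlessMode (hk1 : N * Real.pi < k)
    (h : BiExt γ L k N c (muOut k) d (muIn k N) u ux uy) (ha : incAmp k L N d ≠ 0) :
    IsReflectionlessMode γ L k N u := by
  refine ⟨h.isSolution, incAmp k L N d, fun n => modeCoeff k L c n, ha,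
    h.expDecayLeft_sub_incident hk1, expDecayRight_of_ext h.right.data h.right.eq fun p => ?_⟩
  rw [incident_modeCoeff h.right.data.pos hk1 h.right.data.lt]

/-- The unscaled eigenfunction is a total field without reflected propagating waves. -/
lemma BiExt.exists_isScatteredField (hk1 : N * Real.pi < k)
    (h : BiExt γ L k N c (muOut k) d (muIn k N) u ux uy) :
    ∃ bm bp, (∀ n ≤ N, bm n = 0) ∧ IsScatteredField γ L k (incAmp k L N d)
      (fun p => u p - incident k (incAmp k L N d) p) bm bp := by
  have hk0 := h.right.data.pos
  have hk := h.right.data.lt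
  -- On the left the whole propagating part of u is the incident field, so the reflected
  -- coefficients are 0 for n ≤ N; the others are the evanescent amplitudes of u.
  refine ⟨fun n => if n ≤ N then 0 else modeCoeff k L d n, _, fun n hn => if_pos hn, ?_, ?_,
    ExpandsRight.sub_incident (b := modeCoeff k L c) ?_ _⟩
  · simpa only [add_sub_cancel] using h.isSolution
  · refine ExpandsRight.refl ?_
    have := h.left.data.tendsto_slice h.left.eq
    filter_upwards [this, (by simp [ae_iff] : ∀ᵐ x : ℝ, x ≠ L)] with x hx hne hxL
    refine (hx (lt_of_le_of_ne hxL (Ne.symm hne))).congr' ?_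
    filter_upwards [eventually_ge_atTop (N + 1)] with M hM
    congr 1
    funext y
    rw [incident_incAmp hk0 hk1 hk, refl_refl, sub_sub,
      ← Finset.sum_range_add_sum_Ico _ hM, ← Finset.sum_range_add_sum_Ico (fun n =>
        (if n ≤ N then 0 else modeCoeff k L d n) * modePlus k n (x, y)) hM]
    congr 2
    have hz : ∑ n ∈ Finset.range (N + 1),
        (if n ≤ N then 0 else modeCoeff k L d n) * modePlus k n (x, y) = 0 :=
      Finset.sum_eq_zero fun n hn => by
        rw [if_pos (by rw [Finset.mem_range] at hn; omega), zero_mul]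
    rw [hz, zero_add]
    refine Finset.sum_congr rfl fun n hn => ?_
    have hn' : N < n := by
      rw [Finset.mem_Ico] at hn; omega
    rw [if_neg (not_le.2 hn'), ← extTerm_edgeAmp L, edgeAmp_modeCoeff hk0 hk1 hk, extTerm,
      extTerm, muIn_eq_of_lt k hn']
  · have := h.right.data.tendsto_slice h.right.eq
    filter_upwards [this, (by simp [ae_iff] : ∀ᵐ x : ℝ, x ≠ L)] with x hx hne hxL
    have h1 := hx (lt_of_le_of_ne hxL (Ne.symm hne))
    have h2 : ∀ n p, extTerm c (muOut k) 1 L n p = modeCoeff k L c n * modePlus k n p :=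
      fun n p => by rw [← extTerm_edgeAmp L, edgeAmp_modeCoeff hk0 hk1 hk]
    simpa only [h2] using h1

/-- Vanishing incoming amplitudes force the outgoing ones to vanish. -/
lemma BiExt.outgoing_eq_zero (hγ : IsMedium γ L) (hL : 0 < L) (hk1 : N * Real.pi < k)
    (h : BiExt γ L k N c (muOut k) d (muIn k N) u ux uy) (hd : ∀ n ≤ N, d n = 0) :
    ∀ n ≤ N, c n = 0 := by
  have hfl := h.flux hγ hL (fun n hn => (muOut_re_im hk1 hn).1) (fun n hn => by
    rw [muIn_eq k hn, Complex.neg_re, (muOut_re_im hk1 hn).1, neg_zero])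
  have hfl2 : ∑ n ∈ Finset.range (N + 1), (muOut k n).im * ‖c n‖ ^ 2 = 0 := by
    rw [← hfl]
    refine Finset.sum_congr rfl fun n hn => ?_
    rw [hd n (by rw [Finset.mem_range] at hn; omega)]
    simp
  intro n hn
  have h0 := (Finset.sum_eq_zero_iff_of_nonneg fun m hm => by
    have := (muOut_re_im hk1 (n := m) (by rw [Finset.mem_range] at hm; omega)).2
    positivity).1 hfl2 n (by rw [Finset.mem_range]; omega)
  have h4 := (mul_eq_zero.1 h0).resolve_left (muOut_re_im hk1 hn).2.ne'
  exact norm_eq_zero.1 (pow_eq_zero_iff two_ne_zero |>.1 h4)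

lemma ExtForm.eq_zero {e₀ : ℂ} (h : ExtForm k N c μ e₀ L u ux uy)
    (hu : u =ᵐ[volume.restrict strip] 0) : c = 0 := by
  funext n
  have h0 : u =ᵐ[(volume.restrict (Ioi L)).prod nu] 0 := by
    rw [← restrict_rightPart]
    exact ae_restrict_of_ae_restrict_of_subset inter_subset_left hu
  have : ∀ᵐ x ∂(volume.restrict (Ioi L)), c n = 0 := by
    filter_upwards [h.coef n, coef_congr_ae h0 n] with x h1 h2
    have h3 : Waveguide.coef (0 : ℝ × ℝ → ℂ) n x = 0 := by simp [Waveguide.coef, modalCoeff]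
    rw [h2, h3] at h1
    exact (mul_eq_zero.1 h1.1.symm).resolve_right (Complex.exp_ne_zero _)
  have hne : (ae (volume.restrict (Ioi L))).NeBot := by
    rw [ae_neBot, Ne, Measure.restrict_eq_zero]
    simp
  exact this.exists.choose_spec

end BiExt

/-- Modal expansions of an eigenfunction, and of its unscaled function. -/
lemma IsEigenpairB.exists_extForm {γ : ℝ × ℝ → ℝ} {L θ k : ℝ} {N : ℕ} (hγ : IsMedium γ L)
    (hL : 0 < L) (hθ0 : 0 < θ) (hθ1 : θ < Real.pi / 2) (hk1 : N * Real.pi < k)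
    (hk : k < (N + 1) * Real.pi) {w : ℝ × ℝ → ℂ}
    (h : IsEigenpairB γ L θ ((k ^ 2 : ℝ) : ℂ) w) :
    ∃ wx wy, IsH1 w wx wy ∧ ∃ c d,
      ExtForm k N c (muOut k) (Complex.exp (Complex.I * θ)) L w wx wy ∧
      ExtForm k N d (muIn k N) (Complex.exp (-(Complex.I * θ))) L (fun p => w (refl p))
        (fun p => -wx (refl p)) (fun p => wy (refl p)) ∧
      ∃ ux uy, BiExt γ L k N c (muOut k) d (muIn k N)
        (unscaled L c (muOut k) d (muIn k N) w) ux uy := by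
  obtain ⟨wx, wy, hH, hs⟩ := h.exists_scaledSol hγ
  have hk0 : 0 < k := lt_of_le_of_lt (by positivity) hk1
  have hcos : 0 < Real.cos θ := Real.cos_pos_of_mem_Ioo ⟨by linarith, hθ1⟩
  have hsin : 0 < Real.sin θ := Real.sin_pos_of_pos_of_lt_pi hθ0 (by linarith [Real.pi_pos])
  obtain ⟨r1, i1, r2, i2⟩ := exp_mul_I_re_im (θ := θ)
  have hP := isPhase_scalingCoeff L θ
  have n1 : ‖Complex.exp (Complex.I * θ)‖ = 1 := by
    rw [mul_comm]; exact Complex.norm_exp_ofReal_mul_I θ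
  have n2 : ‖Complex.exp (-(Complex.I * θ))‖ = 1 := by
    rw [Complex.exp_neg, norm_inv, n1, inv_one]
  have b0 : ∀ x : ℝ, |x| < L → scalingCoeff L θ x = 1 := fun x hx => by
    rw [abs_lt] at hx
    rw [scalingCoeff, if_neg (by linarith), if_neg (by linarith)]
  have b1 : ∀ x : ℝ, L ≤ x → scalingCoeff L θ x = (Complex.exp (Complex.I * θ))⁻¹ := fun x hx => by
    rw [scalingCoeff, if_neg (by linarith), if_pos hx, Complex.exp_neg]
  have b2 : ∀ x : ℝ, L ≤ x → scalingCoeff L θ (-x) = (Complex.exp (-(Complex.I * θ)))⁻¹ :=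
    fun x hx => by
      rw [scalingCoeff, if_pos (by linarith), Complex.exp_neg, inv_inv]
  have hrefl : ∀ {f : ℝ × ℝ → ℂ}, MemLp f 2 (volume.restrict strip) →
      MemLp (fun p => f (refl p)) 2 (volume.restrict strip) := fun hf =>
    hf.comp_measurePreserving (measurePreserving_refl_restrict strip)
  -- On the right Im e^{iθ} > 0 selects the outgoing exponents.
  obtain ⟨c, hr⟩ := hs.exists_extForm hγ hL hP hk0 hk1 hk hH.memLp hH.memLp_x
    (e₀ := Complex.exp (Complex.I * θ)) (by rw [r1]; exact hcos) n1
    (fun x h1 h2 => b0 x (by rw [abs_of_pos h1]; exact h2)) b1 (isExponent_muOut hk0 hk1 hk)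
    (muOut_mul_re_neg hk0 hk1 hk (by rw [r1]; exact hcos) (by rw [i1]; exact hsin))
  -- On the left, seen from the reflected side, Im e^{-iθ} < 0 selects the incoming exponents.
  obtain ⟨d, hl⟩ := hs.reflect.exists_extForm hγ.reflect hL hP.reflect hk0 hk1 hk
    (hrefl hH.memLp) (hrefl hH.memLp_x).neg
    (e₀ := Complex.exp (-(Complex.I * θ))) (by rw [r2]; exact hcos) n2
    (fun x h1 h2 => b0 (-x) (by rw [abs_neg, abs_of_pos h1]; exact h2)) b2
    (isExponent_muIn hk0 hk1 hk)
    (muIn_mul_re_neg hk0 hk1 hk (by rw [r2]; exact hcos) (by rw [i2]; linarith))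
  exact ⟨wx, wy, hH, c, d, hr, hl, hs.exists_biExt hγ hL hP b0 b1 b2 hr hl⟩

/-- If the unscaled function vanishes, so does the eigenfunction. -/
lemma ae_eq_zero_of_unscaled {γ : ℝ × ℝ → ℝ} {L θ k : ℝ} {N : ℕ} {c d μ μ' : ℕ → ℂ}
    {w wx wy ux uy : ℝ × ℝ → ℂ} (hL : 0 < L) (hθ : 0 < Real.cos θ)
    (hr : ExtForm k N c μ (Complex.exp (Complex.I * θ)) L w wx wy)
    (hl : ExtForm k N d μ' (Complex.exp (-(Complex.I * θ))) L (fun p => w (refl p))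
      (fun p => -wx (refl p)) (fun p => wy (refl p)))
    (h0 : unscaled L c μ d μ' w =ᵐ[volume.restrict strip] 0)
    (hB : BiExt γ L k N c μ d μ' (unscaled L c μ d μ' w) ux uy) :
    w =ᵐ[volume.restrict strip] 0 := by
  have hc := hB.right.eq_zero h0
  have hd := hB.left.eq_zero (ae_strip_refl h0)
  filter_upwards [ae_continuation_scalingMap hL hθ hr hl, h0, ae_restrict_of_ae (ae_fst_ne L),
    ae_restrict_of_ae (ae_fst_ne (-L))] with p h1 h2 h3 h4
  rw [← continuation_ofReal hL] at h2
  -- Zero amplitudes make the continuation vanish beyond the interfaces, hence also on the rotated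
  -- half-lines; in the middle w and the unscaled function coincide.
  have hz : ∀ z y, L < |z.re| → continuation L c μ d μ' w z y = 0 := fun z y hz => by
    rw [continuation, hc, hd]
    split_ifs with a1 a2
    · simp [modeSeries]
    · simp [modeSeries]
    · exact absurd hz (not_lt.2 (abs_le.2 ⟨not_lt.1 a2, not_lt.1 a1⟩))
  rcases lt_trichotomy |p.1| L with h | h | h
  · rw [h1, scalingMap_middle h, h2]
  · rcases eq_or_eq_neg_of_abs_eq h with h | h
    · exact absurd h h3
    · exact absurd h h4
  · rw [h1]
    refine hz _ _ ?_
    rcases lt_abs.1 h with h | h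
    · exact lt_abs.2 (Or.inl (scalingMap_right_re hL hθ h))
    · have := scalingMap_left_re (L := L) hθ (x := p.1) (by linarith)
      exact lt_abs.2 (Or.inr (by linarith))

end Waveguide

end

/-! ### The proposition -/

open Waveguide
theorem mainTheorem2
    (γ : ℝ × ℝ → ℝ) (L : ℝ) (hL : 0 < L)
    (hγ_meas : AEMeasurable γ (volume.restrict strip))
    (hγ_pos : ∀ p ∈ strip, 0 < γ p)
    (hγ_bdd : ∃ M : ℝ, ∀ p ∈ strip, γ p ≤ M)
    (hγ_one : ∀ p ∈ strip, L ≤ |p.1| → γ p = 1)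
    (θ : ℝ) (hθ_pos : 0 < θ) (hθ_lt : θ < Real.pi / 2)
    (N : ℕ) (k : ℝ) (hk_gt : N * Real.pi < k) (hk_lt : k < (N + 1) * Real.pi)
    (w : ℝ × ℝ → ℂ) (hw : IsEigenpairB γ L θ ((k ^ 2 : ℝ) : ℂ) w) :
    (∃ τ, IsTraceAt (-L) w τ) ∧
    (∃ u, IsUnscaled L θ w u) ∧
    ∀ τ u, IsTraceAt (-L) w τ → IsUnscaled L θ w u →
      (rho N τ = 0 → IsTrappedMode γ k u ∧ k ^ 2 ∈ trappedSet γ) ∧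
      (0 < rho N τ →
        IsReflectionlessMode γ L k N u ∧
        k ^ 2 ∈ reflectionlessSet γ L ∧
        -- the incident field produces the scattered field `u - u_i`
        (∃ bm bp, IsScatteredField γ L k (incidentCoeff L k N τ)
          (fun p => u p - incident k (incidentCoeff L k N τ) p) bm bp) ∧
        -- every scattered field that it produces decays exponentially on the left
        (∀ us bm bp, IsScatteredField γ L k (incidentCoeff L k N τ) us bm bp →
          ExpDecayLeft L us) ∧
        -- its amplitudes are a non zero element of the kernel of the reflection matrix
        incidentCoeff L k N τ ≠ 0 ∧
        (∀ R, IsReflectionMatrix γ L k N R →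
          Matrix.vecMul (incidentCoeff L k N τ) R = 0)) := by
  have hγ : IsMedium γ L := by
    obtain ⟨M, hM⟩ := hγ_bdd
    exact ⟨hγ_meas, ⟨M, fun p hp => by rw [abs_of_pos (hγ_pos p hp)]; exact hM p hp⟩, hγ_one⟩
  have hk0 : 0 < k := lt_of_le_of_lt (by positivity) hk_gt
  have hcos : 0 < Real.cos θ := Real.cos_pos_of_mem_Ioo ⟨by linarith, hθ_lt⟩
  obtain ⟨wx, wy, hH, c, d, hr, hl, hB⟩ :=
    hw.exists_extForm hγ hL hθ_pos hθ_lt hk_gt hk_lt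
  refine ⟨⟨_, hl.isTraceAt hH⟩, ⟨_, isUnscaled_unscaled hL hcos hr hl⟩, fun τ u hτ hu => ?_⟩
  -- ρ and the amplitudes a_n depend on the trace only through the left amplitudes d_n.
  have hd : ∀ n, modalCoeff τ n = d n := hl.modalCoeff_trace hH hτ
  have hue := hu.ae_eq hL hcos hr hl
  obtain ⟨ux, uy, hB0⟩ := hB
  have hBu := hB0.congr hue
  have hinc : incidentCoeff L k N τ = incAmp k L N d := by
    funext n
    rw [incidentCoeff, hd, incAmp, normFactor]
  constructor
  · intro hρ
    have hd0 : ∀ n ≤ N, d n = 0 := fun n hn => by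
      have := (Finset.sum_eq_zero_iff_of_nonneg fun m _ => by positivity).1 hρ
        ⟨n, Nat.lt_succ_of_le hn⟩ (Finset.mem_univ _)
      rw [hd] at this
      exact norm_eq_zero.1 (pow_eq_zero_iff two_ne_zero |>.1 this)
    -- No incoming wave on the left; by energy balance no outgoing wave on the right either, so only
    -- evanescent modes remain.
    have hT : IsTrappedMode γ k u :=
      ⟨hBu.isSolution, hBu.memLp (hBu.outgoing_eq_zero hγ hL hk_gt hd0) hd0,
        fun h0 => hw.2 (ae_eq_zero_of_unscaled hL hcos hr hl (hue.symm.trans h0) hB0)⟩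
    exact ⟨hT, k, hk0, rfl, u, hT⟩
  · intro hρ
    have hne : incAmp k L N d ≠ 0 := by
      intro h0
      refine hρ.ne' (Finset.sum_eq_zero fun n _ => ?_)
      have h1 := congrFun h0 n
      simp only [incAmp, Pi.zero_apply, mul_eq_zero, Complex.exp_ne_zero,
        normFactor_ne_zero hk0 hk_gt hk_lt, false_or] at h1
      rw [hd, h1, norm_zero, zero_pow two_ne_zero]
    obtain ⟨bm, bp, hbm, hS⟩ := hBu.exists_isScatteredField hk_gt
    rw [hinc]
    have hSo := hS.outgoing
    refine ⟨hBu.isReflectionlessMode hk_gt hne,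
      ⟨N, k, hk_gt, hk_lt, rfl, _, hne, _, bm, bp, hS, fun p => ?_⟩, ⟨bm, bp, hS⟩,
      fun us bm' bp' hS' => ?_, hne, fun R hR => ?_⟩
    · exact (hbm p (Nat.lt_succ_iff.1 p.2)).symm
    -- Both fields have the same incident part, so their difference is an outgoing solution. It
    -- decays on the left, though it need not vanish, trapped modes not being excluded.
    · have hs : IsSolution γ k fun p => us p - (u p - incident k (incAmp k L N d) p) := by
        refine cast (congrArg _ (funext fun p => ?_)) (hS'.solution.sub hγ hBu.isSolution)
        ring
      have h1 := (reflected_unique hγ hL hk0 hk_gt hk_lt hS'.outgoing hSo hs).2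
      have h2 := h1.add (hBu.expDecayLeft_sub_incident hk_gt)
      simpa only [sub_add_cancel] using h2
    -- Superposing the fields of the single waves with weights a_n gives a scattered field for u_i
    -- whose reflected amplitudes are the entries of a R. The field u - u_i has none, and these
    -- amplitudes are unique.
    · choose vs bms bps hvs hbms using hR
      have ho := outgoing_sum Finset.univ (incAmp k L N d) fun n => (hvs n).outgoing
      have hco : (fun m => ∑ n, incAmp k L N d n * edgeAmp k L (bms n) m) =
          edgeAmp k L fun m => ∑ n, incAmp k L N d n * bms n m := by
        funext m
        simp only [edgeAmp, Finset.sum_mul, mul_assoc]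
      rw [hco] at ho
      have hs : IsSolution γ k fun p => (∑ n, incAmp k L N d n * vs n p) -
          (u p - incident k (incAmp k L N d) p) := by
        refine cast (congrArg _ (funext fun p => ?_))
          ((isSolution_sum hγ Finset.univ (incAmp k L N d) fun n => (hvs n).solution).sub hγ
            hBu.isSolution)
        have : ∀ n : Fin (N + 1), incident k (Pi.single n 1) p = modePlus k n p := fun n => by
          simp [incident, Pi.single_apply]
        simp only [this, mul_add, Finset.sum_add_distrib]
        rw [incident]
        ring
      have h1 := (reflected_unique hγ hL hk0 hk_gt hk_lt ho hSo hs).1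
      funext p
      have h2 := h1 p (Nat.lt_succ_iff.1 p.2)
      rw [hbm p (Nat.lt_succ_iff.1 p.2)] at h2
      rw [Pi.zero_apply, ← h2, Matrix.vecMul, dotProduct]
      exact Finset.sum_congr rfl fun n _ => congrArg _ (hbms n p)
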